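/- **Conventions.** Let $G$ be a $3$-dimensional unimodular Lie group ($\operatorname{tr}\operatorname{ad}_X=0$ for all $X$ in its Lie algebra $\mathfrak g$). *Data.* Let $\bar h$ be a left invariant Riemannian metric on $G$, $\mathscr K$ a left invariant $(1,1)$-tensor field on $G$ and $\omega\ge 0$. $(G,\bar h,\mathscr K,\omega)$ are *non-degenerate quiescent Bianchi class A initial data on the singularity for the Einstein–orthogonal stiff fluid equations* if (i) $\operatorname{tr}\mathscr K=1$ and $\mathscr K$ is $\bar h$-symmetric; (ii) $\operatorname{tr}\mathscr K^2+2\omega/3=1$ and $\operatorname{div}_{\bar h}\mathscr K=0$; (iii) the eigenvalues $p_1<p_2<p_3$ of $\mathscr K$ are distinct; (iv) if $\mathscr X_i\in\mathfrak g$ are $\bar h$-unit eigenvectors, $\mathscr K\mathscr X_i=p_i\mathscr X_i$, and $[\mathscr X_i,\mathscr X_j]=\gamma^k_{ij}\mathscr X_k$, then $(\gamma^k_{ij})^2=0$ whenever $\{i,j,k\}=\{1,2,3\}$ and $p_k\le 0$. *Developments.* A *Bianchi class A stiff fluid development* on $G$ consists of an open interval $I=(t_-,t_+)$, $-\infty\le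 t_-<t_+\le\infty$, a Lorentz metric $g=-dt\otimes dt+\sum_i a_i^2(t)\,\eta^i\otimes\eta^i$ on $G\times I$ and a smooth energy density $\rho=\rho(t)\ge 0$, where the $a_i$ are smooth and positive and $\{\eta^i\}$ is dual to a basis $\{f_i\}$ of $\mathfrak g$ with $[f_i,f_j]=\epsilon_{ijk}n_kf_k$ (no summation on $k$) for constants $n_k$, such that Einstein's equations $\mathrm{Ric}-\tfrac12 Sg=T$ hold with $T=(\rho+p)\,dt\otimes dt+p\,g$, $p=\rho$, and such that $I$ is the maximal existence interval, i.e. $(g,\rho)$ does not extend to a solution of this form on a strictly larger open interval. It is a vacuum development if $\rho\equiv0$. Let $\bar K$ be the Weingarten map of $G\times\{t\}$ (the second fundamental form $\tfrac12\partial_t g_t$ of the induced metric $g_t$, with one index raised by $g_t$), $\theta=\operatorname{tr}\bar K$ the mean curvature, $\mathcal K=\bar K/\theta$ and $\Omega=3\rho/\theta^2$. **Theorem.** Let $(G,\bar h,\mathscr K,\omega)$ be non-degenerate quiescent Bianchi class A initial data on the singularity for the Einstein–orthogonal stiff fluid equations. Then there is a Bianchi class A stiff fluid development $(G\times I,g,\rho)$,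 unique up to translations of the time coordinate $t$, such that $\theta\to\infty$ as $t\to t_-$ and such that the following holds: 1. $\mathcal K\to\mathscr K$ and $\Omega\to\omega$ as $t\to t_-$. 2. If $\{e_i\}$ is a basis of $\mathfrak g$ with $\mathscr Ke_i=p_ie_i$ (no summation), $p_1<p_2<p_3$, and $\{\xi^i\}$ is the dual basis, then there are $t_0\in I$ and positive functions $b_i$ of $t$ such that for $t\in I$, $t\le t_0$, one has $\theta>0$ and $$g=-dt\otimes dt+\sum_i b_i^2\,\theta^{-2p_i}\,\xi^i\otimes\xi^i.$$ 3. For these $b_i$, $\lim_{t\to t_-}\sum_i b_i^2\,\xi^i\otimes\xi^i=\bar h$. If $\omega=0$, the development is a vacuum development. -/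

import Mathlib

open Filter Topology Manifold
open scoped ContDiff

namespace Bianchi

noncomputable section

/-! ### Left invariant tensor fields on a three dimensional Lie group -/

section LieGroups

variable (G : Type*) [TopologicalSpace G] [ChartedSpace (EuclideanSpace ℝ (Fin 3)) G] [Group G]

/-- The Lie algebra of `G`: the tangent space at the identity, with the bracket of left invariant
vector fields. -/
abbrev Alg : Type _ := GroupLieAlgebra (𝓡 3) G

/-- A smooth Lie group has the regularity that Mathlib asks for in order to make the tangent space
at the identity a Lie algebra. -/
instance instLieGroupMinSmoothness [LieGroup (𝓡 3) ∞ G] :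
    LieGroup (𝓡 3) (minSmoothness ℝ 3) G :=
  LieGroup.of_le (n := ∞) (by
    rw [minSmoothness_of_isRCLikeNormedField]; exact WithTop.coe_le_coe.2 le_top)

/-- A left invariant Riemannian metric on `G`: an inner product on each tangent space, such that
the left translations are isometries. -/
structure LeftInvariantMetric where
  /-- the inner product on the tangent space at `x` -/
  form : ∀ x : G, LinearMap.BilinForm ℝ (TangentSpace (𝓡 3) x)
  symm : ∀ x v w, form x v w = form x w v
  pos : ∀ x v, v ≠ 0 → 0 < form x v v
  leftInvariant : ∀ (y x : G) (v w : TangentSpace (𝓡 3) x),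
    form (y * x) (mfderiv (𝓡 3) (𝓡 3) (fun z : G => y * z) x v)
      (mfderiv (𝓡 3) (𝓡 3) (fun z : G => y * z) x w) = form x v w

/-- A left invariant `(1,1)`-tensor field on `G`: a field of endomorphisms of the tangent spaces
which commutes with the differentials of the left translations. -/
structure LeftInvariantEndomorphism where
  /-- the endomorphism of the tangent space at `x` -/
  map : ∀ x : G, Module.End ℝ (TangentSpace (𝓡 3) x)
  leftInvariant : ∀ (y x : G) (v : TangentSpace (𝓡 3) x),
    map (y * x) (mfderiv (𝓡 3) (𝓡 3) (fun z : G => y * z) x v) =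
      mfderiv (𝓡 3) (𝓡 3) (fun z : G => y * z) x (map x v)

/-- `G` is unimodular (Bianchi class A): `tr (ad X) = 0` for every `X` in the Lie algebra. -/
def IsUnimodular [LieGroup (𝓡 3) ∞ G] : Prop :=
  ∀ X : Alg G, LinearMap.trace ℝ (Alg G) (LieAlgebra.ad ℝ (Alg G) X) = 0

variable {G}

/-- The value of a left invariant metric on two left invariant vector fields (a constant function,
hence evaluated at the identity). -/
def LeftInvariantMetric.onAlg (h : LeftInvariantMetric G) (X Y : Alg G) : ℝ := h.form 1 X Y

/-- A left invariant endomorphism field, as an endomorphism of the Lie algebra. -/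
def LeftInvariantEndomorphism.onAlg (K : LeftInvariantEndomorphism G) : Module.End ℝ (Alg G) :=
  K.map 1

/-- The structure constants: `[e_i, e_j] = ∑ k, γ^k_{ij} e_k`. -/
def structureConst (e : Module.Basis (Fin 3) ℝ (Alg G)) (i j k : Fin 3) : ℝ :=
  e.repr ⁅e i, e j⁆ k

end LieGroups

/-! ### Levi-Civita connection and Ricci curvature in a frame

A frame `(E_a)` is given, in which `[E_a, E_b] = ∑ d, c a b d • E_d` with constants `c a b d`, and
in which the metric components `g_{ab} = g(E_a, E_b)` are functions of one real variable `t` only;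
`D a f` stands for the derivative of such a function `f` in the direction `E_a`. All formulas are
the usual ones for the Levi-Civita connection and its curvature in a (non-coordinate) frame. -/

section Frames

variable {ι : Type*} [Fintype ι] [DecidableEq ι]
  (D : ι → (ℝ → ℝ) → ℝ → ℝ) (c : ι → ι → ι → ℝ) (g : ℝ → Matrix ι ι ℝ)

/-- `g(∇_{E_a} E_b, E_d)`, by the Koszul formula. -/
def koszul (a b d : ι) (t : ℝ) : ℝ :=
  (1 / 2) * (D a (fun s => g s b d) t + D b (fun s => g s a d) t - D d (fun s => g s a b) t
    + ∑ f, (c a b f * g t f d - c a d f * g t f b - c b d f * g t f a))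

/-- The connection coefficients: `∇_{E_a} E_b = ∑ d, Γ a b d • E_d`. -/
def christoffel (a b d : ι) (t : ℝ) : ℝ :=
  ∑ f, koszul D c g a b f t * (g t)⁻¹ f d

/-- The Ricci tensor `Ric(E_b, E_d)`, the trace of `Z ↦ R(Z, E_b) E_d`, where
`R(X, Y) Z = ∇_X ∇_Y Z - ∇_Y ∇_X Z - ∇_{[X, Y]} Z`. -/
def ricci (b d : ι) (t : ℝ) : ℝ :=
  ∑ a, (D a (fun s => christoffel D c g b d a s) t - D b (fun s => christoffel D c g a d a s) t
    + ∑ f, (christoffel D c g b d f t * christoffel D c g a f a t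
      - christoffel D c g a d f t * christoffel D c g b f a t
      - c a b f * christoffel D c g f d a t))

/-- The scalar curvature. -/
def scalarCurvature (t : ℝ) : ℝ :=
  ∑ a, ∑ b, (g t)⁻¹ a b * ricci D c g a b t

/-- The Einstein tensor `Ric - (1/2) S g`. -/
def einstein (a b : ι) (t : ℝ) : ℝ :=
  ricci D c g a b t - (1 / 2) * scalarCurvature D c g t * g t a b

end Frames

/-! ### Data on the singularity -/

section Data

variable {G : Type*} [TopologicalSpace G] [ChartedSpace (EuclideanSpace ℝ (Fin 3)) G] [Group G]

/-- The component `(div_h K)(e_j) = ∑ i, [(∇_{e_i} K)(e_j)]^i` of the divergence of `K`, where `∇`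
is the Levi-Civita connection of `h` and `e` is a left invariant frame. Here the components of `h`
and `K` are constants, so the directional derivatives vanish. -/
def divergence (h : LeftInvariantMetric G) (K : LeftInvariantEndomorphism G)
    (e : Module.Basis (Fin 3) ℝ (Alg G)) (j : Fin 3) : ℝ :=
  let Γ : Fin 3 → Fin 3 → Fin 3 → ℝ := fun a b d =>
    christoffel (fun _ _ _ => 0) (structureConst e) (fun _ => Matrix.of fun i j => h.onAlg (e i) (e j))
      a b d 0
  let k : Fin 3 → Fin 3 → ℝ := fun m j => e.repr (K.onAlg (e j)) m
  ∑ i, ∑ m, (k m j * Γ i m i - Γ i j m * k i m)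

/-- `e` is a basis of the Lie algebra consisting of eigenvectors of `K`, `K e_i = p_i e_i`, with
`p_1 < p_2 < p_3`. -/
structure IsEigenframe (K : LeftInvariantEndomorphism G)
    (e : Module.Basis (Fin 3) ℝ (Alg G)) (p : Fin 3 → ℝ) : Prop where
  strictMono : StrictMono p
  eigen : ∀ i, K.onAlg (e i) = p i • e i

/-- `(G, h, K, Ω₀)` are non-degenerate quiescent Bianchi class A initial data on the singularity for
the Einstein-orthogonal stiff fluid equations. -/
structure IsQuiescentData [LieGroup (𝓡 3) ∞ G] (h : LeftInvariantMetric G)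
    (K : LeftInvariantEndomorphism G) (Ω₀ : ℝ) : Prop where
  unimodular : IsUnimodular G
  nonneg : 0 ≤ Ω₀
  trace_eq : LinearMap.trace ℝ (Alg G) K.onAlg = 1
  symm : ∀ X Y : Alg G, h.onAlg (K.onAlg X) Y = h.onAlg X (K.onAlg Y)
  trace_sq : LinearMap.trace ℝ (Alg G) (K.onAlg * K.onAlg) + 2 * Ω₀ / 3 = 1
  div_eq : ∀ (e : Module.Basis (Fin 3) ℝ (Alg G)) (j : Fin 3), divergence h K e j = 0
  distinct : ∃ p : Fin 3 → ℝ, Function.Injective p ∧ ∀ i, Module.End.HasEigenvalue K.onAlg (p i)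
  quiescent : ∀ (e : Module.Basis (Fin 3) ℝ (Alg G)) (p : Fin 3 → ℝ), IsEigenframe K e p →
    (∀ i, h.onAlg (e i) (e i) = 1) →
    ∀ i j k : Fin 3, i ≠ j → j ≠ k → i ≠ k → p k ≤ 0 → structureConst e i j k ^ 2 = 0

end Data

/-! ### Spatially homogeneous spacetimes and developments -/

section Spacetimes

variable (G : Type*) [TopologicalSpace G] [ChartedSpace (EuclideanSpace ℝ (Fin 3)) G] [Group G]

/-- The manifold `G × I`, where `I = (t₋, t₊)` with `-∞ ≤ t₋ < t₊ ≤ ∞`, with the Lorentz metric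
`-dt ⊗ dt + g_t`, where the `g_t` are left invariant metrics on `G`, and with an energy density
`ρ` depending on `t` only. The values of `metric` and `ρ` outside `I` carry no information. -/
structure Spacetime where
  /-- the left endpoint `t₋` of the existence interval -/
  tMinus : EReal
  /-- the right endpoint `t₊` of the existence interval -/
  tPlus : EReal
  lt : tMinus < tPlus
  /-- the metric `g_t` induced on `G × {t}` -/
  metric : ℝ → LeftInvariantMetric G
  /-- the energy density -/
  ρ : ℝ → ℝ

variable {G}

namespace Spacetime

/-- The existence interval. -/
def interval (M : Spacetime G) : Set ℝ := {t : ℝ | M.tMinus < (t : EReal) ∧ (t : EReal) < M.tPlus}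

/-- The filter `t → t₋` from the right, also if `t₋ = -∞`. -/
def atLeftEnd (M : Spacetime G) : Filter ℝ := comap (fun t : ℝ => (t : EReal)) (𝓝[>] M.tMinus)

/-- The Weingarten map of `G × {t}` with respect to `∂_t`, on left invariant vector fields: the
unique endomorphism `W` with `g_t(W X, Y) = k(X, Y)`, where `k = (1/2) ∂_t g_t` is the second
fundamental form. -/
def weingarten (M : Spacetime G) (t : ℝ) : Module.End ℝ (Alg G) :=
  Classical.epsilon fun W : Module.End ℝ (Alg G) => ∀ X Y : Alg G,
    (M.metric t).onAlg (W X) Y = (1 / 2) * deriv (fun s => (M.metric s).onAlg X Y) t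

/-- The mean curvature `θ` of `G × {t}`, the trace of the Weingarten map. -/
def θ (M : Spacetime G) (t : ℝ) : ℝ := LinearMap.trace ℝ (Alg G) (M.weingarten t)

/-- The expansion normalised Weingarten map. -/
def normalisedWeingarten (M : Spacetime G) (t : ℝ) : Module.End ℝ (Alg G) :=
  (M.θ t)⁻¹ • M.weingarten t

/-- `Ω = 3ρ/θ²`. -/
def Ω (M : Spacetime G) (t : ℝ) : ℝ := 3 * M.ρ t / M.θ t ^ 2

/-! The frame `(∂_t, e_1, e_2, e_3)` of `G × I`, where the `e_i` are left invariant vector fields;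
`none` stands for `∂_t` and `some i` for `e_i`. -/

/-- Derivatives of functions of `t` in the directions of the frame. -/
def frameDeriv : Option (Fin 3) → (ℝ → ℝ) → ℝ → ℝ
  | none, f, t => deriv f t
  | some _, _, _ => 0

/-- The structure constants of the frame: `[∂_t, e_i] = 0`, `[e_i, e_j] = ∑ k, γ^k_{ij} e_k`. -/
def frameStructure (e : Module.Basis (Fin 3) ℝ (Alg G)) :
    Option (Fin 3) → Option (Fin 3) → Option (Fin 3) → ℝ
  | some i, some j, some k => structureConst e i j k
  | _, _, _ => 0

/-- The components of the spacetime metric `-dt ⊗ dt + g_t` in the frame. -/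
def frameMetric (M : Spacetime G) (e : Module.Basis (Fin 3) ℝ (Alg G)) (t : ℝ) :
    Matrix (Option (Fin 3)) (Option (Fin 3)) ℝ :=
  Matrix.of fun
    | none, none => -1
    | some i, some j => (M.metric t).onAlg (e i) (e j)
    | _, _ => 0

/-- The components of the stress energy tensor `(ρ + p) dt ⊗ dt + p g` of an orthogonal stiff
fluid, `p = ρ`. -/
def frameStress (M : Spacetime G) (e : Module.Basis (Fin 3) ℝ (Alg G)) (a b : Option (Fin 3))
    (t : ℝ) : ℝ :=
  (M.ρ t + M.ρ t) * (if a = none ∧ b = none then 1 else 0) + M.ρ t * M.frameMetric e t a b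

/-- `M` is a Bianchi class A orthogonal stiff fluid solution: with respect to a basis `e` of the
Lie algebra with `[e_i, e_j] = ε_{ijk} n_k e_k`, the metric is `-dt ⊗ dt + ∑ a_i² ξ^i ⊗ ξ^i`, where
`ξ` is the dual basis and the `a_i` are smooth and positive; `ρ ≥ 0` is smooth; and Einstein's
equations are satisfied. The case `ρ = 0` is the vacuum case. -/
def IsStiffFluidSolution [LieGroup (𝓡 3) ∞ G] (M : Spacetime G) : Prop :=
  ∃ (e : Module.Basis (Fin 3) ℝ (Alg G)) (n : Fin 3 → ℝ) (a : Fin 3 → ℝ → ℝ),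
    (⁅e 1, e 2⁆ = n 0 • e 0 ∧ ⁅e 2, e 0⁆ = n 1 • e 1 ∧ ⁅e 0, e 1⁆ = n 2 • e 2) ∧
    (∀ i, ContDiffOn ℝ ∞ (a i) M.interval) ∧
    (∀ i, ∀ t ∈ M.interval, 0 < a i t) ∧
    (∀ t ∈ M.interval, ∀ X Y : Alg G,
      (M.metric t).onAlg X Y = ∑ i, a i t ^ 2 * (e.repr X i * e.repr Y i)) ∧
    ContDiffOn ℝ ∞ M.ρ M.interval ∧
    (∀ t ∈ M.interval, 0 ≤ M.ρ t) ∧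
    ∀ t ∈ M.interval, ∀ b d : Option (Fin 3),
      einstein frameDeriv (frameStructure e) (M.frameMetric e) b d t = M.frameStress e b d t

/-- `M'` extends `M`. -/
def IsExtension (M' M : Spacetime G) : Prop :=
  M'.tMinus ≤ M.tMinus ∧ M.tPlus ≤ M'.tPlus ∧
    ∀ t ∈ M.interval, M'.metric t = M.metric t ∧ M'.ρ t = M.ρ t

/-- `M` is a Bianchi class A orthogonal stiff fluid (or vacuum) development: a solution on its
maximal existence interval. -/
def IsDevelopment [LieGroup (𝓡 3) ∞ G] (M : Spacetime G) : Prop :=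
  M.IsStiffFluidSolution ∧
    ∀ M' : Spacetime G, M'.IsStiffFluidSolution → M'.IsExtension M →
      M'.tMinus = M.tMinus ∧ M'.tPlus = M.tPlus

/-- `M` induces the data `(h, K, Ω₀)` on the singularity at `t₋`:
`θ → ∞`, `𝒦 → K` and `Ω → Ω₀` as `t → t₋`; and in every eigenframe of `K`, with dual basis `ξ`, the
metric takes the form `-dt ⊗ dt + ∑ b_i² θ^{-2 p_i} ξ^i ⊗ ξ^i` for `t ≤ t₀`, where
`∑ b_i² ξ^i ⊗ ξ^i → h` as `t → t₋`. -/
structure InducesData (M : Spacetime G) (h : LeftInvariantMetric G)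
    (K : LeftInvariantEndomorphism G) (Ω₀ : ℝ) : Prop where
  crushing : Tendsto M.θ M.atLeftEnd atTop
  weingarten_tendsto : ∀ X : Alg G,
    Tendsto (fun t => M.normalisedWeingarten t X) M.atLeftEnd (𝓝 (K.onAlg X))
  Ω_tendsto : Tendsto M.Ω M.atLeftEnd (𝓝 Ω₀)
  metric_form : ∀ (e : Module.Basis (Fin 3) ℝ (Alg G)) (p : Fin 3 → ℝ), IsEigenframe K e p →
    ∃ t₀ ∈ M.interval, ∃ b : Fin 3 → ℝ → ℝ,
      (∀ t ∈ M.interval, t ≤ t₀ → 0 < M.θ t ∧ (∀ i, 0 < b i t) ∧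
        ∀ X Y : Alg G, (M.metric t).onAlg X Y =
          ∑ i, b i t ^ 2 * M.θ t ^ (-2 * p i) * (e.repr X i * e.repr Y i)) ∧
      ∀ X Y : Alg G, Tendsto (fun t => ∑ i, b i t ^ 2 * (e.repr X i * e.repr Y i))
        M.atLeftEnd (𝓝 (h.onAlg X Y))

/-- `M'` is obtained from `M` by the translation `t ↦ t + τ` of the time coordinate. -/
def IsTimeTranslate (M' M : Spacetime G) (τ : ℝ) : Prop :=
  M'.tMinus = M.tMinus + (τ : EReal) ∧ M'.tPlus = M.tPlus + (τ : EReal) ∧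
    ∀ t ∈ M.interval, M'.metric (t + τ) = M.metric t ∧ M'.ρ (t + τ) = M.ρ t

end Spacetime

end Spacetimes

end

end Bianchi

namespace Bianchi

open Set MeasureTheory

/-! ### Scalar differential inequalities on a half line -/

/-! Write V = a₀a₁a₂ for the volume factor of the slices.

The data single out a frame. In an `h`-orthonormal eigenframe of `K`, vanishing divergence and
unimodularity, combined with distinctness of the eigenvalues, kill every structure constant γ^k_{ij}
except those with i, j, k distinct. The frame is therefore of class A with constants n_k, and
quiescence says that n_k ≠ 0 only where p_k > 0 (`IsQuiescentData.exists_frame`). Conversely, the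
frame of any solution with 𝒦 → K consists of eigenvectors of K, so it agrees with this one up to
order and scaling. Everything thus takes place in one fixed frame, where Einstein's equations are an
autonomous ODE for α_i = log a_i and H_i = α_i', with ρ read off from the Hamiltonian constraint
(`IsDiagonalOn.einstein_iff`).

For this ODE, inducing the data means being asymptotic to a Kasner solution once the singularity is
moved to t = 0: t H_i → p_i and α_i - p_i log t → 0. The link between θ and t is V' = Vθ together
with Vθ → 1. Moreover V²ρ is conserved and equals Ω₀/3, which gives ρ ≥ 0, the limit of Ω and the
vacuum case.

The heart of the matter is that exactly one orbit has prescribed Kasner asymptotics. In the time s =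
log t, the deviations of V H_i, α_i, V/t from p_i, p_i s, 1 obey a system whose only source is
quadratic in the n_i a_i². If 0 < κ ≤ p_i whenever n_i ≠ 0, this source is O(e^{4κs}) as s → -∞.
Dividing the deviations by e^{κs} produces damping of rate at least κ, and the additional weights
l², 1, l make all couplings small. What remains is a small Lipschitz perturbation of u' = -νu, and
such a system has exactly one small bounded solution near -∞, by contraction of the Duhamel integral
from -∞ (`exists_bounded_dissipative`, `dissipative_unique`). Every decaying solution decays fast
enough to stay bounded after rescaling (`IsLogSolution.exists_exp_bound`), so there is no other one.

The orbit is continued as far as possible (`exists_maximal_solution`). It cannot be continued to the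
left because θ blows up. Any other development with the same data, translated in time, agrees with
it near t = 0 and hence sits inside it; the maximality of that development forces equality. -/

theorem tendsto_exp_mul_atBot {μ : ℝ} (hμ : 0 < μ) :
    Tendsto (fun s => Real.exp (μ * s)) atBot (𝓝 0) :=
  Real.tendsto_exp_atBot.comp (tendsto_id.const_mul_atBot hμ)

theorem hasDerivAt_exp_mul (μ s : ℝ) :
    HasDerivAt (fun s => Real.exp (μ * s)) (μ * Real.exp (μ * s)) s := by
  simpa [mul_comm] using ((hasDerivAt_id s).const_mul μ).exp

/-- The difference of `f` and the claimed bound is antitone and tends to 0 at -∞, hence is nowhere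
positive. -/
theorem le_exp_of_deriv_le_exp {f f' : ℝ → ℝ} {s₀ C μ : ℝ} (hμ : 0 < μ)
    (hf : ∀ s < s₀, HasDerivAt f (f' s) s) (hb : ∀ s < s₀, f' s ≤ C * Real.exp (μ * s))
    (hlim : Tendsto f atBot (𝓝 0)) {s : ℝ} (hs : s < s₀) : f s ≤ C / μ * Real.exp (μ * s) := by
  set g : ℝ → ℝ := fun s => f s - C / μ * Real.exp (μ * s) with hg
  have hd : ∀ s < s₀, HasDerivAt g (f' s - C * Real.exp (μ * s)) s := fun s hs => by
    refine ((hf s hs).sub ((hasDerivAt_exp_mul μ s).const_mul (C / μ))).congr_deriv ?_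
    field_simp
  have hanti : AntitoneOn g (Iio s₀) := by
    apply antitoneOn_of_deriv_nonpos (convex_Iio s₀)
      (fun s hs => (hd s hs).continuousAt.continuousWithinAt)
    · intro s hs
      rw [interior_Iio] at hs
      exact (hd s hs).differentiableAt.differentiableWithinAt
    · intro s hs
      rw [interior_Iio] at hs
      rw [(hd s hs).deriv]
      linarith [hb s hs]
  have hl : Tendsto g atBot (𝓝 0) := by
    simpa using hlim.sub ((tendsto_exp_mul_atBot hμ).const_mul (C / μ))
  have : g s ≤ 0 := by
    refine ge_of_tendsto hl ?_
    filter_upwards [eventually_le_atBot s] with r hr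
    exact hanti (show r < s₀ from hr.trans_lt hs) hs hr
  simp only [hg] at this
  linarith

theorem abs_le_exp_of_abs_deriv_le_exp {f f' : ℝ → ℝ} {s₀ C μ : ℝ} (hμ : 0 < μ)
    (hf : ∀ s < s₀, HasDerivAt f (f' s) s) (hb : ∀ s < s₀, |f' s| ≤ C * Real.exp (μ * s))
    (hlim : Tendsto f atBot (𝓝 0)) {s : ℝ} (hs : s < s₀) : |f s| ≤ C / μ * Real.exp (μ * s) := by
  rw [abs_le]
  constructor
  · have := le_exp_of_deriv_le_exp (f := fun s => - f s) hμ (fun s hs => (hf s hs).neg)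
      (fun s hs => (neg_le_abs _).trans (hb s hs)) (by simpa using hlim.neg) hs
    linarith
  · exact le_exp_of_deriv_le_exp hμ hf (fun s hs => (le_abs_self _).trans (hb s hs)) hlim hs

/-- Boundedness excludes the homogeneous solution e^{-νs}, which blows up at -∞: e^{νs} f tends to 0
there and has derivative e^{νs} h. The a priori bound `D` is purely qualitative and leaves no trace
in the conclusion. -/
theorem abs_le_of_dissipative {f h : ℝ → ℝ} {s₀ C D ν : ℝ} (hν : 0 < ν)
    (hf : ∀ s < s₀, HasDerivAt f (-ν * f s + h s) s) (hh : ∀ s < s₀, |h s| ≤ C)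
    (hD : ∀ s < s₀, |f s| ≤ D) {s : ℝ} (hs : s < s₀) : |f s| ≤ C / ν := by
  have hlim : Tendsto (fun s => Real.exp (ν * s) * f s) atBot (𝓝 0) := by
    apply squeeze_zero_norm' (a := fun s => Real.exp (ν * s) * D)
    · filter_upwards [eventually_lt_atBot s₀] with s hs
      rw [norm_mul, Real.norm_eq_abs, Real.norm_eq_abs, abs_of_pos (Real.exp_pos _)]
      exact mul_le_mul_of_nonneg_left (hD s hs) (Real.exp_pos _).le
    · simpa using (tendsto_exp_mul_atBot hν).mul_const D
  have := abs_le_exp_of_abs_deriv_le_exp (f := fun s => Real.exp (ν * s) * f s)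
    (f' := fun s => Real.exp (ν * s) * h s) (C := C) hν
    (fun s hs => ((hasDerivAt_exp_mul ν s).mul (hf s hs)).congr_deriv (by ring))
    (fun s hs => by
      rw [abs_mul, abs_of_pos (Real.exp_pos _), mul_comm]
      exact mul_le_mul_of_nonneg_right (hh s hs) (Real.exp_pos _).le) hlim hs
  rw [abs_mul, abs_of_pos (Real.exp_pos _), mul_comm] at this
  exact le_of_mul_le_mul_right this (Real.exp_pos _)

/-! ### Bounded solutions of dissipative equations -/

/-- The bounded solution of `f' = -ν f + h`. -/
noncomputable def dissipativeSolution (ν : ℝ) (h : ℝ → ℝ) (s : ℝ) : ℝ :=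
  Real.exp (-ν * s) * ∫ r in Iic s, Real.exp (ν * r) * h r

theorem integrableOn_exp_mul_bounded {ν C : ℝ} (hν : 0 < ν) {h : ℝ → ℝ} (hc : Continuous h)
    (hC : ∀ s, |h s| ≤ C) (s : ℝ) : IntegrableOn (fun r => Real.exp (ν * r) * h r) (Iic s) := by
  refine Integrable.mono' ((integrableOn_exp_mul_Iic hν s).mul_const C)
    (by fun_prop) (ae_of_all _ fun r => ?_)
  rw [norm_mul, Real.norm_eq_abs, Real.norm_eq_abs, abs_of_pos (Real.exp_pos _)]
  exact mul_le_mul_of_nonneg_left (hC r) (Real.exp_pos _).le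

theorem hasDerivAt_dissipativeSolution {ν C : ℝ} (hν : 0 < ν) {h : ℝ → ℝ} (hc : Continuous h)
    (hC : ∀ s, |h s| ≤ C) (s : ℝ) :
    HasDerivAt (dissipativeSolution ν h) (-ν * dissipativeSolution ν h s + h s) s := by
  have hI := integrableOn_exp_mul_bounded hν hc hC
  have h1 : HasDerivAt (fun s => ∫ r in Iic s, Real.exp (ν * r) * h r)
      (Real.exp (ν * s) * h s) s := by
    have : (fun s => ∫ r in Iic s, Real.exp (ν * r) * h r) = fun s =>
        (∫ r in (0 : ℝ)..s, Real.exp (ν * r) * h r) + ∫ r in Iic 0, Real.exp (ν * r) * h r := by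
      funext s
      rw [← intervalIntegral.integral_Iic_sub_Iic (hI 0) (hI s)]
      ring
    rw [this]
    apply HasDerivAt.add_const
    have hcont : Continuous fun r => Real.exp (ν * r) * h r := by fun_prop
    exact hcont.integral_hasStrictDerivAt 0 s |>.hasDerivAt
  refine ((hasDerivAt_exp_mul (-ν) s).mul h1).congr_deriv ?_
  rw [← mul_assoc (Real.exp (-ν * s)), ← Real.exp_add, dissipativeSolution]
  simp [mul_assoc]

theorem abs_dissipativeSolution_le {ν C : ℝ} (hν : 0 < ν) {h : ℝ → ℝ} (hc : Continuous h)
    (hC : ∀ s, |h s| ≤ C) (s : ℝ) : |dissipativeSolution ν h s| ≤ C / ν := by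
  have hI := integrableOn_exp_mul_bounded hν hc hC s
  have h1 : |∫ r in Iic s, Real.exp (ν * r) * h r| ≤ ∫ r in Iic s, Real.exp (ν * r) * C := by
    refine (abs_integral_le_integral_abs).trans ?_
    refine integral_mono hI.abs ((integrableOn_exp_mul_Iic hν s).mul_const C) fun r => ?_
    simp only [abs_mul, abs_of_pos (Real.exp_pos _)]
    exact mul_le_mul_of_nonneg_left (hC r) (Real.exp_pos _).le
  rw [integral_mul_const, integral_exp_mul_Iic hν] at h1
  rw [dissipativeSolution, abs_mul, abs_of_pos (Real.exp_pos _)]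
  refine (mul_le_mul_of_nonneg_left h1 (Real.exp_pos _).le).trans (le_of_eq ?_)
  have : Real.exp (-ν * s) * Real.exp (ν * s) = 1 := by rw [← Real.exp_add]; simp
  rw [← mul_div_right_comm, ← mul_div_assoc, ← mul_assoc, this, one_mul]

/-- One step of the contraction, with factor K/κ. Existence uses it as the contraction estimate,
uniqueness iterates it; as before, `C` is only a qualitative bound. -/
theorem abs_sub_le_of_dissipative {ι : Type*} [Fintype ι] {ν : ι → ℝ} {κ : ℝ} (hκ : 0 < κ)
    (hν : ∀ i, κ ≤ ν i) {K s₀ C D : ℝ} (hK : 0 ≤ K) {u v gu gv : ℝ → ι → ℝ}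
    (hu : ∀ s < s₀, ∀ i, HasDerivAt (fun r => u r i) (-ν i * u s i + gu s i) s)
    (hv : ∀ s < s₀, ∀ i, HasDerivAt (fun r => v r i) (-ν i * v s i + gv s i) s)
    (hC : ∀ s < s₀, ‖u s - v s‖ ≤ C)
    (hg : ∀ s < s₀, ‖gu s - gv s‖ ≤ K * D) (hD : 0 ≤ D) {s : ℝ} (hs : s < s₀) :
    ‖u s - v s‖ ≤ K / κ * D := by
  rw [pi_norm_le_iff_of_nonneg (by positivity)]
  intro i
  have hνi : 0 < ν i := hκ.trans_le (hν i)
  have := abs_le_of_dissipative (f := fun r => u r i - v r i) (h := fun r => gu r i - gv r i)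
    (C := K * D) (D := C) hνi
    (fun s hs => ((hu s hs i).sub (hv s hs i)).congr_deriv (by ring))
    (fun s hs => (norm_le_pi_norm (gu s - gv s) i).trans (hg s hs))
    (fun s hs => (norm_le_pi_norm (u s - v s) i).trans (hC s hs)) hs
  refine this.trans ?_
  rw [div_mul_eq_mul_div]
  exact div_le_div_of_nonneg_left (by positivity) hκ (hν i)

/-- Banach's fixed point theorem for the Duhamel integral from -∞, on bounded continuous curves. The
bound comes from ‖u‖ ≤ (C + K‖u‖)/κ at the fixed point. -/
theorem exists_bounded_dissipative {ι : Type*} [Fintype ι] {ν : ι → ℝ} {κ : ℝ} (hκ : 0 < κ)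
    (hν : ∀ i, κ ≤ ν i) {K C : ℝ} (hK : 0 ≤ K) (hKκ : K < κ) {g : ℝ → (ι → ℝ) → ι → ℝ}
    (hgc : Continuous (Function.uncurry g)) (hg : ∀ s u v, ‖g s u - g s v‖ ≤ K * ‖u - v‖)
    (hg0 : ∀ s, ‖g s 0‖ ≤ C) :
    ∃ u : ℝ → ι → ℝ, (∀ s, ‖u s‖ ≤ C / (κ - K)) ∧
      ∀ s i, HasDerivAt (fun r => u r i) (-ν i * u s i + g s (u s) i) s := by
  have hC : 0 ≤ C := (norm_nonneg _).trans (hg0 0)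
  have hgb : ∀ s u, ‖g s u‖ ≤ C + K * ‖u‖ := fun s u => by
    have h1 := norm_add_le (g s 0) (g s u - g s 0)
    have h2 := hg s u 0
    rw [add_sub_cancel] at h1
    rw [sub_zero] at h2
    linarith [hg0 s]
  let B := BoundedContinuousFunction ℝ (ι → ℝ)
  have hcont : ∀ (u : B) i, Continuous fun r => g r (u r) i := fun u i =>
    (continuous_apply i).comp (hgc.comp (continuous_id.prodMk u.continuous))
  have hbd : ∀ (u : B) i r, |g r (u r) i| ≤ C + K * ‖u‖ := fun u i r =>
    (norm_le_pi_norm (g r (u r)) i).trans ((hgb r (u r)).trans (by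
      have := mul_le_mul_of_nonneg_left (u.norm_coe_le_norm r) hK
      linarith))
  have hνp : ∀ i, 0 < ν i := fun i => hκ.trans_le (hν i)
  let S : B → ℝ → ι → ℝ := fun u s i => dissipativeSolution (ν i) (fun r => g r (u r) i) s
  have hSd : ∀ u s i, HasDerivAt (fun r => S u r i) (-ν i * S u s i + g s (u s) i) s :=
    fun u s i => hasDerivAt_dissipativeSolution (hνp i) (hcont u i) (hbd u i) s
  have hSb : ∀ u s, ‖S u s‖ ≤ (C + K * ‖u‖) / κ := fun u s => by
    rw [pi_norm_le_iff_of_nonneg (by positivity)]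
    intro i
    refine (abs_dissipativeSolution_le (hνp i) (hcont u i) (hbd u i) s).trans ?_
    exact div_le_div_of_nonneg_left (by positivity) hκ (hν i)
  let T : B → B := fun u => BoundedContinuousFunction.ofNormedAddCommGroup (S u)
    (continuous_pi fun i => continuous_iff_continuousAt.2 fun s => (hSd u s i).continuousAt)
    _ (hSb u)
  have hT : ContractingWith (Real.toNNReal (K / κ)) T := by
    refine ⟨by rw [Real.toNNReal_lt_one]; exact (div_lt_one hκ).2 hKκ, ?_⟩
    refine LipschitzWith.of_dist_le_mul fun u v => ?_
    rw [Real.coe_toNNReal _ (by positivity)]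
    rw [dist_eq_norm, dist_eq_norm]
    refine (BoundedContinuousFunction.norm_le (by positivity)).2 fun s => ?_
    -- The estimate lives on an open half line, so it is taken up to `s + 1`. Any finite number
    -- serves as qualitative bound, in particular ‖T u - T v‖ itself.
    exact abs_sub_le_of_dissipative (s₀ := s + 1) (C := ‖T u - T v‖) hκ hν hK
      (fun s _ => hSd u s) (fun s _ => hSd v s)
      (fun s _ => (T u - T v).norm_coe_le_norm s)
      (fun s _ => (hg s _ _).trans
        (mul_le_mul_of_nonneg_left ((u - v).norm_coe_le_norm s) hK)) (norm_nonneg _)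
      (by linarith)
  set u := hT.fixedPoint with hu
  have hfix : T u = u := hT.fixedPoint_isFixedPt
  have hSu : S u = u := congrArg DFunLike.coe hfix
  have hnorm : ‖u‖ ≤ C / (κ - K) := by
    have : ‖u‖ ≤ (C + K * ‖u‖) / κ := by
      refine (BoundedContinuousFunction.norm_le (by positivity)).2 fun s => ?_
      have := hSb u s
      rwa [hSu] at this
    rw [le_div_iff₀ hκ] at this
    rw [le_div_iff₀ (by linarith)]
    linarith
  refine ⟨u, fun s => (u.norm_coe_le_norm s).trans hnorm, fun s i => ?_⟩
  have := hSd u s i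
  rwa [hSu] at this

/-- Here `g` need only be Lipschitz on the ball where both solutions live. Starting from the trivial
bound 2R, each application of the contraction estimate gains a factor K/κ < 1. -/
theorem dissipative_unique {ι : Type*} [Fintype ι] {ν : ι → ℝ} {κ : ℝ} (hκ : 0 < κ)
    (hν : ∀ i, κ ≤ ν i) {K s₀ R : ℝ} (hK : 0 ≤ K) (hKκ : K < κ) {g : ℝ → (ι → ℝ) → ι → ℝ}
    (hg : ∀ s < s₀, ∀ u v, ‖u‖ ≤ R → ‖v‖ ≤ R → ‖g s u - g s v‖ ≤ K * ‖u - v‖)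
    {u v : ℝ → ι → ℝ} (hu : ∀ s < s₀, ‖u s‖ ≤ R) (hv : ∀ s < s₀, ‖v s‖ ≤ R)
    (hu' : ∀ s < s₀, ∀ i, HasDerivAt (fun r => u r i) (-ν i * u s i + g s (u s) i) s)
    (hv' : ∀ s < s₀, ∀ i, HasDerivAt (fun r => v r i) (-ν i * v s i + g s (v s) i) s)
    {s : ℝ} (hs : s < s₀) : u s = v s := by
  have hR : 0 ≤ R := (norm_nonneg _).trans (hu s hs)
  have key : ∀ k : ℕ, ∀ s < s₀, ‖u s - v s‖ ≤ (K / κ) ^ k * (2 * R) := by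
    intro k
    induction k with
    | zero =>
      intro s hs
      have := norm_sub_le (u s) (v s)
      have h1 := hu s hs
      have h2 := hv s hs
      rw [pow_zero]
      linarith
    | succ k ih =>
      intro s hs
      rw [pow_succ', mul_assoc]
      exact abs_sub_le_of_dissipative hκ hν hK hu' hv' ih
        (fun s hs => (hg s hs _ _ (hu s hs) (hv s hs)).trans
          (mul_le_mul_of_nonneg_left (ih s hs) hK)) (by positivity) hs
  have hlim : Tendsto (fun k : ℕ => (K / κ) ^ k * (2 * R)) atTop (𝓝 0) := by
    simpa using (tendsto_pow_atTop_nhds_zero_of_lt_one (by positivity)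
      ((div_lt_one hκ).2 hKκ)).mul_const (2 * R)
  have := ge_of_tendsto' hlim fun k => key k s hs
  exact sub_eq_zero.1 (norm_le_zero_iff.1 this)

/-! ### The equations near the singularity, in logarithmic time -/

/-- The right-hand side of the class A equations in the time with lapse `a₀ a₁ a₂`. -/
def toda (x : Fin 3 → ℝ) (i : Fin 3) : ℝ := (x (i + 1) - x (i + 2)) ^ 2 - x i ^ 2

theorem toda_mul (c : ℝ) (x : Fin 3 → ℝ) (i : Fin 3) :
    toda (fun j => c * x j) i = c ^ 2 * toda x i := by
  simp only [toda]; ring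

theorem abs_toda_le {x : Fin 3 → ℝ} {B : ℝ} (h : ∀ j, |x j| ≤ B) (i : Fin 3) :
    |toda x i| ≤ 5 * B ^ 2 := by
  have hB : 0 ≤ B := (abs_nonneg _).trans (h 0)
  have h1 : (x (i + 1) - x (i + 2)) ^ 2 ≤ (2 * B) ^ 2 := sq_le_sq.2 <| by
    rw [abs_of_nonneg (by positivity : 0 ≤ 2 * B)]
    linarith [abs_sub (x (i + 1)) (x (i + 2)), h (i + 1), h (i + 2)]
  have h2 : x i ^ 2 ≤ B ^ 2 := sq_le_sq.2 (by rw [abs_of_nonneg hB]; exact h i)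
  rw [toda, abs_le]
  constructor <;> nlinarith [sq_nonneg (x (i + 1) - x (i + 2)), sq_nonneg (x i)]

/-- The class A equations in the time `s = log t`, for the deviations `a`, `b`, `v` of
`a₀ a₁ a₂ • H`, `log aᵢ`, `a₀ a₁ a₂ / t` from the Kasner values `p`, `p s`, `1`. -/
structure IsLogSolution (p n : Fin 3 → ℝ) (s₀ : ℝ) (a b : ℝ → Fin 3 → ℝ) (v : ℝ → ℝ) : Prop where
  pos : ∀ s < s₀, 0 < 1 + v s
  da : ∀ s < s₀, ∀ i, HasDerivAt (fun r => a r i)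
    (toda (fun j => n j * Real.exp (2 * p j * s + 2 * b s j)) i / (2 * (1 + v s))) s
  db : ∀ s < s₀, ∀ i, HasDerivAt (fun r => b r i) ((a s i - p i * v s) / (1 + v s)) s
  dv : ∀ s < s₀, HasDerivAt v (-v s + ∑ i, a s i) s

/-- The deviations vanish at the singularity. -/
structure IsDecaying (a b : ℝ → Fin 3 → ℝ) (v : ℝ → ℝ) : Prop where
  a : ∀ i, Tendsto (fun s => a s i) atBot (𝓝 0)
  b : ∀ i, Tendsto (fun s => b s i) atBot (𝓝 0)
  v : Tendsto v atBot (𝓝 0)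

/-- The index type of the rescaled deviations. -/
abbrev Dev : Type := Fin 3 ⊕ Fin 3 ⊕ Unit

/-- The linear damping rates of the rescaled deviations. -/
noncomputable def devRate (κ : ℝ) : Dev → ℝ := Sum.elim (fun _ => κ) (Sum.elim (fun _ => κ) (fun _ => κ + 1))

/-- The forcing term for `a`, as a function of bounded variables. -/
noncomputable def forcing (i : Fin 3) (z : (Fin 3 → ℝ) × (Fin 3 → ℝ) × ℝ) : ℝ :=
  toda (fun j => z.1 j * Real.exp (2 * z.2.1 j)) i / (2 * (1 + z.2.2))

/-- The forcing term for `b`, as a function of bounded variables. -/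
noncomputable def drift (q : ℝ) (z : ℝ × ℝ × ℝ × ℝ) : ℝ :=
  (z.1 * z.2.2.1 - q * z.2.2.2) / (1 + z.1 * z.2.1 * z.2.2.2)

/-- The nonlinear part of the equations for the rescaled deviations. -/
noncomputable def devRHS (p n : Fin 3 → ℝ) (κ l s : ℝ) (u : Dev → ℝ) : Dev → ℝ :=
  Sum.elim
    (fun i => Real.exp (κ * s) ^ 3 / l ^ 2 * forcing i
      (fun j => n j * Real.exp (2 * (p j - κ) * s),
        fun j => Real.exp (κ * s) * u (.inr (.inl j)), l * Real.exp (κ * s) * u (.inr (.inr ()))))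
    (Sum.elim
      (fun i => l * drift (p i) (l, Real.exp (κ * s), u (.inl i), u (.inr (.inr ()))))
      (fun _ => l * ∑ i, u (.inl i)))

/-! ### Lipschitz bounds for the rescaled system -/

theorem exists_lipschitzOn_forcing (N : ℝ) (i : Fin 3) : ∃ K, LipschitzOnWith K (forcing i)
    (Metric.closedBall 0 N ×ˢ Metric.closedBall 0 1 ×ˢ Metric.closedBall 0 (1 / 2)) := by
  refine ContDiffOn.exists_lipschitzOnWith (n := 1) ?_ one_ne_zero
    ((convex_closedBall _ _).prod ((convex_closedBall _ _).prod (convex_closedBall _ _)))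
    ((isCompact_closedBall _ _).prod ((isCompact_closedBall _ _).prod (isCompact_closedBall _ _)))
  refine ContDiffOn.div (ContDiff.contDiffOn ?_) (ContDiff.contDiffOn (by fun_prop)) ?_
  · unfold toda
    fun_prop
  · rintro z ⟨-, -, hz⟩
    rw [mem_closedBall_zero_iff, Real.norm_eq_abs, abs_le] at hz
    have : 0 < 1 + z.2.2 := by linarith
    positivity

theorem exists_lipschitzOn_drift (q : ℝ) : ∃ K, LipschitzOnWith K (drift q)
    (Metric.closedBall 0 (1 / 2) ×ˢ Metric.closedBall 0 1 ×ˢ Metric.closedBall 0 1 ×ˢ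
      Metric.closedBall 0 1) := by
  refine ContDiffOn.exists_lipschitzOnWith (n := 1) ?_ one_ne_zero
    ((convex_closedBall _ _).prod ((convex_closedBall _ _).prod
      ((convex_closedBall _ _).prod (convex_closedBall _ _))))
    ((isCompact_closedBall _ _).prod ((isCompact_closedBall _ _).prod
      ((isCompact_closedBall _ _).prod (isCompact_closedBall _ _))))
  refine ContDiffOn.div (ContDiff.contDiffOn (by fun_prop)) (ContDiff.contDiffOn (by fun_prop)) ?_
  rintro z ⟨h1, h2, -, h4⟩
  simp only [mem_closedBall_zero_iff, Real.norm_eq_abs] at h1 h2 h4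
  have h : |z.1 * z.2.1 * z.2.2.2| ≤ 1 / 2 * 1 * 1 := by
    rw [abs_mul, abs_mul]
    gcongr
  have := (abs_le.1 h).1
  linarith

theorem exists_forcing_bounds (N : ℝ) : ∃ A : ℝ, 0 ≤ A ∧
    (∀ i Y b c v w D, ‖Y‖ ≤ N → ‖b‖ ≤ 1 → ‖c‖ ≤ 1 → |v| ≤ 1 / 2 → |w| ≤ 1 / 2 →
      ‖b - c‖ ≤ D → |v - w| ≤ D → |forcing i (Y, b, v) - forcing i (Y, c, w)| ≤ A * D) ∧
    ∀ i Y, ‖Y‖ ≤ N → |forcing i (Y, 0, 0)| ≤ A := by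
  choose K hK using exists_lipschitzOn_forcing N
  have hA : ∀ i, (K i : ℝ) ≤ ∑ i, (K i : ℝ) := fun i =>
    Finset.single_le_sum (f := fun i => (K i : ℝ)) (fun j _ => (K j).2) (Finset.mem_univ i)
  have hA0 : 0 ≤ ∑ i, (K i : ℝ) := (K 0).2.trans (hA 0)
  -- A single constant for both claims: the Lipschitz claim needs the sum of the constants, and the
  -- bound at zero deviation needs it times `N`, because `forcing` vanishes at the origin.
  refine ⟨(∑ i, (K i : ℝ)) * (1 + |N|), by positivity, ?_, ?_⟩
  · intro i Y b c v w D hY hb hc hv hw hD hD'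
    have hd := (hK i).dist_le_mul (Y, b, v) ⟨mem_closedBall_zero_iff.2 hY,
      mem_closedBall_zero_iff.2 hb, mem_closedBall_zero_iff.2 hv⟩ (Y, c, w)
      ⟨mem_closedBall_zero_iff.2 hY, mem_closedBall_zero_iff.2 hc, mem_closedBall_zero_iff.2 hw⟩
    rw [Prod.dist_eq, Prod.dist_eq, dist_self, Real.dist_eq, Real.dist_eq, dist_eq_norm] at hd
    have hD0 : 0 ≤ D := (norm_nonneg _).trans hD
    refine hd.trans ?_
    refine mul_le_mul ((hA i).trans (le_mul_of_one_le_right hA0 ?_))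
      (max_le hD0 (max_le hD hD')) (by positivity) (by positivity)
    linarith [abs_nonneg N]
  · intro i Y hY
    have hN : 0 ≤ N := (norm_nonneg _).trans hY
    have hd := (hK i).dist_le_mul (Y, 0, 0) ⟨mem_closedBall_zero_iff.2 hY,
      by simp, by simp⟩ 0 ⟨by simpa using hN, by simp, by simp⟩
    have h0 : forcing i 0 = 0 := by simp [forcing, toda]
    rw [h0, Real.dist_eq, sub_zero, dist_zero_right, Prod.norm_def] at hd
    refine hd.trans (mul_le_mul (hA i) (max_le ?_ ?_) (by positivity) hA0)
    · rw [abs_of_nonneg hN]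
      exact hY.trans (by linarith)
    · simp only [Prod.mk_zero_zero, norm_zero]
      positivity

theorem exists_drift_bounds (p : Fin 3 → ℝ) : ∃ B : ℝ, 0 ≤ B ∧
    ∀ i l E a a' v v' D, |l| ≤ 1 / 2 → |E| ≤ 1 → |a| ≤ 1 → |a'| ≤ 1 → |v| ≤ 1 → |v'| ≤ 1 →
      |a - a'| ≤ D → |v - v'| ≤ D →
      |drift (p i) (l, E, a, v) - drift (p i) (l, E, a', v')| ≤ B * D := by
  choose K hK using fun i => exists_lipschitzOn_drift (p i)
  have hA : ∀ i, (K i : ℝ) ≤ ∑ i, (K i : ℝ) := fun i =>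
    Finset.single_le_sum (f := fun i => (K i : ℝ)) (fun j _ => (K j).2) (Finset.mem_univ i)
  refine ⟨∑ i, (K i : ℝ), (K 0).2.trans (hA 0), ?_⟩
  intro i l E a a' v v' D hl hE ha ha' hv hv' hD hD'
  have hd := (hK i).dist_le_mul (l, E, a, v) ⟨mem_closedBall_zero_iff.2 hl,
    mem_closedBall_zero_iff.2 hE, mem_closedBall_zero_iff.2 ha, mem_closedBall_zero_iff.2 hv⟩
    (l, E, a', v') ⟨mem_closedBall_zero_iff.2 hl,
    mem_closedBall_zero_iff.2 hE, mem_closedBall_zero_iff.2 ha', mem_closedBall_zero_iff.2 hv'⟩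
  rw [Prod.dist_eq, Prod.dist_eq, Prod.dist_eq, dist_self, dist_self, Real.dist_eq, Real.dist_eq,
    Real.dist_eq] at hd
  have hD0 : 0 ≤ D := (abs_nonneg _).trans hD
  exact hd.trans (mul_le_mul (hA i) (max_le hD0 (max_le hD0 (max_le hD hD'))) (by positivity)
    ((K 0).2.trans (hA 0)))

/-- Each block carries a small prefactor: e^{3κs}/l² for the forcing, small for s near -∞ once l is
fixed, and l for the two remaining couplings. -/
theorem norm_devRHS_sub_le {p n : Fin 3 → ℝ} {κ l s A B δ : ℝ} (hl0 : 0 < l) (hl1 : l ≤ 1 / 2)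
    (hE : Real.exp (κ * s) ≤ 1) (hY : ‖fun j => n j * Real.exp (2 * (p j - κ) * s)‖ ≤ ‖n‖)
    (hA : ∀ i Y b c v w D, ‖Y‖ ≤ ‖n‖ → ‖b‖ ≤ 1 → ‖c‖ ≤ 1 → |v| ≤ 1 / 2 → |w| ≤ 1 / 2 →
      ‖b - c‖ ≤ D → |v - w| ≤ D → |forcing i (Y, b, v) - forcing i (Y, c, w)| ≤ A * D)
    (hB : ∀ i l E a a' v v' D, |l| ≤ 1 / 2 → |E| ≤ 1 → |a| ≤ 1 → |a'| ≤ 1 → |v| ≤ 1 → |v'| ≤ 1 →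
      |a - a'| ≤ D → |v - v'| ≤ D →
      |drift (p i) (l, E, a, v) - drift (p i) (l, E, a', v')| ≤ B * D)
    (hδ : 0 ≤ δ) (hAδ : Real.exp (κ * s) ^ 3 / l ^ 2 * A ≤ δ) (hBδ : l * B ≤ δ) (h3δ : l * 3 ≤ δ)
    {u v : Dev → ℝ} (hu : ‖u‖ ≤ 1) (hv : ‖v‖ ≤ 1) :
    ‖devRHS p n κ l s u - devRHS p n κ l s v‖ ≤ δ * ‖u - v‖ := by
  have hE0 := Real.exp_pos (κ * s)
  have hE' : |Real.exp (κ * s)| ≤ 1 := by rwa [abs_of_pos hE0]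
  have hcoord : ∀ w : Dev → ℝ, ‖w‖ ≤ 1 → ∀ j, |w j| ≤ 1 := fun w hw j =>
    (norm_le_pi_norm w j).trans hw
  have hdiff : ∀ j, |u j - v j| ≤ ‖u - v‖ := fun j => norm_le_pi_norm (u - v) j
  have hb : ∀ w : Dev → ℝ, ‖w‖ ≤ 1 →
      ‖fun j => Real.exp (κ * s) * w (.inr (.inl j))‖ ≤ 1 := fun w hw => by
    rw [pi_norm_le_iff_of_nonneg zero_le_one]
    intro j
    rw [Real.norm_eq_abs, abs_mul]
    exact mul_le_one₀ hE' (abs_nonneg _) (hcoord w hw _)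
  have hvv : ∀ w : Dev → ℝ, ‖w‖ ≤ 1 →
      |l * Real.exp (κ * s) * w (.inr (.inr ()))| ≤ 1 / 2 := fun w hw => by
    rw [abs_mul, abs_mul, abs_of_pos hl0]
    calc l * |Real.exp (κ * s)| * |w (.inr (.inr ()))| ≤ 1 / 2 * 1 * 1 := by
          gcongr
          exact hcoord w hw _
      _ = 1 / 2 := by norm_num
  rw [pi_norm_le_iff_of_nonneg (by positivity)]
  rintro (i | i | i)
  · have hd := hA i _ _ _ _ _ ‖u - v‖ hY (hb u hu) (hb v hv) (hvv u hu) (hvv v hv)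
      (by
        rw [pi_norm_le_iff_of_nonneg (norm_nonneg _)]
        intro j
        rw [Pi.sub_apply, ← mul_sub, Real.norm_eq_abs, abs_mul]
        exact (mul_le_of_le_one_left (abs_nonneg _) hE').trans (hdiff _))
      (by
        rw [← mul_sub, abs_mul, abs_of_pos (by positivity : 0 < l * Real.exp (κ * s))]
        exact (mul_le_of_le_one_left (abs_nonneg _)
          (mul_le_one₀ (by linarith) hE0.le hE)).trans (hdiff _))
    simp only [devRHS, Pi.sub_apply, Sum.elim_inl, ← mul_sub]
    rw [Real.norm_eq_abs, abs_mul, abs_of_pos (by positivity)]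
    refine (mul_le_mul_of_nonneg_left hd (by positivity)).trans ?_
    rw [← mul_assoc]
    exact mul_le_mul_of_nonneg_right hAδ (norm_nonneg _)
  · have hd := hB i l (Real.exp (κ * s)) _ _ _ _ ‖u - v‖ (by rwa [abs_of_pos hl0]) hE'
      (hcoord u hu (.inl i)) (hcoord v hv (.inl i)) (hcoord u hu (.inr (.inr ())))
      (hcoord v hv (.inr (.inr ()))) (hdiff _) (hdiff _)
    simp only [devRHS, Pi.sub_apply, Sum.elim_inl, Sum.elim_inr, ← mul_sub]
    rw [Real.norm_eq_abs, abs_mul, abs_of_pos hl0]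
    refine (mul_le_mul_of_nonneg_left hd hl0.le).trans ?_
    rw [← mul_assoc]
    exact mul_le_mul_of_nonneg_right hBδ (norm_nonneg _)
  · simp only [devRHS, Pi.sub_apply, Sum.elim_inr, ← mul_sub, ← Finset.sum_sub_distrib]
    rw [Real.norm_eq_abs, abs_mul, abs_of_pos hl0]
    have hd : |∑ j, (u (.inl j) - v (.inl j))| ≤ 3 * ‖u - v‖ := by
      refine (Finset.abs_sum_le_sum_abs _ _).trans ?_
      refine (Finset.sum_le_card_nsmul _ _ ‖u - v‖ fun j _ => hdiff _).trans ?_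
      simp
    refine (mul_le_mul_of_nonneg_left hd hl0.le).trans ?_
    rw [← mul_assoc]
    exact mul_le_mul_of_nonneg_right h3δ (norm_nonneg _)

theorem norm_devRHS_zero_le {p n : Fin 3 → ℝ} {κ l s A δ : ℝ} (hl0 : 0 < l)
    (hY : ‖fun j => n j * Real.exp (2 * (p j - κ) * s)‖ ≤ ‖n‖)
    (hA : ∀ i Y, ‖Y‖ ≤ ‖n‖ → |forcing i (Y, 0, 0)| ≤ A)
    (hδ : 0 ≤ δ) (hAδ : Real.exp (κ * s) ^ 3 / l ^ 2 * A ≤ δ) : ‖devRHS p n κ l s 0‖ ≤ δ := by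
  rw [pi_norm_le_iff_of_nonneg hδ]
  rintro (i | i | i)
  · have h1 : devRHS p n κ l s 0 (.inl i) = Real.exp (κ * s) ^ 3 / l ^ 2 *
        forcing i (fun j => n j * Real.exp (2 * (p j - κ) * s), 0, 0) := by
      simp [devRHS, Pi.zero_def]
    rw [h1, Real.norm_eq_abs, abs_mul, abs_of_pos (by positivity)]
    exact (mul_le_mul_of_nonneg_left (hA i _ hY) (by positivity)).trans hAδ
  · simpa [devRHS, drift] using hδ
  · simpa [devRHS] using hδ

/-- Quiescence enters here: where `n j ≠ 0` the exponent is nonpositive for s ≤ 0, and where `n j =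
0` the growth of the exponential is irrelevant. -/
theorem norm_mul_exp_le {p n : Fin 3 → ℝ} {κ : ℝ} (hp : ∀ j, n j ≠ 0 → κ ≤ p j) {s : ℝ}
    (hs : s ≤ 0) : ‖fun j => n j * Real.exp (2 * (p j - κ) * s)‖ ≤ ‖n‖ := by
  rw [pi_norm_le_iff_of_nonneg (norm_nonneg _)]
  intro j
  by_cases hj : n j = 0
  · simp [hj]
  · rw [norm_mul, Real.norm_eq_abs (Real.exp _), abs_of_pos (Real.exp_pos _)]
    refine (mul_le_of_le_one_right (norm_nonneg _) (Real.exp_le_one_iff.2 ?_)).trans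
      (norm_le_pi_norm n j)
    have := hp j hj
    nlinarith

/-- The order of choices matters: `l` is fixed by the couplings alone, and `s₀` is then taken
negative enough to beat 1/l² in the forcing. -/
theorem exists_devRHS_bounds {p n : Fin 3 → ℝ} {κ : ℝ} (hκ : 0 < κ)
    (hp : ∀ j, n j ≠ 0 → κ ≤ p j) : ∃ l : ℝ, 0 < l ∧ l ≤ 1 / 2 ∧ ∃ s₀ < 0,
      (∀ s ≤ s₀, ∀ u v, ‖u‖ ≤ 1 → ‖v‖ ≤ 1 →
        ‖devRHS p n κ l s u - devRHS p n κ l s v‖ ≤ κ / 2 * ‖u - v‖) ∧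
      ∀ s ≤ s₀, ‖devRHS p n κ l s 0‖ ≤ κ / 2 := by
  obtain ⟨A, hA0, hA, hA'⟩ := exists_forcing_bounds ‖n‖
  obtain ⟨B, hB0, hB⟩ := exists_drift_bounds p
  have hκ2 : 0 < κ / 2 := by positivity
  -- `B` is the Lipschitz constant of the drift and 3 counts the summands that drive `v`; the bound
  -- on l (B + 3) covers both requirements.
  set l : ℝ := min (1 / 2) (κ / 2 / (B + 3)) with hl
  have hl0 : 0 < l := lt_min (by norm_num) (by positivity)
  have hl2 : l * (B + 3) ≤ κ / 2 := (le_div_iff₀ (by positivity)).1 (min_le_right _ _)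
  have hlim : Tendsto (fun s => Real.exp (κ * s) ^ 3 / l ^ 2 * A) atBot (𝓝 0) := by
    simpa using (((tendsto_exp_mul_atBot hκ).pow 3).div_const (l ^ 2)).mul_const A
  obtain ⟨s₁, hs₁⟩ := eventually_atBot.1 (hlim.eventually (ge_mem_nhds hκ2))
  refine ⟨l, hl0, min_le_left _ _, min s₁ (-1), (min_le_right _ _).trans_lt (by norm_num),
    fun s hs u v hu hv => ?_, fun s hs => ?_⟩
  · have hs0 : s ≤ 0 := hs.trans ((min_le_right _ _).trans (by norm_num))
    exact norm_devRHS_sub_le hl0 (min_le_left _ _)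
      (Real.exp_le_one_iff.2 (mul_nonpos_of_nonneg_of_nonpos hκ.le hs0)) (norm_mul_exp_le hp hs0)
      hA hB hκ2.le (hs₁ s (hs.trans (min_le_left _ _))) (by nlinarith) (by nlinarith) hu hv
  · have hs0 : s ≤ 0 := hs.trans ((min_le_right _ _).trans (by norm_num))
    exact norm_devRHS_zero_le hl0 (norm_mul_exp_le hp hs0) hA' hκ2.le
      (hs₁ s (hs.trans (min_le_left _ _)))

/-! ### Existence and uniqueness of decaying solutions -/

/-- The retraction of the line onto `[-1, 1]`. -/
noncomputable def clip (x : ℝ) : ℝ := max (-1) (min 1 x)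

theorem continuous_clip : Continuous clip := by unfold clip; fun_prop

theorem abs_clip_le (x : ℝ) : |clip x| ≤ 1 :=
  abs_le.2 ⟨le_max_left _ _, max_le (by norm_num) (min_le_left _ _)⟩

theorem clip_of_abs_le {x : ℝ} (h : |x| ≤ 1) : clip x = x := by
  rw [clip, min_eq_right (abs_le.1 h).2, max_eq_right (abs_le.1 h).1]

theorem abs_clip_sub_le (x y : ℝ) : |clip x - clip y| ≤ |x - y| :=
  (abs_max_sub_max_le_max _ _ _ _).trans (max_le (by simp)
    ((abs_min_sub_min_le_max _ _ _ _).trans (max_le (by simp) le_rfl)))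

theorem norm_clip_le (u : Dev → ℝ) : ‖fun j => clip (u j)‖ ≤ 1 :=
  (pi_norm_le_iff_of_nonneg zero_le_one).2 fun j => abs_clip_le (u j)

theorem norm_clip_sub_le (u v : Dev → ℝ) :
    ‖(fun j => clip (u j)) - fun j => clip (v j)‖ ≤ ‖u - v‖ :=
  (pi_norm_le_iff_of_nonneg (norm_nonneg _)).2 fun j =>
    (abs_clip_sub_le (u j) (v j)).trans (norm_le_pi_norm (u - v) j)

theorem abs_mul_mul_le_half {l E v : ℝ} (hl0 : 0 < l) (hl1 : l ≤ 1 / 2) (hE0 : 0 < E) (hE1 : E ≤ 1)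
    (hv : |v| ≤ 1) : |l * E * v| ≤ 1 / 2 := by
  rw [abs_mul, abs_mul, abs_of_pos hl0, abs_of_pos hE0]
  calc l * E * |v| ≤ 1 / 2 * 1 * 1 := by gcongr
    _ = 1 / 2 := by norm_num

/-- Clipping `u` and freezing the time at `s₀` gives a right-hand side on the whole space to which
the global existence theorem applies; both keep the denominators positive. -/
theorem continuous_clipped_devRHS {p n : Fin 3 → ℝ} {κ l s₀ : ℝ} (hκ : 0 < κ) (hl0 : 0 < l)
    (hl1 : l ≤ 1 / 2) (hs₀ : s₀ < 0) :
    Continuous (Function.uncurry fun (s : ℝ) (u : Dev → ℝ) =>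
      devRHS p n κ l (min s s₀) fun j => clip (u j)) := by
  have hpos : ∀ (s : ℝ) (v : ℝ), 0 < 1 + l * Real.exp (κ * min s s₀) * clip v := fun s v => by
    have h1 : Real.exp (κ * min s s₀) ≤ 1 := Real.exp_le_one_iff.2
      (mul_nonpos_of_nonneg_of_nonpos hκ.le ((min_le_right _ _).trans hs₀.le))
    have := (abs_le.1 (abs_mul_mul_le_half hl0 hl1 (Real.exp_pos _) h1 (abs_clip_le v))).1
    linarith
  have hcl : ∀ j : Dev, Continuous fun z : ℝ × (Dev → ℝ) => clip (z.2 j) := fun j =>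
    continuous_clip.comp ((continuous_apply j).comp continuous_snd)
  have hcla := fun j => hcl (.inl j)
  have hclb := fun j => hcl (.inr (.inl j))
  have hclv := hcl (.inr (.inr ()))
  refine continuous_pi ?_
  rintro (i | i | i)
  · simp only [Function.uncurry_def, devRHS, Sum.elim_inl, forcing]
    refine Continuous.mul (by fun_prop) (Continuous.div ?_ (by fun_prop) ?_)
    · unfold toda
      fun_prop
    · intro z
      exact (mul_pos two_pos (hpos z.1 (z.2 (.inr (.inr ()))))).ne'
  · simp only [Function.uncurry_def, devRHS, Sum.elim_inl, Sum.elim_inr, drift]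
    refine Continuous.mul (by fun_prop) (Continuous.div (by fun_prop) (by fun_prop) ?_)
    intro z
    exact (hpos z.1 (z.2 (.inr (.inr ())))).ne'
  · simp only [Function.uncurry_def, devRHS, Sum.elim_inr]
    fun_prop

theorem exists_bounded_dev {p n : Fin 3 → ℝ} {κ l s₀ : ℝ} (hκ : 0 < κ) (hl0 : 0 < l)
    (hl1 : l ≤ 1 / 2) (hs₀ : s₀ < 0)
    (hL : ∀ s ≤ s₀, ∀ u v, ‖u‖ ≤ 1 → ‖v‖ ≤ 1 →
        ‖devRHS p n κ l s u - devRHS p n κ l s v‖ ≤ κ / 2 * ‖u - v‖)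
    (h0 : ∀ s ≤ s₀, ‖devRHS p n κ l s 0‖ ≤ κ / 2) :
    ∃ u : ℝ → Dev → ℝ, (∀ s, ‖u s‖ ≤ 1) ∧ ∀ s < s₀, ∀ i,
      HasDerivAt (fun r => u r i) (-devRate κ i * u s i + devRHS p n κ l s (u s) i) s := by
  have hν : ∀ i, κ ≤ devRate κ i := by
    rintro (i | i | i) <;> simp [devRate]
  have hclip0 : (fun j : Dev => clip ((0 : Dev → ℝ) j)) = 0 := funext fun j => by
    rw [Pi.zero_apply, clip_of_abs_le (by simp)]
  obtain ⟨u, hu, hu'⟩ := exists_bounded_dissipative hκ hν (K := κ / 2) (C := κ / 2)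
    (by positivity) (by linarith) (continuous_clipped_devRHS (p := p) (n := n) hκ hl0 hl1 hs₀)
    (fun s u v => (hL _ (min_le_right _ _) _ _ (norm_clip_le u) (norm_clip_le v)).trans
      (mul_le_mul_of_nonneg_left (norm_clip_sub_le u v) (by positivity)))
    (fun s => by
      rw [hclip0]
      exact h0 _ (min_le_right _ _))
  -- With C = K = κ/2 the bound C/(κ - K) is exactly 1, so the clipping is inactive along the
  -- solution.
  have hu1 : ∀ s, ‖u s‖ ≤ 1 := fun s => (hu s).trans (le_of_eq (by field_simp; norm_num))
  refine ⟨u, hu1, fun s hs i => ?_⟩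
  have := hu' s i
  have hc : (fun j => clip (u s j)) = u s := funext fun j =>
    clip_of_abs_le ((norm_le_pi_norm (u s) j).trans (hu1 s))
  rwa [min_eq_left hs.le, hc] at this

/-- A factor e^{2κs} is taken out of each argument, and `toda` is homogeneous of degree 2. One of
the four powers of e^{κs} is spent on rescaling, which explains the cube in `devRHS`. -/
theorem toda_exp_scaling (n p b : Fin 3 → ℝ) (κ s : ℝ) (i : Fin 3) :
    toda (fun j => n j * Real.exp (2 * p j * s + 2 * b j)) i =
      Real.exp (κ * s) ^ 4 *
        toda (fun j => n j * Real.exp (2 * (p j - κ) * s) * Real.exp (2 * b j)) i := by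
  rw [show Real.exp (κ * s) ^ 4 = (Real.exp (κ * s) ^ 2) ^ 2 by ring, ← toda_mul]
  congr 1
  funext j
  rw [show 2 * p j * s + 2 * b j = κ * s + κ * s + 2 * (p j - κ) * s + 2 * b j by ring,
    Real.exp_add, Real.exp_add, Real.exp_add]
  ring

/-- The weights l², 1, l follow the hierarchy of the couplings: `a` drives `v`, and `a` and `v`
drive `b`, so each arrow gains at least one factor l. -/
theorem exists_isLogSolution {p n : Fin 3 → ℝ} {κ : ℝ} (hκ : 0 < κ)
    (hp : ∀ j, n j ≠ 0 → κ ≤ p j) :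
    ∃ s₀ a b v, IsLogSolution p n s₀ a b v ∧ IsDecaying a b v := by
  obtain ⟨l, hl0, hl1, s₀, hs₀, hL, h0⟩ := exists_devRHS_bounds hκ hp
  obtain ⟨u, hu, hu'⟩ := exists_bounded_dev hκ hl0 hl1 hs₀ hL h0
  have hlim : ∀ (c : ℝ) j, Tendsto (fun s => c * (Real.exp (κ * s) * u s j)) atBot (𝓝 0) :=
    fun c j => by
      have : Tendsto (fun s => Real.exp (κ * s) * u s j) atBot (𝓝 0) := by
        refine squeeze_zero_norm (fun s => ?_) (tendsto_exp_mul_atBot hκ)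
        rw [norm_mul, Real.norm_eq_abs, abs_of_pos (Real.exp_pos _)]
        exact mul_le_of_le_one_right (Real.exp_pos _).le ((norm_le_pi_norm (u s) j).trans (hu s))
      simpa using this.const_mul c
  -- The difference `κ - devRate κ j` is 0 for the `a` and `b` components and -1 for `v`, where it
  -- restores the term -v.
  have hd : ∀ (c : ℝ) j, ∀ s < s₀, HasDerivAt (fun s => c * (Real.exp (κ * s) * u s j))
      (c * (Real.exp (κ * s) *
        ((κ - devRate κ j) * u s j + devRHS p n κ l s (u s) j))) s := fun c j s hs =>
    (((hasDerivAt_exp_mul κ s).mul (hu' s hs j)).const_mul c).congr_deriv (by ring)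
  refine ⟨s₀, fun s i => l ^ 2 * (Real.exp (κ * s) * u s (.inl i)),
    fun s i => 1 * (Real.exp (κ * s) * u s (.inr (.inl i))),
    fun s => l * (Real.exp (κ * s) * u s (.inr (.inr ()))),
    ⟨fun s hs => ?_, fun s hs i => ?_, fun s hs i => ?_, fun s hs => ?_⟩,
    ⟨fun i => hlim _ _, fun i => hlim _ _, hlim _ _⟩⟩
  · have h1 : Real.exp (κ * s) ≤ 1 := Real.exp_le_one_iff.2
      (mul_nonpos_of_nonneg_of_nonpos hκ.le (hs.trans hs₀).le)
    have := (abs_le.1 (abs_mul_mul_le_half hl0 hl1 (Real.exp_pos _) h1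
      ((norm_le_pi_norm (u s) (.inr (.inr ()))).trans (hu s)))).1
    linarith
  · refine (hd (l ^ 2) (.inl i) s hs).congr_deriv ?_
    rw [toda_exp_scaling n p _ κ s i]
    simp only [devRHS, devRate, forcing, Sum.elim_inl, one_mul, ← mul_assoc]
    field_simp
    ring
  · refine (hd 1 (.inr (.inl i)) s hs).congr_deriv ?_
    simp only [devRHS, devRate, drift, Sum.elim_inl, Sum.elim_inr, ← mul_assoc]
    ring
  · refine (hd l (.inr (.inr ())) s hs).congr_deriv ?_
    simp only [devRHS, devRate, Sum.elim_inr, ← Finset.mul_sum]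
    ring

/-! ### Decay rates and uniqueness of decaying solutions -/

theorem IsLogSolution.mono {p n : Fin 3 → ℝ} {s₀ s₁ : ℝ} {a b : ℝ → Fin 3 → ℝ} {v : ℝ → ℝ}
    (h : IsLogSolution p n s₀ a b v) (hs : s₁ ≤ s₀) : IsLogSolution p n s₁ a b v :=
  ⟨fun s h' => h.pos s (h'.trans_le hs), fun s h' => h.da s (h'.trans_le hs),
    fun s h' => h.db s (h'.trans_le hs), fun s h' => h.dv s (h'.trans_le hs)⟩

/-- Mere decay bounds `b` and keeps 1 + v away from 0, so a' = O(e^{4κs}). Integrating from -∞ gives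
the rate for `a`, then through the equations for `v` and for `b`. -/
theorem IsLogSolution.exists_exp_bound {p n : Fin 3 → ℝ} {κ : ℝ} (hκ : 0 < κ)
    (hp : ∀ j, n j ≠ 0 → κ ≤ p j) {s₀ : ℝ} {a b : ℝ → Fin 3 → ℝ} {v : ℝ → ℝ}
    (h : IsLogSolution p n s₀ a b v) (hlim : IsDecaying a b v) :
    ∃ C s₁, s₁ ≤ s₀ ∧ ∀ s < s₁, (∀ i, |a s i| ≤ C * Real.exp (4 * κ * s)) ∧
      (∀ i, |b s i| ≤ C * Real.exp (4 * κ * s)) ∧ |v s| ≤ C * Real.exp (4 * κ * s) := by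
  have hev : ∀ᶠ s in atBot, (∀ i, |b s i| ≤ 1) ∧ |v s| ≤ 1 / 2 := by
    refine (eventually_all.2 fun i => ?_).and ?_
    · exact (by simpa using (hlim.b i).abs :
        Tendsto (fun s => |b s i|) atBot (𝓝 0)).eventually (ge_mem_nhds one_pos)
    · exact (by simpa using hlim.v.abs :
        Tendsto (fun s => |v s|) atBot (𝓝 0)).eventually (ge_mem_nhds one_half_pos)
  obtain ⟨s₂, hs₂⟩ := eventually_atBot.1 hev
  set s₁ := min s₀ (min s₂ 0)
  have h₁ := h.mono (min_le_left s₀ (min s₂ 0))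
  have hb : ∀ s < s₁, ∀ i, |b s i| ≤ 1 := fun s hs =>
    (hs₂ s (hs.le.trans ((min_le_right _ _).trans (min_le_left _ _)))).1
  have hv : ∀ s < s₁, 1 / 2 ≤ 1 + v s := fun s hs => by
    have := (abs_le.1 (hs₂ s (hs.le.trans ((min_le_right _ _).trans (min_le_left _ _)))).2).1
    linarith
  have hs0 : ∀ s < s₁, s ≤ 0 := fun s hs => hs.le.trans ((min_le_right _ _).trans (min_le_right _ _))
  -- The 5 is that of `abs_toda_le`; the arguments of `toda`, stripped of e^{2κs}, are at most ‖n‖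
  -- e² because |b| ≤ 1.
  set B : ℝ := 5 * (‖n‖ * Real.exp 2) ^ 2 with hB
  have hE : ∀ s : ℝ, Real.exp (κ * s) ^ 4 = Real.exp (4 * κ * s) := fun s => by
    rw [← Real.exp_nat_mul]; push_cast; ring_nf
  have hκ4 : 0 < 4 * κ := by positivity
  have ha : ∀ s < s₁, ∀ i, |a s i| ≤ B / (4 * κ) * Real.exp (4 * κ * s) := fun s hs i => by
    refine abs_le_exp_of_abs_deriv_le_exp hκ4 (fun s hs => h₁.da s hs i) (fun s hs => ?_)
      (hlim.a i) hs
    have hv' := hv s hs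
    rw [abs_div, abs_of_pos (by linarith : 0 < 2 * (1 + v s))]
    refine (div_le_self (abs_nonneg _) (by linarith)).trans ?_
    rw [toda_exp_scaling n p _ κ s i, abs_mul, abs_of_pos (by positivity), hE, mul_comm]
    refine mul_le_mul_of_nonneg_right (abs_toda_le (fun j => ?_) i) (Real.exp_pos _).le
    rw [abs_mul, abs_of_pos (Real.exp_pos _)]
    refine mul_le_mul ?_ (Real.exp_le_exp.2 ?_) (Real.exp_pos _).le (norm_nonneg _)
    · exact (norm_le_pi_norm _ j).trans (norm_mul_exp_le hp (hs0 s hs))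
    · linarith [(abs_le.1 (hb s hs j)).2]
  set A : ℝ := B / (4 * κ)
  have hA0 : 0 ≤ A := by positivity
  have hsum : ∀ s < s₁, |∑ i, a s i| ≤ 3 * A * Real.exp (4 * κ * s) := fun s hs => by
    refine (Finset.abs_sum_le_sum_abs _ _).trans
      ((Finset.sum_le_card_nsmul _ _ _ fun i _ => ha s hs i).trans (le_of_eq ?_))
    simp [mul_assoc]
  have hvv : ∀ s < s₁, |v s| ≤ 3 * A * Real.exp (4 * κ * s) := fun s hs => by
    -- The integrating factor e^s absorbs the term -v; it is cancelled afterwards.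
    have := abs_le_exp_of_abs_deriv_le_exp (f := fun s => Real.exp (1 * s) * v s)
      (f' := fun s => Real.exp (1 * s) * ∑ i, a s i) (C := 3 * A) (μ := 1 + 4 * κ) (by positivity)
      (fun s hs => ((hasDerivAt_exp_mul 1 s).mul (h₁.dv s hs)).congr_deriv (by ring))
      (fun s hs => by
        rw [abs_mul, abs_of_pos (Real.exp_pos _), add_mul, Real.exp_add]
        have := mul_le_mul_of_nonneg_left (hsum s hs) (Real.exp_pos (1 * s)).le
        linarith)
      (by simpa using (tendsto_exp_mul_atBot one_pos).mul hlim.v) hs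
    rw [abs_mul, abs_of_pos (Real.exp_pos _), add_mul, Real.exp_add, mul_left_comm] at this
    refine (le_of_mul_le_mul_left this (Real.exp_pos _)).trans ?_
    refine mul_le_mul_of_nonneg_right (div_le_self (by positivity) (by linarith))
      (Real.exp_pos _).le
  -- The factor 2 bounds 1/(1 + v).
  have hbb : ∀ s < s₁, ∀ i, |b s i| ≤
      (2 * (A + |p i| * (3 * A))) / (4 * κ) * Real.exp (4 * κ * s) := fun s hs i => by
    refine abs_le_exp_of_abs_deriv_le_exp hκ4 (fun s hs => h₁.db s hs i) (fun s hs => ?_)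
      (hlim.b i) hs
    have hv' := hv s hs
    rw [abs_div, abs_of_pos (by linarith : 0 < 1 + v s), div_le_iff₀ (by linarith)]
    have h1 : |a s i - p i * v s| ≤ (A + |p i| * (3 * A)) * Real.exp (4 * κ * s) := by
      refine (abs_sub _ _).trans ?_
      rw [abs_mul]
      have := mul_le_mul_of_nonneg_left (hvv s hs) (abs_nonneg (p i))
      linarith [ha s hs i]
    have h2 : 0 ≤ (A + |p i| * (3 * A)) * Real.exp (4 * κ * s) := by positivity
    nlinarith
  refine ⟨A + 3 * A + ∑ i, (2 * (A + |p i| * (3 * A))) / (4 * κ), s₁, min_le_left _ _,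
    fun s hs => ⟨fun i => (ha s hs i).trans ?_, fun i => (hbb s hs i).trans ?_,
      (hvv s hs).trans ?_⟩⟩
  all_goals refine mul_le_mul_of_nonneg_right ?_ (Real.exp_pos _).le
  · have : 0 ≤ ∑ i, (2 * (A + |p i| * (3 * A))) / (4 * κ) :=
      Finset.sum_nonneg fun i _ => by positivity
    linarith
  · have := Finset.single_le_sum (f := fun i => (2 * (A + |p i| * (3 * A))) / (4 * κ))
      (fun i _ => by positivity) (Finset.mem_univ i)
    linarith
  · have : 0 ≤ ∑ i, (2 * (A + |p i| * (3 * A))) / (4 * κ) :=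
      Finset.sum_nonneg fun i _ => by positivity
    linarith

/-- The rescaled deviations. -/
noncomputable def dev (κ l : ℝ) (a b : ℝ → Fin 3 → ℝ) (v : ℝ → ℝ) (s : ℝ) : Dev → ℝ :=
  Sum.elim (fun i => Real.exp (-κ * s) * (a s i / l ^ 2))
    (Sum.elim (fun i => Real.exp (-κ * s) * b s i) (fun _ => Real.exp (-κ * s) * (v s / l)))

theorem IsLogSolution.hasDerivAt_dev {p n : Fin 3 → ℝ} {κ l s₀ : ℝ} (hl : 0 < l)
    {a b : ℝ → Fin 3 → ℝ} {v : ℝ → ℝ} (h : IsLogSolution p n s₀ a b v) {s : ℝ} (hs : s < s₀)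
    (i : Dev) : HasDerivAt (fun r => dev κ l a b v r i)
      (-devRate κ i * dev κ l a b v s i + devRHS p n κ l s (dev κ l a b v s) i) s := by
  have hE : Real.exp (κ * s) * Real.exp (-κ * s) = 1 := by rw [← Real.exp_add]; simp
  have hE' : ∀ x, Real.exp (κ * s) * (Real.exp (-κ * s) * x) = x := fun x => by
    rw [← mul_assoc, hE, one_mul]
  have hv : l * Real.exp (κ * s) * (Real.exp (-κ * s) * (v s / l)) = v s := by
    rw [mul_assoc, hE', mul_div_cancel₀ _ hl.ne']
  have hv' := h.pos s hs
  obtain i | i | i := i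
  · refine ((hasDerivAt_exp_mul (-κ) s).mul ((h.da s hs i).div_const (l ^ 2))).congr_deriv ?_
    rw [toda_exp_scaling n p _ κ s i]
    simp only [dev, devRHS, devRate, forcing, Sum.elim_inl, Sum.elim_inr, hE', hv]
    have : Real.exp (-κ * s) * Real.exp (κ * s) ^ 4 = Real.exp (κ * s) ^ 3 := by
      linear_combination Real.exp (κ * s) ^ 3 * hE
    field_simp
    rw [← this]
    ring_nf
  · refine ((hasDerivAt_exp_mul (-κ) s).mul (h.db s hs i)).congr_deriv ?_
    simp only [dev, devRHS, devRate, drift, Sum.elim_inl, Sum.elim_inr, hv]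
    field_simp
  · refine ((hasDerivAt_exp_mul (-κ) s).mul ((h.dv s hs).div_const l)).congr_deriv ?_
    simp only [dev, devRHS, devRate, Sum.elim_inl, Sum.elim_inr, ← Finset.mul_sum,
      ← Finset.sum_div]
    field_simp
    ring

/-- The rate e^{4κs} beats the weight e^{-κs}, with e^{3κs} to spare for absorbing the constants. -/
theorem IsLogSolution.eventually_norm_dev_le {p n : Fin 3 → ℝ} {κ : ℝ} (hκ : 0 < κ)
    (hp : ∀ j, n j ≠ 0 → κ ≤ p j) {l s₀ : ℝ} (hl : 0 < l) {a b : ℝ → Fin 3 → ℝ} {v : ℝ → ℝ}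
    (h : IsLogSolution p n s₀ a b v) (hlim : IsDecaying a b v) :
    ∀ᶠ s in atBot, ‖dev κ l a b v s‖ ≤ 1 := by
  obtain ⟨C, s₁, -, hC⟩ := h.exists_exp_bound hκ hp hlim
  have key : ∀ c : ℝ, ∀ᶠ s in atBot, Real.exp (-κ * s) * (C * Real.exp (4 * κ * s) / c) ≤ 1 := by
    intro c
    have : Tendsto (fun s => C / c * Real.exp (3 * κ * s)) atBot (𝓝 0) := by
      simpa using (tendsto_exp_mul_atBot (by positivity : 0 < 3 * κ)).const_mul (C / c)
    filter_upwards [this.eventually (ge_mem_nhds one_pos)] with s hs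
    rw [show 4 * κ * s = κ * s + 3 * κ * s by ring, Real.exp_add]
    have hE : Real.exp (-κ * s) * Real.exp (κ * s) = 1 := by rw [← Real.exp_add]; simp
    calc _ = Real.exp (-κ * s) * Real.exp (κ * s) * (C / c * Real.exp (3 * κ * s)) := by ring
      _ ≤ 1 := by rwa [hE, one_mul]
  filter_upwards [key (l ^ 2), key 1, key l, eventually_lt_atBot s₁] with s h1 h2 h3 hs
  obtain ⟨ha, hb, hv⟩ := hC s hs
  rw [pi_norm_le_iff_of_nonneg zero_le_one]
  rintro (i | i | i) <;> simp only [dev, Sum.elim_inl, Sum.elim_inr]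
  · rw [norm_mul, norm_div, Real.norm_eq_abs, Real.norm_eq_abs, abs_of_pos (Real.exp_pos _),
      Real.norm_eq_abs, abs_of_pos (by positivity : 0 < l ^ 2)]
    refine le_trans ?_ h1
    gcongr
    exact ha i
  · rw [norm_mul, Real.norm_eq_abs, Real.norm_eq_abs, abs_of_pos (Real.exp_pos _)]
    refine le_trans ?_ h2
    rw [div_one]
    gcongr
    exact hb i
  · rw [norm_mul, norm_div, Real.norm_eq_abs, Real.norm_eq_abs, abs_of_pos (Real.exp_pos _),
      Real.norm_eq_abs, abs_of_pos hl]
    refine le_trans ?_ h3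
    gcongr

/-- Both rescaled deviations eventually lie in the unit ball, where `devRHS` is Lipschitz with
constant κ/2 < κ, so uniqueness of bounded solutions applies. -/
theorem IsLogSolution.eventually_eq {p n : Fin 3 → ℝ} {κ : ℝ} (hκ : 0 < κ)
    (hp : ∀ j, n j ≠ 0 → κ ≤ p j) {s₀ s₀' : ℝ} {a b a' b' : ℝ → Fin 3 → ℝ} {v v' : ℝ → ℝ}
    (h : IsLogSolution p n s₀ a b v) (hlim : IsDecaying a b v)
    (h' : IsLogSolution p n s₀' a' b' v') (hlim' : IsDecaying a' b' v') :
    ∀ᶠ s in atBot, a s = a' s ∧ b s = b' s ∧ v s = v' s := by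
  obtain ⟨l, hl0, hl1, s₁, hs₁, hL, h0⟩ := exists_devRHS_bounds hκ hp
  obtain ⟨s₂, hs₂⟩ := eventually_atBot.1 ((h.eventually_norm_dev_le hκ hp hl0 hlim).and
    (h'.eventually_norm_dev_le hκ hp hl0 hlim'))
  set s₃ := min (min s₀ s₀') (min s₁ s₂) with hs₃
  have hν : ∀ i, κ ≤ devRate κ i := by
    rintro (i | i | i) <;> simp [devRate]
  filter_upwards [eventually_lt_atBot s₃] with s hs
  have hs' : ∀ s < s₃, s < s₀ ∧ s < s₀' ∧ s < s₁ ∧ s < s₂ := fun s hs => by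
    simpa only [hs₃, lt_min_iff, and_assoc] using hs
  have key := dissipative_unique hκ hν (K := κ / 2) (R := 1) (by positivity) (by linarith)
    (fun s hs => hL s (hs' s hs).2.2.1.le) (fun s hs => (hs₂ s (hs' s hs).2.2.2.le).1)
    (fun s hs => (hs₂ s (hs' s hs).2.2.2.le).2)
    (fun s hs => h.hasDerivAt_dev hl0 (hs' s hs).1)
    (fun s hs => h'.hasDerivAt_dev hl0 (hs' s hs).2.1) hs
  have hE := (Real.exp_pos (-κ * s)).ne'
  refine ⟨funext fun i => ?_, funext fun i => ?_, ?_⟩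
  · have := congrFun key (.inl i)
    simp only [dev, Sum.elim_inl] at this
    exact (div_left_inj' (by positivity)).1 (mul_left_cancel₀ hE this)
  · have := congrFun key (.inr (.inl i))
    simp only [dev, Sum.elim_inl, Sum.elim_inr] at this
    exact mul_left_cancel₀ hE this
  · have := congrFun key (.inr (.inr ()))
    simp only [dev, Sum.elim_inr] at this
    exact (div_left_inj' hl0.ne').1 (mul_left_cancel₀ hE this)

/-! ### Autonomous equations: uniqueness and maximal solutions -/

section Autonomous

variable {E : Type*} [NormedAddCommGroup E] [NormedSpace ℝ E] [ProperSpace E] {X : E → E}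

/-- On a compact interval both curves stay in one closed ball, which is compact and convex, so a C¹
field is Lipschitz on it. -/
theorem autonomous_unique (hX : ContDiff ℝ 1 X) {I : Set ℝ} (hI : IsOpen I) (hI' : I.OrdConnected)
    {f g : ℝ → E} (hf : ∀ t ∈ I, HasDerivAt f (X (f t)) t)
    (hg : ∀ t ∈ I, HasDerivAt g (X (g t)) t) {t₀ : ℝ} (ht₀ : t₀ ∈ I) (h₀ : f t₀ = g t₀) {t : ℝ}
    (ht : t ∈ I) : f t = g t := by
  have hlow : ∀ x ∈ I, ∃ a < x, a ∈ I := fun x hx => by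
    obtain ⟨a, ha, hax⟩ := exists_Ioc_subset_of_mem_nhds (hI.mem_nhds hx) ⟨x - 1, by linarith⟩
    exact ⟨(a + x) / 2, by linarith, hax ⟨by linarith, by linarith⟩⟩
  have hup : ∀ x ∈ I, ∃ b > x, b ∈ I := fun x hx => by
    obtain ⟨b, hb, hbx⟩ := exists_Ico_subset_of_mem_nhds (hI.mem_nhds hx) ⟨x + 1, by linarith⟩
    exact ⟨(b + x) / 2, by linarith, hbx ⟨by linarith, by linarith⟩⟩
  have hmin : min t₀ t ∈ I := by rcases min_choice t₀ t with h | h <;> rw [h] <;> assumption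
  have hmax : max t₀ t ∈ I := by rcases max_choice t₀ t with h | h <;> rw [h] <;> assumption
  -- Openness of `I` leaves room on both sides, so that t₀ is an interior point of the compact
  -- interval.
  obtain ⟨a, ha, haI⟩ := hlow _ hmin
  obtain ⟨b, hb, hbI⟩ := hup _ hmax
  have hsub : Icc a b ⊆ I := hI'.out haI hbI
  have hfc : ContinuousOn f (Icc a b) := fun x hx => (hf x (hsub hx)).continuousAt.continuousWithinAt
  have hgc : ContinuousOn g (Icc a b) := fun x hx => (hg x (hsub hx)).continuousAt.continuousWithinAt
  obtain ⟨R, hR⟩ := ((isCompact_Icc.image_of_continuousOn hfc).union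
    (isCompact_Icc.image_of_continuousOn hgc)).isBounded.subset_closedBall 0
  obtain ⟨K, hK⟩ := hX.contDiffOn.exists_lipschitzOnWith one_ne_zero
    (convex_closedBall (0 : E) R) (isCompact_closedBall 0 R)
  have hm1 := ha.trans_le (min_le_left t₀ t)
  have hm2 := ha.trans_le (min_le_right t₀ t)
  have hm3 := (le_max_left t₀ t).trans_lt hb
  have hm4 := (le_max_right t₀ t).trans_lt hb
  exact ODE_solution_unique_of_mem_Icc (v := fun _ => X) (s := fun _ => Metric.closedBall 0 R)
    (fun _ _ => hK) ⟨hm1, hm3⟩ hfc (fun x hx => hf x (hsub (Ioo_subset_Icc_self hx)))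
    (fun x hx => hR (.inl (mem_image_of_mem f (Ioo_subset_Icc_self hx)))) hgc
    (fun x hx => hg x (hsub (Ioo_subset_Icc_self hx)))
    (fun x hx => hR (.inr (mem_image_of_mem g (Ioo_subset_Icc_self hx)))) h₀ ⟨hm2.le, hm4.le⟩

/-- The interval `(0, T)`. -/
def initialInterval (T : EReal) : Set ℝ := {t : ℝ | 0 < t ∧ (t : EReal) < T}

theorem isOpen_initialInterval (T : EReal) : IsOpen (initialInterval T) :=
  isOpen_Ioi.inter (isOpen_Iio.preimage continuous_coe_real_ereal)

theorem ordConnected_initialInterval (T : EReal) : (initialInterval T).OrdConnected :=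
  ⟨fun _ hx _ hy _ hz => ⟨hx.1.trans_le hz.1, (EReal.coe_le_coe_iff.2 hz.2).trans_lt hy.2⟩⟩

theorem initialInterval_mem_nhdsGT {T : EReal} (hT : 0 < T) : initialInterval T ∈ 𝓝[>] (0 : ℝ) :=
  inter_mem self_mem_nhdsWithin (mem_nhdsWithin_of_mem_nhds
    ((isOpen_Iio.preimage continuous_coe_real_ereal).mem_nhds (by simpa using hT)))

theorem autonomous_unique_of_eventuallyEq (hX : ContDiff ℝ 1 X) {T : EReal} {f g : ℝ → E}
    (hf : ∀ t ∈ initialInterval T, HasDerivAt f (X (f t)) t)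
    (hg : ∀ t ∈ initialInterval T, HasDerivAt g (X (g t)) t) (h : f =ᶠ[𝓝[>] 0] g) {t : ℝ}
    (ht : t ∈ initialInterval T) : f t = g t := by
  have hT : 0 < T := lt_trans (by exact_mod_cast ht.1) ht.2
  obtain ⟨t₀, h₀, ht₀⟩ := (h.and (initialInterval_mem_nhdsGT hT)).exists
  exact autonomous_unique hX (isOpen_initialInterval T) (ordConnected_initialInterval T) hf hg
    ht₀ h₀ ht

/-- Solutions with the germ of `f₀` at 0 agree wherever both exist. `T` is the supremum of their
endpoints, and the value at `t` is that of any one of them living beyond `t`. -/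
theorem exists_maximal_solution (hX : ContDiff ℝ 1 X) {T₀ : EReal} (hT₀ : 0 < T₀) {f₀ : ℝ → E}
    (hf₀ : ∀ t ∈ initialInterval T₀, HasDerivAt f₀ (X (f₀ t)) t) :
    ∃ (T : EReal) (f : ℝ → E), 0 < T ∧ f =ᶠ[𝓝[>] 0] f₀ ∧
      (∀ t ∈ initialInterval T, HasDerivAt f (X (f t)) t) ∧
      ∀ (T' : EReal) (g : ℝ → E), (∀ t ∈ initialInterval T', HasDerivAt g (X (g t)) t) →
        g =ᶠ[𝓝[>] 0] f₀ → T' ≤ T ∧ ∀ t ∈ initialInterval T', g t = f t := by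
  let S : Set EReal := {T | ∃ g : ℝ → E, (∀ t ∈ initialInterval T, HasDerivAt g (X (g t)) t) ∧
    g =ᶠ[𝓝[>] 0] f₀}
  have hS : ∀ t ∈ initialInterval (sSup S), ∃ T, (t : EReal) < T ∧ ∃ g : ℝ → E,
      (∀ t ∈ initialInterval T, HasDerivAt g (X (g t)) t) ∧ g =ᶠ[𝓝[>] 0] f₀ := fun t ht => by
    obtain ⟨T, hT, htT⟩ := lt_sSup_iff.1 ht.2
    exact ⟨T, htT, hT⟩
  choose! T hT g hg hg₀ using hS
  have key : ∀ (T' : EReal) (h : ℝ → E),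
      (∀ t ∈ initialInterval T', HasDerivAt h (X (h t)) t) → h =ᶠ[𝓝[>] 0] f₀ →
      ∀ t ∈ initialInterval T', t ∈ initialInterval (sSup S) → h t = g t t := by
    intro T' h hh hh₀ t ht ht'
    have hmono : ∀ T'', min T' (T t) ≤ T'' →
        initialInterval (min T' (T t)) ⊆ initialInterval T'' := fun T'' hle r hr =>
      ⟨hr.1, hr.2.trans_le hle⟩
    exact autonomous_unique_of_eventuallyEq hX
      (fun r hr => hh r (hmono _ (min_le_left _ _) hr))
      (fun r hr => hg t ht' r (hmono _ (min_le_right _ _) hr)) (hh₀.trans (hg₀ t ht').symm)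
      ⟨ht.1, lt_min ht.2 (hT t ht')⟩
  have hsub : ∀ T' (h : ℝ → E), (∀ t ∈ initialInterval T', HasDerivAt h (X (h t)) t) →
      h =ᶠ[𝓝[>] 0] f₀ → T' ≤ sSup S := fun T' h hh hh₀ => le_sSup ⟨h, hh, hh₀⟩
  have hT₀S := hsub T₀ f₀ hf₀ EventuallyEq.rfl
  refine ⟨sSup S, fun t => g t t, hT₀.trans_le hT₀S, ?_, ?_, ?_⟩
  · filter_upwards [initialInterval_mem_nhdsGT hT₀] with t ht
    exact (key T₀ f₀ hf₀ EventuallyEq.rfl t ht ⟨ht.1, ht.2.trans_le hT₀S⟩).symm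
  · intro t ht
    have ht' : t ∈ initialInterval (T t) := ⟨ht.1, hT t ht⟩
    -- Near `t` the diagonal curve r ↦ g r r coincides with the single solution `g t`.
    refine (hg t ht t ht').congr_of_eventuallyEq ?_
    filter_upwards [(isOpen_initialInterval (T t)).mem_nhds ht',
      (isOpen_initialInterval (sSup S)).mem_nhds ht] with r hr hr'
    exact (key (T t) (g t) (hg t ht) (hg₀ t ht) r hr hr').symm
  · intro T' h hh hh₀
    have hle := hsub T' h hh hh₀
    exact ⟨hle, fun t ht => key T' h hh hh₀ t ht ⟨ht.1, ht.2.trans_le hle⟩⟩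

end Autonomous

/-- Bootstrap: if f is C^k then so is f' = X ∘ f, hence f is C^{k+1}. -/
theorem contDiffOn_of_autonomous {E : Type*} [NormedAddCommGroup E] [NormedSpace ℝ E]
    {X : E → E} (hX : ContDiff ℝ ∞ X) {I : Set ℝ} (hI : IsOpen I) {f : ℝ → E}
    (hf : ∀ t ∈ I, HasDerivAt f (X (f t)) t) : ContDiffOn ℝ ∞ f I := by
  rw [contDiffOn_infty]
  intro k
  induction k with
  | zero =>
    exact contDiffOn_zero.2 fun t ht => (hf t ht).continuousAt.continuousWithinAt
  | succ k ih =>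
    push_cast
    rw [contDiffOn_succ_iff_deriv_of_isOpen hI]
    refine ⟨fun t ht => (hf t ht).differentiableAt.differentiableWithinAt, by simp, ?_⟩
    exact ((hX.of_le (by exact_mod_cast le_top)).comp_contDiffOn ih).congr
      fun t ht => (hf t ht).deriv

/-! ### The class A equations in proper time -/

/-- The logarithms of the scale factors and the Hubble rates. -/
abbrev Phase : Type := (Fin 3 → ℝ) × (Fin 3 → ℝ)

/-- The structure constants of the orthonormal frame. -/
noncomputable def twist (n α : Fin 3 → ℝ) (i : Fin 3) : ℝ :=
  n i * Real.exp (2 * α i - ∑ j, α j)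

/-- The vector field of the class A equations. -/
noncomputable def classAField (n : Fin 3 → ℝ) (z : Phase) : Phase :=
  (z.2, fun i => toda (twist n z.1) i / 2 - (∑ j, z.2 j) * z.2 i)

/-- The energy density determined by the Hamiltonian constraint. -/
noncomputable def constraintDensity (n : Fin 3 → ℝ) (z : Phase) : ℝ :=
  ((∑ i, z.2 i) ^ 2 - ∑ i, z.2 i ^ 2 - (∑ i, toda (twist n z.1) i) / 2) / 2

/-- The orbit is asymptotic at `t = 0` to the Kasner solution `aᵢ = t ^ pᵢ`. -/
structure IsKasnerLike (p : Fin 3 → ℝ) (f : ℝ → Phase) : Prop where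
  rate : ∀ i, Tendsto (fun t => t * (f t).2 i) (𝓝[>] 0) (𝓝 (p i))
  scale : ∀ i, Tendsto (fun t => (f t).1 i - p i * Real.log t) (𝓝[>] 0) (𝓝 0)

theorem contDiff_classAField (n : Fin 3 → ℝ) : ContDiff ℝ ∞ (classAField n) := by
  unfold classAField toda twist
  fun_prop

theorem contDiff_constraintDensity (n : Fin 3 → ℝ) : ContDiff ℝ ∞ (constraintDensity n) := by
  unfold constraintDensity toda twist
  fun_prop

theorem hasDerivAt_phase_iff {f : ℝ → Phase} {z : Phase} {t : ℝ} : HasDerivAt f z t ↔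
    (∀ i, HasDerivAt (fun s => (f s).1 i) (z.1 i) t) ∧
      ∀ i, HasDerivAt (fun s => (f s).2 i) (z.2 i) t := by
  rw [← hasDerivAt_pi, ← hasDerivAt_pi]
  exact ⟨fun h => ⟨h.fst, h.snd⟩, fun h => h.1.prodMk h.2⟩

theorem hasDerivAt_classA_iff {n : Fin 3 → ℝ} {f : ℝ → Phase} {t : ℝ} :
    HasDerivAt f (classAField n (f t)) t ↔
    (∀ i, HasDerivAt (fun s => (f s).1 i) ((f t).2 i) t) ∧
      ∀ i, HasDerivAt (fun s => (f s).2 i)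
        (toda (twist n (f t).1) i / 2 - (∑ j, (f t).2 j) * (f t).2 i) t :=
  hasDerivAt_phase_iff

theorem classA_exp_sum {n : Fin 3 → ℝ} {f : ℝ → Phase} {t : ℝ}
    (hf : HasDerivAt f (classAField n (f t)) t) :
    HasDerivAt (fun s => Real.exp (∑ i, (f s).1 i))
      (Real.exp (∑ i, (f t).1 i) * ∑ i, (f t).2 i) t :=
  (HasDerivAt.fun_sum fun i _ => (hasDerivAt_classA_iff.1 hf).1 i).exp

theorem exp_mul_twist (n α : Fin 3 → ℝ) (i : Fin 3) :
    Real.exp (∑ j, α j) * twist n α i = n i * Real.exp (2 * α i) := by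
  rw [twist, mul_left_comm, ← Real.exp_add]
  ring_nf

theorem exp_sq_mul_toda_twist (n α : Fin 3 → ℝ) (i : Fin 3) :
    Real.exp (∑ j, α j) ^ 2 * toda (twist n α) i =
      toda (fun j => n j * Real.exp (2 * α j)) i := by
  rw [← toda_mul]
  simp only [exp_mul_twist]

/-! ### Conservation of the constraint -/

theorem hasDerivAt_twist {n : Fin 3 → ℝ} {f : ℝ → Phase} {t : ℝ}
    (hf : HasDerivAt f (classAField n (f t)) t) (i : Fin 3) :
    HasDerivAt (fun s => twist n (f s).1 i)
      (twist n (f t).1 i * (2 * (f t).2 i - ∑ j, (f t).2 j)) t := by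
  have h := (hasDerivAt_classA_iff.1 hf).1
  exact ((((h i).const_mul 2).fun_sub (HasDerivAt.fun_sum fun j _ => h j)).exp.const_mul
    (n i)).congr_deriv (by rw [twist]; ring)

/-- Energy conservation for a stiff fluid, ρ' = -2θρ, balances V' = θV. With ρ given by the
constraint this is a polynomial identity in the H_i and the twists. -/
theorem hasDerivAt_exp_mul_constraintDensity {n : Fin 3 → ℝ} {f : ℝ → Phase} {t : ℝ}
    (hf : HasDerivAt f (classAField n (f t)) t) :
    HasDerivAt (fun s => Real.exp (∑ i, (f s).1 i) ^ 2 * constraintDensity n (f s)) 0 t := by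
  have h2 := (hasDerivAt_classA_iff.1 hf).2
  have hm := hasDerivAt_twist hf
  have htoda : ∀ i, HasDerivAt (fun s => toda (twist n (f s).1) i) _ t := fun i =>
    (((hm (i + 1)).fun_sub (hm (i + 2))).fun_pow 2).fun_sub ((hm i).fun_pow 2)
  have hd : HasDerivAt (fun s => constraintDensity n (f s)) _ t :=
    ((((HasDerivAt.fun_sum (u := Finset.univ) fun i _ => h2 i).fun_pow 2).sub
      (HasDerivAt.fun_sum (u := Finset.univ) fun i _ => (h2 i).fun_pow 2)).sub
      ((HasDerivAt.fun_sum (u := Finset.univ) fun i _ => htoda i).div_const 2)).div_const 2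
  refine (((classA_exp_sum hf).fun_pow 2).fun_mul hd).congr_deriv ?_
  simp only [constraintDensity, toda, show (2 : ℕ) - 1 = 1 from rfl, pow_one, Nat.cast_ofNat,
    Fin.sum_univ_three, Fin.isValue, zero_add,
    show (1 : Fin 3) + 1 = 2 from rfl, show (1 : Fin 3) + 2 = 0 from rfl,
    show (2 : Fin 3) + 1 = 0 from rfl, show (2 : Fin 3) + 2 = 1 from rfl]
  ring

/-! ### Orbits asymptotic to Kasner solutions -/

section Kasner

variable {p n : Fin 3 → ℝ} {f : ℝ → Phase}

theorem IsKasnerLike.exp_sum (hf : IsKasnerLike p f) (hp : ∑ i, p i = 1) :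
    Tendsto (fun t => Real.exp (∑ i, (f t).1 i) / t) (𝓝[>] 0) (𝓝 1) := by
  have h1 : Tendsto (fun t => Real.exp (∑ i, ((f t).1 i - p i * Real.log t))) (𝓝[>] 0) (𝓝 1) := by
    simpa [Function.comp_def] using (Real.continuous_exp.tendsto _).comp
      (tendsto_finsetSum Finset.univ fun i _ => hf.scale i)
  refine h1.congr' ?_
  filter_upwards [self_mem_nhdsWithin] with t ht
  rw [Finset.sum_sub_distrib, ← Finset.sum_mul, hp, one_mul, Real.exp_sub, Real.exp_log ht]

theorem IsKasnerLike.exp_sum_mul (hf : IsKasnerLike p f) (hp : ∑ i, p i = 1) (i : Fin 3) :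
    Tendsto (fun t => Real.exp (∑ j, (f t).1 j) * (f t).2 i) (𝓝[>] 0) (𝓝 (p i)) := by
  have := (hf.exp_sum hp).mul (hf.rate i)
  rw [one_mul] at this
  refine this.congr' ?_
  filter_upwards [self_mem_nhdsWithin] with t ht
  have ht' : t ≠ 0 := ne_of_gt ht
  field_simp

/-- Since α_i = p_i log t + o(1), a positive p_i sends the exponential to 0; no sign is needed when
n_i = 0. -/
theorem IsKasnerLike.curvature (hf : IsKasnerLike p f) (hnp : ∀ i, n i ≠ 0 → 0 < p i)
    (i : Fin 3) :
    Tendsto (fun t => n i * Real.exp (2 * (f t).1 i)) (𝓝[>] 0) (𝓝 0) := by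
  by_cases hi : n i = 0
  · simp [hi]
  · have h1 : Tendsto (fun t => p i * Real.log t) (𝓝[>] 0) atBot :=
      Real.tendsto_log_nhdsGT_zero.const_mul_atBot (hnp i hi)
    have h2 : Tendsto (fun t => 2 * (f t).1 i) (𝓝[>] 0) atBot := by
      have := (h1.atBot_add (hf.scale i)).const_mul_atBot two_pos
      exact this.congr fun t => by ring
    simpa using (Real.tendsto_exp_atBot.comp h2).const_mul (n i)

/-- The conserved quantity is evaluated in the limit t → 0, where V H_i → p_i and the curvature
terms, multiplied by V², vanish. -/
theorem IsKasnerLike.constraintDensity_eq (hf : IsKasnerLike p f) (hp : ∑ i, p i = 1)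
    (hnp : ∀ i, n i ≠ 0 → 0 < p i) {T : EReal}
    (hsol : ∀ t ∈ initialInterval T, HasDerivAt f (classAField n (f t)) t) {t : ℝ}
    (ht : t ∈ initialInterval T) :
    Real.exp (∑ i, (f t).1 i) ^ 2 * constraintDensity n (f t) = (1 - ∑ i, p i ^ 2) / 2 := by
  have hT : 0 < T := lt_trans (by exact_mod_cast ht.1) ht.2
  set F : ℝ → ℝ := fun s => Real.exp (∑ i, (f s).1 i) ^ 2 * constraintDensity n (f s) with hF
  have hconst : ∀ s ∈ initialInterval T, F s = F t := fun s hs =>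
    (isOpen_initialInterval T).is_const_of_deriv_eq_zero
      (ordConnected_initialInterval T).isPreconnected
      (fun s hs => (hasDerivAt_exp_mul_constraintDensity
        (hsol s hs)).differentiableAt.differentiableWithinAt)
      (fun s hs => (hasDerivAt_exp_mul_constraintDensity (hsol s hs)).deriv) hs ht
  have hl1 : Tendsto F (𝓝[>] 0) (𝓝 (F t)) := tendsto_const_nhds.congr' (by
    filter_upwards [initialInterval_mem_nhdsGT hT] with s hs using (hconst s hs).symm)
  have htoda : ∀ i, Tendsto (fun s => toda (fun j => n j * Real.exp (2 * (f s).1 j)) i)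
      (𝓝[>] 0) (𝓝 0) := fun i => by
    simpa [toda] using (((hf.curvature hnp (i + 1)).sub (hf.curvature hnp (i + 2))).pow 2).sub
      ((hf.curvature hnp i).pow 2)
  have hl2 : Tendsto F (𝓝[>] 0)
      (𝓝 (((∑ i, p i) ^ 2 - ∑ i, p i ^ 2 - (∑ i : Fin 3, (0 : ℝ)) / 2) / 2)) := by
    have := ((((tendsto_finsetSum Finset.univ fun i _ => hf.exp_sum_mul hp i).pow 2).sub
      (tendsto_finsetSum Finset.univ fun i _ => (hf.exp_sum_mul hp i).pow 2)).sub
      ((tendsto_finsetSum Finset.univ fun i _ => htoda i).div_const 2)).div_const 2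
    refine this.congr fun s => ?_
    simp only [hF, constraintDensity, ← exp_sq_mul_toda_twist, ← Finset.mul_sum, mul_pow]
    ring
  have := tendsto_nhds_unique hl1 hl2
  rw [hp] at this
  simpa using this

/-! ### Passage between logarithmic and proper time -/

theorem exists_pos_le_of_ne_zero (hnp : ∀ i, n i ≠ 0 → 0 < p i) :
    ∃ κ : ℝ, 0 < κ ∧ ∀ j, n j ≠ 0 → κ ≤ p j := by
  have : ∀ i, ∃ κ : ℝ, 0 < κ ∧ (n i ≠ 0 → κ ≤ p i) := fun i => by
    by_cases hi : n i = 0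
    · exact ⟨1, one_pos, fun h => absurd hi h⟩
    · exact ⟨p i, hnp i hi, fun _ => le_rfl⟩
  choose κ hκ hκ' using this
  refine ⟨min (κ 0) (min (κ 1) (κ 2)), by simp [hκ], fun j hj => le_trans ?_ (hκ' j hj)⟩
  fin_cases j <;> simp

/-- The logarithmic system encodes the volume twice, by Σ b and by v. The discrepancy of the two has
zero derivative because Σ p = 1, and it vanishes at -∞. -/
theorem IsLogSolution.exp_sum {s₀ : ℝ} {a b : ℝ → Fin 3 → ℝ} {v : ℝ → ℝ}
    (h : IsLogSolution p n s₀ a b v) (hlim : IsDecaying a b v) (hp : ∑ i, p i = 1) {s : ℝ}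
    (hs : s < s₀) : Real.exp (∑ i, b s i) = 1 + v s := by
  have hd : ∀ s < s₀, HasDerivAt (fun s => (∑ i, b s i) - Real.log (1 + v s)) 0 s := fun s hs => by
    have hv := h.pos s hs
    refine ((HasDerivAt.fun_sum fun i _ => h.db s hs i).sub
      (((h.dv s hs).const_add 1).log hv.ne')).congr_deriv ?_
    rw [← Finset.sum_div, Finset.sum_sub_distrib, ← Finset.sum_mul, hp, ← sub_div, div_eq_zero_iff]
    left
    ring
  have hl : Tendsto (fun s => (∑ i, b s i) - Real.log (1 + v s)) atBot (𝓝 0) := by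
    have h1 : Tendsto (fun s => Real.log (1 + v s)) atBot (𝓝 0) := by
      simpa using (hlim.v.const_add 1).log (by norm_num)
    simpa using (tendsto_finsetSum Finset.univ fun i _ => hlim.b i).sub h1
  have := abs_le_exp_of_abs_deriv_le_exp (C := 0) one_pos hd (by simp) hl hs
  have h0 : (∑ i, b s i) = Real.log (1 + v s) := by
    rw [zero_div, zero_mul] at this
    exact sub_eq_zero.1 (abs_nonpos_iff.1 this)
  rw [h0, Real.exp_log (h.pos s hs)]

/-- The rates are recovered by dividing V H_i = p_i + a_i by t (1 + v); `IsLogSolution.exp_sum`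
identifies this denominator with the volume, which makes the curvature term come out right. -/
theorem exists_kasnerLike (hp : ∑ i, p i = 1) (hnp : ∀ i, n i ≠ 0 → 0 < p i) :
    ∃ (T : EReal) (f : ℝ → Phase), 0 < T ∧
      (∀ t ∈ initialInterval T, HasDerivAt f (classAField n (f t)) t) ∧ IsKasnerLike p f := by
  obtain ⟨κ, hκ, hκp⟩ := exists_pos_le_of_ne_zero hnp
  obtain ⟨s₀, a, b, v, h, hlim⟩ := exists_isLogSolution hκ hκp
  have hlog := Real.tendsto_log_nhdsGT_zero
  refine ⟨(Real.exp s₀ : ℝ), fun t => (fun i => p i * Real.log t + b (Real.log t) i,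
    fun i => (p i + a (Real.log t) i) / (t * (1 + v (Real.log t)))),
    by exact_mod_cast Real.exp_pos s₀, fun t ht => ?_, fun i => ?_, fun i => ?_⟩
  · have ht0 : 0 < t := ht.1
    have hs : Real.log t < s₀ := (Real.log_lt_iff_lt_exp ht0).2 (EReal.coe_lt_coe_iff.1 ht.2)
    have hv := h.pos _ hs
    have hl := Real.hasDerivAt_log ht0.ne'
    have hsum : Real.exp (∑ i, (p i * Real.log t + b (Real.log t) i)) =
        t * (1 + v (Real.log t)) := by
      rw [Finset.sum_add_distrib, ← Finset.sum_mul, hp, one_mul, Real.exp_add, Real.exp_log ht0,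
        h.exp_sum hlim hp hs]
    have hH : ∑ i, (p i + a (Real.log t) i) = 1 + ∑ i, a (Real.log t) i := by
      rw [Finset.sum_add_distrib, hp]
    rw [hasDerivAt_classA_iff]
    refine ⟨fun i => ?_, fun i => ?_⟩
    · refine ((hl.const_mul (p i)).add ((h.db _ hs i).comp t hl)).congr_deriv ?_
      field_simp
      ring
    · have hden := (hasDerivAt_id t).mul (((h.dv _ hs).comp t hl).const_add 1)
      refine ((((h.da _ hs i).comp t hl).const_add (p i)).div hden (by
        simp only [id, Pi.mul_apply]; positivity)).congr_deriv ?_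
      have htw := exp_sq_mul_toda_twist n (fun i => p i * Real.log t + b (Real.log t) i) i
      rw [hsum] at htw
      simp only [mul_add, ← mul_assoc] at htw
      simp only [← Finset.sum_div, hH, ← htw, id, Pi.mul_apply, Function.comp]
      generalize toda (twist n fun i => p i * Real.log t + b (Real.log t) i) i = Q
      field_simp
      ring
  · have h1 : Tendsto (fun t => (p i + a (Real.log t) i) / (1 + v (Real.log t))) (𝓝[>] 0)
        (𝓝 (p i)) := by
      simpa [Function.comp_def, Pi.div_def] using (((hlim.a i).comp hlog).const_add (p i)).div
        ((hlim.v.comp hlog).const_add 1) (by norm_num)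
    refine h1.congr' ?_
    filter_upwards [self_mem_nhdsWithin] with t ht
    have ht' : t ≠ 0 := ne_of_gt ht
    field_simp
  · simpa [Function.comp_def] using (hlim.b i).comp hlog

/-- The deviations of an orbit from the Kasner solution with exponents `p`, in logarithmic time. -/
theorem IsKasnerLike.isLogSolution (hf : IsKasnerLike p f) (hp : ∑ i, p i = 1) {T : EReal}
    {s₀ : ℝ} (hs₀ : (Real.exp s₀ : EReal) ≤ T)
    (hsol : ∀ t ∈ initialInterval T, HasDerivAt f (classAField n (f t)) t) :
    IsLogSolution p n s₀
      (fun s i => Real.exp (∑ j, (f (Real.exp s)).1 j) * (f (Real.exp s)).2 i - p i)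
      (fun s i => (f (Real.exp s)).1 i - p i * s)
      (fun s => Real.exp (∑ j, (f (Real.exp s)).1 j) * Real.exp (-s) - 1) ∧
    IsDecaying
      (fun s i => Real.exp (∑ j, (f (Real.exp s)).1 j) * (f (Real.exp s)).2 i - p i)
      (fun s i => (f (Real.exp s)).1 i - p i * s)
      (fun s => Real.exp (∑ j, (f (Real.exp s)).1 j) * Real.exp (-s) - 1) := by
  have hmem : ∀ s < s₀, Real.exp s ∈ initialInterval T := fun s hs =>
    ⟨Real.exp_pos s, lt_of_lt_of_le (by exact_mod_cast Real.exp_lt_exp.2 hs) hs₀⟩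
  have hexp : Tendsto Real.exp atBot (𝓝[>] 0) := Real.tendsto_exp_atBot_nhdsGT
  have hinv : ∀ s, Real.exp s * Real.exp (-s) = 1 := fun s => by rw [← Real.exp_add]; simp
  refine ⟨⟨fun s hs => ?_, fun s hs i => ?_, fun s hs i => ?_, fun s hs => ?_⟩,
    ⟨fun i => ?_, fun i => ?_, ?_⟩⟩
  · rw [add_sub_cancel]
    positivity
  · have hd := hsol _ (hmem s hs)
    have he := Real.hasDerivAt_exp s
    have h1 := (classA_exp_sum hd).comp s he
    have h2 := ((hasDerivAt_classA_iff.1 hd).2 i).comp s he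
    refine ((h1.mul h2).sub_const (p i)).congr_deriv ?_
    have htw := exp_sq_mul_toda_twist n (f (Real.exp s)).1 i
    have harg : ∀ j, 2 * p j * s + 2 * ((f (Real.exp s)).1 j - p j * s) =
        2 * (f (Real.exp s)).1 j := fun j => by ring
    simp only [harg, add_sub_cancel, ← htw, Function.comp]
    have : Real.exp (-s) = (Real.exp s)⁻¹ := Real.exp_neg s
    rw [this]
    field_simp
    ring
  · have hd := hsol _ (hmem s hs)
    have h1 := ((hasDerivAt_classA_iff.1 hd).1 i).comp s (Real.hasDerivAt_exp s)
    refine (h1.sub ((hasDerivAt_id s).const_mul (p i))).congr_deriv ?_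
    rw [add_sub_cancel, eq_div_iff (by positivity)]
    linear_combination Real.exp (∑ j, (f (Real.exp s)).1 j) * (f (Real.exp s)).2 i * hinv s
  · have hd := hsol _ (hmem s hs)
    have h1 := (classA_exp_sum hd).comp s (Real.hasDerivAt_exp s)
    have h2 := (hasDerivAt_exp_mul (-1) s)
    simp only [neg_one_mul] at h2
    refine ((h1.mul h2).sub_const 1).congr_deriv ?_
    rw [Finset.sum_sub_distrib, ← Finset.mul_sum, hp, Function.comp]
    linear_combination Real.exp (∑ j, (f (Real.exp s)).1 j) * (∑ j, (f (Real.exp s)).2 j) * hinv s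
  · simpa using ((hf.exp_sum_mul hp i).comp hexp).sub_const (p i)
  · simpa [Function.comp_def] using (hf.scale i).comp hexp
  · have := ((hf.exp_sum hp).comp hexp).sub_const 1
    rw [sub_self] at this
    refine this.congr fun s => ?_
    rw [Function.comp, Real.exp_neg, div_eq_mul_inv]

theorem IsKasnerLike.eventuallyEq {g : ℝ → Phase} (hf : IsKasnerLike p f) (hg : IsKasnerLike p g)
    (hp : ∑ i, p i = 1) (hnp : ∀ i, n i ≠ 0 → 0 < p i) {T T' : EReal} (hT : 0 < T) (hT' : 0 < T')
    (hsol : ∀ t ∈ initialInterval T, HasDerivAt f (classAField n (f t)) t)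
    (hsol' : ∀ t ∈ initialInterval T', HasDerivAt g (classAField n (g t)) t) :
    f =ᶠ[𝓝[>] 0] g := by
  obtain ⟨κ, hκ, hκp⟩ := exists_pos_le_of_ne_zero hnp
  obtain ⟨r, hr, hrr⟩ := Filter.nonempty_of_mem (inter_mem (initialInterval_mem_nhdsGT hT)
    (initialInterval_mem_nhdsGT hT'))
  have hre : Real.exp (Real.log r) = r := Real.exp_log hr.1
  obtain ⟨h1, h1'⟩ := hf.isLogSolution hp (s₀ := Real.log r) (by rw [hre]; exact hr.2.le) hsol
  obtain ⟨h2, h2'⟩ := hg.isLogSolution hp (s₀ := Real.log r) (by rw [hre]; exact hrr.2.le) hsol'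
  have key := Real.tendsto_log_nhdsGT_zero.eventually (h1.eventually_eq hκ hκp h1' h2 h2')
  filter_upwards [key, self_mem_nhdsWithin] with t ht ht0
  obtain ⟨ha, hb, hv⟩ := ht
  simp only [Real.exp_log (show 0 < t from ht0)] at ha hb hv
  have hb' : ∀ i, (f t).1 i = (g t).1 i := fun i => by simpa using congrFun hb i
  have hb'' : (f t).1 = (g t).1 := funext hb'
  refine Prod.ext hb'' (funext fun i => ?_)
  have := congrFun ha i
  rw [hb''] at this
  exact mul_left_cancel₀ (Real.exp_pos _).ne' (sub_left_inj.1 this)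

end Kasner

/-! ### Curvature of diagonal class A metrics -/

/-- The permutation symbol. -/
def levi : Fin 3 → Fin 3 → Fin 3 → ℝ :=
  ![![![0, 0, 0], ![0, 0, 1], ![0, -1, 0]], ![![0, 0, -1], ![0, 0, 0], ![1, 0, 0]],
    ![![0, 1, 0], ![-1, 0, 0], ![0, 0, 0]]]

/-- The structure constants of the frame `(∂_t, e₀, e₁, e₂)` with `[e_i, e_j] = ε_{ijk} n_k e_k`. -/
def classAStructure (n : Fin 3 → ℝ) : Option (Fin 3) → Option (Fin 3) → Option (Fin 3) → ℝ
  | some i, some j, some k => levi i j k * n k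
  | _, _, _ => 0

/-- The diagonal components of `-dt ⊗ dt + ∑ exp (2 αᵢ) ξⁱ ⊗ ξⁱ`. -/
noncomputable def diagMetric (α : Fin 3 → ℝ) : Option (Fin 3) → ℝ
  | none => -1
  | some i => Real.exp (2 * α i)

/-- The connection coefficients of `-dt ⊗ dt + ∑ exp (2 αᵢ) ξⁱ ⊗ ξⁱ`. -/
noncomputable def diagChristoffel (n : Fin 3 → ℝ) (z : Phase) :
    Option (Fin 3) → Option (Fin 3) → Option (Fin 3) → ℝ
  | none, some i, some j => if i = j then z.2 i else 0
  | some i, none, some j => if i = j then z.2 i else 0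
  | some i, some j, none => if i = j then z.2 i * Real.exp (2 * z.1 i) else 0
  | some i, some j, some k => levi i j k * (n k * Real.exp (2 * z.1 k) +
      n j * Real.exp (2 * z.1 j) - n i * Real.exp (2 * z.1 i)) / (2 * Real.exp (2 * z.1 k))
  | _, _, _ => 0

/-- The metric in the frame is diagonal on `I`, with coefficients `exp (2 αᵢ)` differentiable with
Hubble rates `Hᵢ`, where `f = (α, H)`. -/
structure IsDiagonalOn (g : ℝ → Matrix (Option (Fin 3)) (Option (Fin 3)) ℝ) (f : ℝ → Phase)
    (I : Set ℝ) : Prop where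
  isOpen : IsOpen I
  eq : ∀ t ∈ I, g t = Matrix.diagonal (diagMetric (f t).1)
  deriv : ∀ t ∈ I, ∀ i, HasDerivAt (fun s => (f s).1 i) ((f t).2 i) t

section Curvature

variable {n : Fin 3 → ℝ} {g : ℝ → Matrix (Option (Fin 3)) (Option (Fin 3)) ℝ} {f : ℝ → Phase}
  {I : Set ℝ} {t : ℝ}

theorem diagMetric_ne_zero (α : Fin 3 → ℝ) (a : Option (Fin 3)) : diagMetric α a ≠ 0 := by
  cases a with
  | none => simp [diagMetric]
  | some i => exact (Real.exp_pos _).ne'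

theorem inv_diagonal_diagMetric (α : Fin 3 → ℝ) :
    (Matrix.diagonal (diagMetric α))⁻¹ = Matrix.diagonal fun a => (diagMetric α a)⁻¹ := by
  refine Matrix.inv_eq_right_inv ?_
  rw [Matrix.diagonal_mul_diagonal, ← Matrix.diagonal_one]
  congr 1
  funext a
  exact mul_inv_cancel₀ (diagMetric_ne_zero α a)

theorem IsDiagonalOn.frameDeriv_eq (h : IsDiagonalOn g f I) (ht : t ∈ I)
    (a b d : Option (Fin 3)) : Spacetime.frameDeriv a (fun s => g s b d) t =
      match a, b, d with
      | none, some i, some j => if i = j then 2 * (f t).2 i * Real.exp (2 * (f t).1 i) else 0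
      | _, _, _ => 0 := by
  cases a with
  | some a => rfl
  | none =>
    have hev : (fun s => g s b d) =ᶠ[𝓝 t] fun s => Matrix.diagonal (diagMetric (f s).1) b d := by
      filter_upwards [h.isOpen.mem_nhds ht] with s hs
      rw [h.eq s hs]
    rw [Spacetime.frameDeriv, hev.deriv_eq]
    match b, d with
    | none, none => simp [diagMetric]
    | none, some j => simp
    | some i, none => simp
    | some i, some j =>
      by_cases hij : i = j
      · subst hij
        simp only [Matrix.diagonal_apply_eq, diagMetric, if_true]
        rw [((h.deriv t ht i).const_mul 2).exp.deriv]
        ring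
      · have : some i ≠ some j := fun h => hij (Option.some_injective _ h)
        simp [this, hij]

set_option maxHeartbeats 1000000 in
theorem IsDiagonalOn.christoffel_eq (h : IsDiagonalOn g f I) (ht : t ∈ I)
    (a b d : Option (Fin 3)) :
    christoffel Spacetime.frameDeriv (classAStructure n) g a b d t =
      diagChristoffel n (f t) a b d := by
  have hinv : ∀ x, ((g t)⁻¹ x d) = if x = d then (diagMetric (f t).1 x)⁻¹ else 0 := fun x => by
    rw [h.eq t ht, inv_diagonal_diagMetric, Matrix.diagonal_apply]
  simp only [christoffel, hinv, mul_ite, mul_zero, Finset.sum_ite_eq', Finset.mem_univ, if_true]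
  simp only [koszul, h.frameDeriv_eq ht, h.eq t ht, Matrix.diagonal_apply, mul_ite, mul_zero,
    Finset.sum_sub_distrib, Finset.sum_ite_eq', Finset.mem_univ, if_true]
  have hexp : ∀ i, Real.exp (2 * (f t).1 i) ≠ 0 := fun i => (Real.exp_pos _).ne'
  match a, b, d with
  | none, none, none => simp [diagChristoffel, classAStructure]
  | none, none, some k => simp [diagChristoffel, classAStructure]
  | none, some j, none => simp [diagChristoffel, classAStructure]
  | some i, none, none => simp [diagChristoffel, classAStructure]
  | none, some j, some k =>
    by_cases hjk : j = k
    · subst hjk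
      simp only [classAStructure, diagChristoffel, diagMetric, if_true]
      field_simp [hexp j]
      simp
    · simp [diagChristoffel, classAStructure, hjk]
  | some i, none, some k =>
    by_cases hjk : i = k
    · subst hjk
      simp only [classAStructure, diagChristoffel, diagMetric, if_true]
      field_simp [hexp i]
      simp
    · simp [diagChristoffel, classAStructure, hjk]
  | some i, some j, none =>
    by_cases hjk : i = j
    · subst hjk
      simp [diagChristoffel, classAStructure, diagMetric]
      ring
    · simp [diagChristoffel, classAStructure, hjk]
  | some i, some j, some k =>
    -- Total antisymmetry expresses the three terms of the Koszul formula through one symbol, so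
    -- that a rational identity remains.
    have h1 : levi i k j = - levi i j k := by
      fin_cases i <;> fin_cases j <;> fin_cases k <;> simp [levi]
    have h2 : levi j k i = levi i j k := by
      fin_cases i <;> fin_cases j <;> fin_cases k <;> simp [levi]
    simp only [classAStructure, diagChristoffel, diagMetric, h1, h2]
    field_simp [hexp k]
    ring

/-- Only ∂_t differentiates nontrivially. In the Ricci formula this leaves coefficients with upper
index ∂_t, treated here, and the derivative of the trace when b = ∂_t, treated in the next lemma. -/
theorem IsDiagonalOn.deriv_christoffel_none (h : IsDiagonalOn g f I) (ht : t ∈ I)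
    {H' : Fin 3 → ℝ} (hH : ∀ i, HasDerivAt (fun s => (f s).2 i) (H' i) t) (b d : Option (Fin 3)) :
    Spacetime.frameDeriv none
      (fun s => christoffel Spacetime.frameDeriv (classAStructure n) g b d none s) t =
      match b, d with
      | some i, some j => if i = j then
          (H' i + 2 * (f t).2 i ^ 2) * Real.exp (2 * (f t).1 i) else 0
      | _, _ => 0 := by
  have hev : (fun s => christoffel Spacetime.frameDeriv (classAStructure n) g b d none s) =ᶠ[𝓝 t]
      fun s => diagChristoffel n (f s) b d none := by
    filter_upwards [h.isOpen.mem_nhds ht] with s hs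
    rw [h.christoffel_eq hs]
  rw [Spacetime.frameDeriv, hev.deriv_eq]
  match b, d with
  | none, none => simp [diagChristoffel]
  | none, some j => simp [diagChristoffel]
  | some i, none => simp [diagChristoffel]
  | some i, some j =>
    by_cases hij : i = j
    · subst hij
      simp only [diagChristoffel, if_true]
      rw [((hH i).fun_mul ((h.deriv t ht i).const_mul 2).exp).deriv]
      ring
    · simp [diagChristoffel, hij]

theorem IsDiagonalOn.deriv_christoffel_trace (h : IsDiagonalOn g f I) (ht : t ∈ I)
    {H' : Fin 3 → ℝ} (hH : ∀ i, HasDerivAt (fun s => (f s).2 i) (H' i) t) (a d : Option (Fin 3)) :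
    Spacetime.frameDeriv none
      (fun s => christoffel Spacetime.frameDeriv (classAStructure n) g a d a s) t =
      match a, d with
      | some i, none => H' i
      | _, _ => 0 := by
  have hev : (fun s => christoffel Spacetime.frameDeriv (classAStructure n) g a d a s) =ᶠ[𝓝 t]
      fun s => diagChristoffel n (f s) a d a := by
    filter_upwards [h.isOpen.mem_nhds ht] with s hs
    rw [h.christoffel_eq hs]
  rw [Spacetime.frameDeriv, hev.deriv_eq]
  match a, d with
  | none, none => simp [diagChristoffel]
  | none, some j => simp [diagChristoffel]
  | some i, none =>
    simp only [diagChristoffel, if_true]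
    exact (hH i).deriv
  | some i, some j =>
    have : levi i j i = 0 := by fin_cases i <;> fin_cases j <;> simp [levi]
    simp [diagChristoffel, this]

/-- The Ricci tensor of `-dt ⊗ dt + ∑ exp (2 αᵢ) ξⁱ ⊗ ξⁱ`, where `H'` are the derivatives of the
Hubble rates. -/
noncomputable def diagRicci (n : Fin 3 → ℝ) (z : Phase) (H' : Fin 3 → ℝ) :
    Option (Fin 3) → Option (Fin 3) → ℝ
  | none, none => -∑ i, (H' i + z.2 i ^ 2)
  | some i, some j => if i = j then Real.exp (2 * z.1 i) *
      (H' i + (∑ j, z.2 j) * z.2 i - toda (twist n z.1) i / 2) else 0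
  | _, _ => 0

/-- In this form the spatial Ricci components involve only e^{2α_0}, e^{2α_1}, e^{2α_2}, and become
rational identities once these are taken as independent variables. -/
theorem toda_twist_eq (n α : Fin 3 → ℝ) (i : Fin 3) : toda (twist n α) i =
    toda (fun j => n j * Real.exp (2 * α j)) i / ∏ j, Real.exp (2 * α j) := by
  rw [← exp_sq_mul_toda_twist, ← Real.exp_sum, ← Finset.mul_sum, two_mul, Real.exp_add]
  field_simp

set_option maxHeartbeats 4000000 in
theorem IsDiagonalOn.ricci_eq (h : IsDiagonalOn g f I) (ht : t ∈ I)
    {H' : Fin 3 → ℝ} (hH : ∀ i, HasDerivAt (fun s => (f s).2 i) (H' i) t) (b d : Option (Fin 3)) :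
    ricci Spacetime.frameDeriv (classAStructure n) g b d t = diagRicci n (f t) H' b d := by
  have hsome : ∀ (i : Fin 3) (F : ℝ → ℝ), Spacetime.frameDeriv (some i) F t = 0 := fun _ _ => rfl
  have hexp : ∀ i, Real.exp (2 * (f t).1 i) ≠ 0 := fun i => (Real.exp_pos _).ne'
  simp only [ricci, h.christoffel_eq ht, Fintype.sum_option, hsome,
    h.deriv_christoffel_none ht hH]
  match b, d with
  | none, none =>
    simp only [h.deriv_christoffel_trace ht hH]
    simp only [diagChristoffel, classAStructure, diagRicci, Fin.sum_univ_three]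
    simp
    ring
  | none, some j =>
    simp only [h.deriv_christoffel_trace ht hH]
    simp only [diagChristoffel, classAStructure, diagRicci, Fin.sum_univ_three]
    fin_cases j <;> simp [levi]
  | some i, none =>
    simp only [hsome, diagChristoffel, classAStructure, diagRicci, Fin.sum_univ_three]
    fin_cases i <;> simp [levi]
  | some i, some j =>
    have h0 := hexp 0
    have h1 := hexp 1
    have h2 := hexp 2
    simp only [hsome, diagChristoffel, classAStructure, diagRicci, Fin.sum_univ_three,
      toda_twist_eq]
    simp only [toda, Fin.prod_univ_three]
    fin_cases i <;> fin_cases j <;> simp [levi] <;>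
      generalize Real.exp (2 * (f t).1 0) = w0 at * <;>
      generalize Real.exp (2 * (f t).1 1) = w1 at * <;>
      generalize Real.exp (2 * (f t).1 2) = w2 at * <;> field_simp <;> ring

end Curvature

/-! ### Einstein's equations for diagonal class A metrics -/

theorem IsDiagonalOn.einstein_eq {n : Fin 3 → ℝ}
    {g : ℝ → Matrix (Option (Fin 3)) (Option (Fin 3)) ℝ} {f : ℝ → Phase} {I : Set ℝ} {t : ℝ}
    (h : IsDiagonalOn g f I) (ht : t ∈ I) {H' : Fin 3 → ℝ}
    (hH : ∀ i, HasDerivAt (fun s => (f s).2 i) (H' i) t) (b d : Option (Fin 3)) :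
    einstein Spacetime.frameDeriv (classAStructure n) g b d t =
      diagRicci n (f t) H' b d - 1 / 2 * (∑ i, (H' i + (f t).2 i ^ 2) +
        ∑ i, (H' i + (∑ j, (f t).2 j) * (f t).2 i - toda (twist n (f t).1) i / 2)) *
        Matrix.diagonal (diagMetric (f t).1) b d := by
  have hS : scalarCurvature Spacetime.frameDeriv (classAStructure n) g t =
      ∑ i, (H' i + (f t).2 i ^ 2) +
        ∑ i, (H' i + (∑ j, (f t).2 j) * (f t).2 i - toda (twist n (f t).1) i / 2) := by
    simp only [scalarCurvature, h.ricci_eq ht hH, h.eq t ht, inv_diagonal_diagMetric,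
      Matrix.diagonal_apply, ite_mul, zero_mul, Finset.sum_ite_eq, Finset.mem_univ, if_true]
    rw [Fintype.sum_option]
    congr 1
    · simp [diagMetric, diagRicci]
    · refine Finset.sum_congr rfl fun i _ => ?_
      simp only [diagMetric, diagRicci, if_true]
      rw [← mul_assoc, inv_mul_cancel₀ (Real.exp_pos _).ne', one_mul]
  rw [einstein, h.ricci_eq ht hH, hS, h.eq t ht]

/-- Einstein's equations for a stiff fluid amount to the class A equations and the Hamiltonian
constraint. -/
theorem IsDiagonalOn.einstein_iff {n : Fin 3 → ℝ}
    {g : ℝ → Matrix (Option (Fin 3)) (Option (Fin 3)) ℝ} {f : ℝ → Phase} {I : Set ℝ} {t : ℝ}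
    (h : IsDiagonalOn g f I) (ht : t ∈ I) {H' : Fin 3 → ℝ}
    (hH : ∀ i, HasDerivAt (fun s => (f s).2 i) (H' i) t) (ρ : ℝ) :
    (∀ b d, einstein Spacetime.frameDeriv (classAStructure n) g b d t =
      (ρ + ρ) * (if b = none ∧ d = none then 1 else 0) + ρ * g t b d) ↔
    (∀ i, H' i = toda (twist n (f t).1) i / 2 - (∑ j, (f t).2 j) * (f t).2 i) ∧
      ρ = constraintDensity n (f t) := by
  simp only [h.einstein_eq ht hH, h.eq t ht]
  constructor
  · intro hE
    have h0 := hE none none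
    have hi : ∀ i, (H' i + (∑ j, (f t).2 j) * (f t).2 i - toda (twist n (f t).1) i / 2) -
        1 / 2 * (∑ i, (H' i + (f t).2 i ^ 2) +
        ∑ i, (H' i + (∑ j, (f t).2 j) * (f t).2 i - toda (twist n (f t).1) i / 2)) = ρ :=
      fun i => by
        have hi := hE (some i) (some i)
        simp only [diagRicci, diagMetric, Matrix.diagonal_apply_eq, if_true, reduceCtorEq,
          and_self, if_false, mul_zero, zero_add] at hi
        refine mul_left_cancel₀ (Real.exp_pos (2 * (f t).1 i)).ne' ?_
        linear_combination hi
    simp only [diagRicci, diagMetric, Matrix.diagonal_apply_eq, and_self, if_true] at h0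
    have h1 := hi 0
    have h2 := hi 1
    have h3 := hi 2
    simp only [Fin.sum_univ_three, constraintDensity] at h0 h1 h2 h3 ⊢
    -- The four diagonal equations are linear in ρ and the H'_i when products are treated as atoms;
    -- they are solved for these four unknowns.
    refine ⟨fun i => ?_, by linarith⟩
    fin_cases i <;> simp only [Fin.zero_eta, Fin.mk_one, Fin.reduceFinMk] <;> linarith
  · rintro ⟨hH', hρ⟩ b d
    simp only [constraintDensity, Fin.sum_univ_three] at hρ
    have h1 := hH' 0
    have h2 := hH' 1
    have h3 := hH' 2
    match b, d with
    | none, none =>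
      simp only [diagRicci, diagMetric, Matrix.diagonal_apply_eq, and_self, if_true,
        Fin.sum_univ_three] at h1 h2 h3 ⊢
      linarith
    | none, some j => simp [diagRicci]
    | some i, none => simp [diagRicci]
    | some i, some j =>
      by_cases hij : i = j
      · subst hij
        have hi := hH' i
        simp only [diagRicci, diagMetric, Matrix.diagonal_apply_eq, if_true, reduceCtorEq,
          and_self, if_false, mul_zero, zero_add, hi, h1, h2, h3, Fin.sum_univ_three, hρ]
        ring
      · have : some i ≠ some j := fun h => hij (Option.some_injective _ h)
        simp [diagRicci, hij, this]

/-! ### Class A frames -/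

section Geometry

variable {G : Type*} [TopologicalSpace G] [ChartedSpace (EuclideanSpace ℝ (Fin 3)) G] [Group G]

/-- The brackets of the frame are `[e_i, e_j] = ε_{ijk} n_k e_k`. -/
def IsClassAFrame (e : Module.Basis (Fin 3) ℝ (Alg G)) (n : Fin 3 → ℝ) : Prop :=
  ⁅e 1, e 2⁆ = n 0 • e 0 ∧ ⁅e 2, e 0⁆ = n 1 • e 1 ∧ ⁅e 0, e 1⁆ = n 2 • e 2

theorem IsClassAFrame.lie_eq [LieGroup (𝓡 3) ∞ G] {e : Module.Basis (Fin 3) ℝ (Alg G)}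
    {n : Fin 3 → ℝ} (h : IsClassAFrame e n) (i j : Fin 3) :
    ⁅e i, e j⁆ = ∑ k, (levi i j k * n k) • e k := by
  obtain ⟨h0, h1, h2⟩ := h
  have h0' : ⁅e 2, e 1⁆ = -(n 0 • e 0) := by rw [← h0, lie_skew]
  have h1' : ⁅e 0, e 2⁆ = -(n 1 • e 1) := by rw [← h1, lie_skew]
  have h2' : ⁅e 1, e 0⁆ = -(n 2 • e 2) := by rw [← h2, lie_skew]
  fin_cases i <;> fin_cases j <;>
    simp [levi, Fin.sum_univ_three, h0, h1, h2, h0', h1', h2']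

theorem IsClassAFrame.structureConst_eq [LieGroup (𝓡 3) ∞ G]
    {e : Module.Basis (Fin 3) ℝ (Alg G)} {n : Fin 3 → ℝ} (h : IsClassAFrame e n) (i j k : Fin 3) :
    structureConst e i j k = levi i j k * n k := by
  rw [structureConst, h.lie_eq, map_sum, Finset.sum_apply']
  simp [Finsupp.single_apply]

theorem IsClassAFrame.frameStructure_eq [LieGroup (𝓡 3) ∞ G]
    {e : Module.Basis (Fin 3) ℝ (Alg G)} {n : Fin 3 → ℝ} (h : IsClassAFrame e n) :
    Spacetime.frameStructure e = classAStructure n := by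
  funext a b d
  match a, b, d with
  | some i, some j, some k => exact h.structureConst_eq i j k
  | none, _, _ => rfl
  | some i, none, _ => rfl
  | some i, some j, none => rfl

namespace Spacetime

/-- The metric is diagonal in the frame `e`, with coefficients `exp (2 αᵢ)` and Hubble rates `Hᵢ`,
where `f = (α, H)` solves the class A equations, and the density is given by the constraint. -/
structure IsDiagonalSolution (M : Spacetime G) (e : Module.Basis (Fin 3) ℝ (Alg G))
    (n : Fin 3 → ℝ) (f : ℝ → Phase) : Prop where
  sol : ∀ t ∈ M.interval, HasDerivAt f (classAField n (f t)) t
  metric : ∀ t ∈ M.interval, ∀ X Y : Alg G,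
    (M.metric t).onAlg X Y = ∑ i, Real.exp (2 * (f t).1 i) * (e.repr X i * e.repr Y i)
  density : ∀ t ∈ M.interval, M.ρ t = constraintDensity n (f t)

theorem isOpen_interval (M : Spacetime G) : IsOpen M.interval :=
  (isOpen_Ioi.preimage continuous_coe_real_ereal).inter
    (isOpen_Iio.preimage continuous_coe_real_ereal)

theorem frameMetric_eq_diagonal {M : Spacetime G} {e : Module.Basis (Fin 3) ℝ (Alg G)}
    {α : Fin 3 → ℝ} {t : ℝ}
    (h : ∀ X Y : Alg G, (M.metric t).onAlg X Y =
      ∑ i, Real.exp (2 * α i) * (e.repr X i * e.repr Y i)) :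
    M.frameMetric e t = Matrix.diagonal (diagMetric α) := by
  ext a b
  match a, b with
  | none, none => simp [frameMetric, diagMetric]
  | none, some j => simp [frameMetric]
  | some i, none => simp [frameMetric]
  | some i, some j =>
    simp only [frameMetric, Matrix.of_apply, h, Module.Basis.repr_self]
    by_cases hij : i = j
    · subst hij
      simp [diagMetric, Finsupp.single_apply]
    · have : some i ≠ some j := fun h => hij (Option.some_injective _ h)
      simp [this, Finsupp.single_apply, hij]

/-- The bridge from geometry to the ODE, with α_i = log a_i and H_i = a_i'/a_i. In the converse
direction smoothness of a_i and ρ costs nothing: orbits of a smooth field are smooth, and ρ is a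
smooth function of the phase. -/
theorem isStiffFluidSolution_iff [LieGroup (𝓡 3) ∞ G] (M : Spacetime G) :
    M.IsStiffFluidSolution ↔ ∃ e n f, IsClassAFrame e n ∧ M.IsDiagonalSolution e n f ∧
      ∀ t ∈ M.interval, 0 ≤ M.ρ t := by
  constructor
  · rintro ⟨e, n, a, hn, ha, hapos, hmetric, -, hρ0, hE⟩
    have hn : IsClassAFrame e n := hn
    have hda : ∀ i, ∀ t ∈ M.interval, HasDerivAt (a i) (deriv (a i) t) t := fun i t ht =>
      (((ha i).contDiffAt (M.isOpen_interval.mem_nhds ht)).differentiableAt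
        (by simp)).hasDerivAt
    have hdda : ∀ i, ∀ t ∈ M.interval, DifferentiableAt ℝ (deriv (a i)) t := fun i t ht =>
      (((contDiffOn_infty_iff_deriv_of_isOpen M.isOpen_interval).1 (ha i)).2.contDiffAt
        (M.isOpen_interval.mem_nhds ht)).differentiableAt (by simp)
    let f : ℝ → Phase := fun t => (fun i => Real.log (a i t), fun i => deriv (a i) t / a i t)
    have hm : ∀ t ∈ M.interval, ∀ X Y : Alg G, (M.metric t).onAlg X Y =
        ∑ i, Real.exp (2 * (f t).1 i) * (e.repr X i * e.repr Y i) := fun t ht X Y => by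
      rw [hmetric t ht]
      refine Finset.sum_congr rfl fun i _ => ?_
      rw [two_mul, Real.exp_add, Real.exp_log (hapos i t ht), sq]
    have hdiag : IsDiagonalOn (M.frameMetric e) f M.interval :=
      ⟨M.isOpen_interval, fun t ht => frameMetric_eq_diagonal (hm t ht),
        fun t ht i => (hda i t ht).log (hapos i t ht).ne'⟩
    have hH : ∀ t ∈ M.interval, ∀ i, HasDerivAt (fun s => (f s).2 i)
        (deriv (fun s => (f s).2 i) t) t := fun t ht i =>
      ((hdda i t ht).fun_div (hda i t ht).differentiableAt (hapos i t ht).ne').hasDerivAt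
    have key := fun t ht => (hdiag.einstein_iff (n := n) ht (hH t ht) (M.ρ t)).1 (by
      rw [← hn.frameStructure_eq]
      exact hE t ht)
    refine ⟨e, n, f, hn, ⟨fun t ht => hasDerivAt_classA_iff.2 ⟨hdiag.deriv t ht, fun i => ?_⟩, hm,
      fun t ht => (key t ht).2⟩, hρ0⟩
    rw [← (key t ht).1 i]
    exact hH t ht i
  · rintro ⟨e, n, f, hn, h, hρ0⟩
    have hf := contDiffOn_of_autonomous (contDiff_classAField n) M.isOpen_interval h.sol
    have hdiag : IsDiagonalOn (M.frameMetric e) f M.interval :=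
      ⟨M.isOpen_interval, fun t ht => frameMetric_eq_diagonal (h.metric t ht),
        fun t ht => (hasDerivAt_classA_iff.1 (h.sol t ht)).1⟩
    refine ⟨e, n, fun i t => Real.exp ((f t).1 i), hn, fun i => ?_, fun i t _ => Real.exp_pos _,
      fun t ht X Y => ?_, ?_, hρ0, fun t ht => ?_⟩
    · have : ContDiff ℝ ∞ fun z : Phase => Real.exp (z.1 i) := by fun_prop
      exact this.comp_contDiffOn hf
    · rw [h.metric t ht]
      refine Finset.sum_congr rfl fun i _ => ?_
      rw [two_mul, Real.exp_add, sq]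
    · exact ((contDiff_constraintDensity n).comp_contDiffOn hf).congr h.density
    · rw [hn.frameStructure_eq]
      exact (hdiag.einstein_iff ht (hasDerivAt_classA_iff.1 (h.sol t ht)).2 (M.ρ t)).2
        ⟨fun _ => rfl, h.density t ht⟩

/-! ### The Weingarten map in the diagonal frame -/

section Weingarten

variable {M : Spacetime G} {e : Module.Basis (Fin 3) ℝ (Alg G)} {n : Fin 3 → ℝ} {f : ℝ → Phase}

theorem IsDiagonalSolution.hasDerivAt_metric (h : M.IsDiagonalSolution e n f) {t : ℝ}
    (ht : t ∈ M.interval) (X Y : Alg G) :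
    HasDerivAt (fun s => (M.metric s).onAlg X Y)
      (∑ i, 2 * (f t).2 i * Real.exp (2 * (f t).1 i) * (e.repr X i * e.repr Y i)) t := by
  have h1 := HasDerivAt.fun_sum (u := Finset.univ) fun i _ =>
    ((((hasDerivAt_classA_iff.1 (h.sol t ht)).1 i).const_mul 2).exp.mul_const
      (e.repr X i * e.repr Y i))
  refine (h1.congr_of_eventuallyEq ?_).congr_deriv
    (Finset.sum_congr rfl fun i _ => by ring)
  filter_upwards [M.isOpen_interval.mem_nhds ht] with s hs using h.metric s hs X Y

/-- The defining choice is only known to satisfy its property once a map satisfying it is exhibited,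
here the diagonal one. Testing against `e i` then determines the components. -/
theorem IsDiagonalSolution.weingarten_apply (h : M.IsDiagonalSolution e n f) {t : ℝ}
    (ht : t ∈ M.interval) (X : Alg G) (i : Fin 3) :
    e.repr (M.weingarten t X) i = (f t).2 i * e.repr X i := by
  have hex : ∃ W : Module.End ℝ (Alg G), ∀ X Y : Alg G,
      (M.metric t).onAlg (W X) Y = (1 / 2) * deriv (fun s => (M.metric s).onAlg X Y) t := by
    refine ⟨e.constr ℝ fun i => (f t).2 i • e i, fun X Y => ?_⟩
    have hW : ∀ i, e.repr (e.constr ℝ (fun i => (f t).2 i • e i) X) i =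
        (f t).2 i * e.repr X i := fun i => by
      rw [Module.Basis.constr_apply_fintype, map_sum, Finset.sum_apply']
      simp [Finsupp.single_apply, mul_comm]
    rw [(h.hasDerivAt_metric ht X Y).deriv, h.metric t ht, Finset.mul_sum]
    refine Finset.sum_congr rfl fun i _ => ?_
    rw [hW]
    ring
  have hspec := Classical.epsilon_spec hex X (e i)
  change (M.metric t).onAlg (M.weingarten t X) (e i) = _ at hspec
  rw [(h.hasDerivAt_metric ht X (e i)).deriv, h.metric t ht] at hspec
  simp only [Module.Basis.repr_self, Finsupp.single_apply, mul_ite, mul_one, mul_zero,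
    Finset.sum_ite_eq, Finset.mem_univ, if_true] at hspec
  refine mul_left_cancel₀ (Real.exp_pos (2 * (f t).1 i)).ne' ?_
  rw [hspec]
  ring

theorem IsDiagonalSolution.weingarten_basis (h : M.IsDiagonalSolution e n f) {t : ℝ}
    (ht : t ∈ M.interval) (i : Fin 3) : M.weingarten t (e i) = (f t).2 i • e i := by
  refine e.repr.injective (Finsupp.ext fun j => ?_)
  rw [h.weingarten_apply ht]
  by_cases hij : i = j
  · subst hij
    simp
  · simp [hij]

theorem trace_eq_sum {e : Module.Basis (Fin 3) ℝ (Alg G)} {A : Module.End ℝ (Alg G)}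
    {p : Fin 3 → ℝ} (h : ∀ i, A (e i) = p i • e i) : LinearMap.trace ℝ (Alg G) A = ∑ i, p i := by
  rw [LinearMap.trace_eq_matrix_trace ℝ e, Matrix.trace]
  simp [LinearMap.toMatrix_apply, h]

theorem IsDiagonalSolution.θ_eq (h : M.IsDiagonalSolution e n f) {t : ℝ} (ht : t ∈ M.interval) :
    M.θ t = ∑ i, (f t).2 i := trace_eq_sum (h.weingarten_basis ht)

end Weingarten

end Spacetime

end Geometry

section LieGroup

variable {G : Type*} [TopologicalSpace G] [ChartedSpace (EuclideanSpace ℝ (Fin 3)) G] [Group G]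

/-! ### Left invariant metrics from inner products on the Lie algebra -/

theorem LeftInvariantMetric.ext_onAlg {h h' : LeftInvariantMetric G}
    (H : ∀ X Y : Alg G, h.onAlg X Y = h'.onAlg X Y) : h = h' := by
  -- The point x⁻¹ * x is not definitionally 1, so agreement at the identity is stated for every y
  -- with y = 1.
  have key : ∀ y : G, y = 1 → ∀ v w : TangentSpace (𝓡 3) y, h.form y v w = h'.form y v w := by
    rintro _ rfl v w
    exact H v w
  have hform : h.form = h'.form := by
    funext x
    refine LinearMap.ext fun v => LinearMap.ext fun w => ?_
    rw [← h.leftInvariant x⁻¹ x v w, ← h'.leftInvariant x⁻¹ x v w]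
    exact key _ (inv_mul_cancel x) _ _
  cases h
  cases h'
  congr

/-- The left Maurer-Cartan form. -/
noncomputable def maurerCartan (x : G) : TangentSpace (𝓡 3) x →L[ℝ] Alg G :=
  mfderiv (𝓡 3) (𝓡 3) (fun z : G => x⁻¹ * z) x

theorem mdifferentiableAt_mul_left [LieGroup (𝓡 3) ∞ G] (y x : G) :
    MDifferentiableAt (𝓡 3) (𝓡 3) (fun z : G => y * z) x :=
  (contMDiff_mul_left (I := 𝓡 3) (n := ∞)).contMDiffAt.mdifferentiableAt (by simp)

theorem mfderiv_mul_left_comp [LieGroup (𝓡 3) ∞ G] (y z x : G)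
    (v : TangentSpace (𝓡 3) x) :
    mfderiv (𝓡 3) (𝓡 3) (fun w : G => y * w) (z * x)
      (mfderiv (𝓡 3) (𝓡 3) (fun w : G => z * w) x v) =
    mfderiv (𝓡 3) (𝓡 3) (fun w : G => y * z * w) x v := by
  have : (fun w : G => y * z * w) = (fun w : G => y * w) ∘ fun w : G => z * w := by
    funext w
    simp [mul_assoc]
  rw [this, mfderiv_comp (I' := 𝓡 3) _ (mdifferentiableAt_mul_left _ _)
    (mdifferentiableAt_mul_left _ _)]
  rfl

theorem maurerCartan_mul [LieGroup (𝓡 3) ∞ G] (y x : G) (v : TangentSpace (𝓡 3) x) :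
    maurerCartan (y * x) (mfderiv (𝓡 3) (𝓡 3) (fun z : G => y * z) x v) = maurerCartan x v := by
  have h := mfderiv_mul_left_comp (y * x)⁻¹ y x v
  have h2 : (y * x)⁻¹ * y = x⁻¹ := by group
  rw [h2] at h
  exact h

theorem maurerCartan_one [LieGroup (𝓡 3) ∞ G] (v : Alg G) : maurerCartan (1 : G) v = v := by
  have : (fun z : G => (1 : G)⁻¹ * z) = id := by funext z; simp
  have h : mfderiv (𝓡 3) (𝓡 3) (fun z : G => (1 : G)⁻¹ * z) 1 =
      ContinuousLinearMap.id ℝ (TangentSpace (𝓡 3) (1 : G)) := by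
    rw [this, mfderiv_id]
  exact congrArg (fun A : TangentSpace (𝓡 3) (1 : G) →L[ℝ] TangentSpace (𝓡 3) (1 : G) => A v) h

theorem maurerCartan_injective [LieGroup (𝓡 3) ∞ G] {x : G} {v : TangentSpace (𝓡 3) x}
    (hv : maurerCartan x v = 0) : v = 0 := by
  have h := mfderiv_mul_left_comp x x⁻¹ x v
  have h1 : (fun w : G => x * x⁻¹ * w) = id := by funext z; simp
  rw [h1, mfderiv_id] at h
  have h2 : mfderiv (𝓡 3) (𝓡 3) (fun w : G => x⁻¹ * w) x v = 0 := hv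
  rw [h2, map_zero] at h
  exact h.symm

/-- The left invariant metric `∑ exp (2 αᵢ) ξⁱ ⊗ ξⁱ`, where `ξ` is the dual basis of `e`. -/
noncomputable def diagonalMetric [LieGroup (𝓡 3) ∞ G] (e : Module.Basis (Fin 3) ℝ (Alg G))
    (α : Fin 3 → ℝ) : LeftInvariantMetric G where
  form x := LinearMap.mk₂ ℝ (fun v w => ∑ i, Real.exp (2 * α i) *
      (e.repr (maurerCartan x v) i * e.repr (maurerCartan x w) i))
    (fun v v' w => by
      simp only [map_add, Finsupp.add_apply, ← Finset.sum_add_distrib]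
      exact Finset.sum_congr rfl fun i _ => by ring)
    (fun c v w => by
      simp only [map_smul, Finsupp.smul_apply, smul_eq_mul, Finset.mul_sum]
      exact Finset.sum_congr rfl fun i _ => by ring)
    (fun v w w' => by
      simp only [map_add, Finsupp.add_apply, ← Finset.sum_add_distrib]
      exact Finset.sum_congr rfl fun i _ => by ring)
    (fun c v w => by
      simp only [map_smul, Finsupp.smul_apply, smul_eq_mul, Finset.mul_sum]
      exact Finset.sum_congr rfl fun i _ => by ring)
  symm x v w := by
    simp only [LinearMap.mk₂_apply]
    exact Finset.sum_congr rfl fun i _ => by ring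
  pos x v hv := by
    simp only [LinearMap.mk₂_apply]
    obtain ⟨i, hi⟩ : ∃ i, e.repr (maurerCartan x v) i ≠ 0 := by
      by_contra! hcon
      exact hv (maurerCartan_injective (e.repr.map_eq_zero_iff.1 (Finsupp.ext hcon)))
    exact Finset.sum_pos' (fun j _ => mul_nonneg (Real.exp_pos _).le (mul_self_nonneg _))
      ⟨i, Finset.mem_univ i, mul_pos (Real.exp_pos _) (mul_self_pos.2 hi)⟩
  leftInvariant y x v w := by
    simp only [LinearMap.mk₂_apply, maurerCartan_mul]

theorem diagonalMetric_onAlg [LieGroup (𝓡 3) ∞ G] (e : Module.Basis (Fin 3) ℝ (Alg G))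
    (α : Fin 3 → ℝ) (X Y : Alg G) : (diagonalMetric e α).onAlg X Y =
      ∑ i, Real.exp (2 * α i) * (e.repr X i * e.repr Y i) := by
  simp only [LeftInvariantMetric.onAlg, diagonalMetric, LinearMap.mk₂_apply]
  simp only [maurerCartan_one]

/-! ### Eigenframes -/

/-- A component of `e i` along `e' j` can be nonzero only if p_i = p'_j. Choosing such a j for each
i is injective since p is, hence a permutation, and no other component can survive. -/
theorem exists_perm_of_eigenbases {K : Module.End ℝ (Alg G)}
    {e e' : Module.Basis (Fin 3) ℝ (Alg G)} {p p' : Fin 3 → ℝ} (hp : Function.Injective p)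
    (he : ∀ i, K (e i) = p i • e i) (he' : ∀ i, K (e' i) = p' i • e' i) :
    ∃ (σ : Equiv.Perm (Fin 3)) (c : Fin 3 → ℝ), (∀ i, c i ≠ 0) ∧
      (∀ i, e i = c i • e' (σ i)) ∧ ∀ i, p i = p' (σ i) := by
  have hK : ∀ X j, e'.repr (K X) j = p' j * e'.repr X j := fun X j => by
    have h : K X = ∑ i, e'.repr X i • p' i • e' i := by
      conv_lhs => rw [← e'.sum_repr X, map_sum]
      simp only [map_smul, he']
    rw [h, map_sum, Finset.sum_apply']
    simp [Finsupp.single_apply, mul_comm]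
  have hcoord : ∀ i j, e'.repr (e i) j ≠ 0 → p i = p' j := fun i j hij => by
    have := hK (e i) j
    rw [he, map_smul, Finsupp.smul_apply, smul_eq_mul] at this
    exact mul_right_cancel₀ hij this
  have hex : ∀ i, ∃ j, e'.repr (e i) j ≠ 0 := fun i => by
    by_contra! hcon
    exact e.ne_zero i (e'.repr.map_eq_zero_iff.1 (Finsupp.ext hcon))
  choose σ hσ using hex
  have hpσ : ∀ i, p i = p' (σ i) := fun i => hcoord i _ (hσ i)
  have hinj : Function.Injective σ := fun i j hij => hp (by rw [hpσ, hpσ, hij])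
  have hbij := Finite.injective_iff_bijective.1 hinj
  refine ⟨Equiv.ofBijective σ hbij, fun i => e'.repr (e i) (σ i), hσ, fun i => ?_, hpσ⟩
  refine e'.repr.injective (Finsupp.ext fun j => ?_)
  simp only [Equiv.ofBijective_apply, map_smul, Module.Basis.repr_self, Finsupp.smul_apply,
    smul_eq_mul, Finsupp.single_apply]
  by_cases hj : σ i = j
  · simp [hj]
  · simp only [hj, if_false, mul_zero]
    by_contra hne
    obtain ⟨k, rfl⟩ := hbij.2 j
    exact hj (congrArg σ (hp ((hcoord i _ hne).trans (hpσ k).symm)))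

theorem perm_eq_one_of_strictMono :
    ∀ σ : Equiv.Perm (Fin 3), (∀ i j, i < j → σ i < σ j) → σ = 1 := by
  decide

theorem IsEigenframe.exists_scaling {K : LeftInvariantEndomorphism G}
    {e e' : Module.Basis (Fin 3) ℝ (Alg G)} {p p' : Fin 3 → ℝ} (h : IsEigenframe K e p)
    (h' : IsEigenframe K e' p') :
    p = p' ∧ ∃ c : Fin 3 → ℝ, (∀ i, c i ≠ 0) ∧ ∀ i, e i = c i • e' i := by
  obtain ⟨σ, c, hc, he, hp⟩ := exists_perm_of_eigenbases h.strictMono.injective h.eigen h'.eigen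
  have hσ : ∀ i j, i < j → σ i < σ j := fun i j hij => by
    have := h.strictMono hij
    rwa [hp, hp, h'.strictMono.lt_iff_lt] at this
  have hid : σ = 1 := perm_eq_one_of_strictMono σ hσ
  subst hid
  exact ⟨funext hp, c, hc, he⟩

/-! ### Initial data in an orthonormal eigenframe -/

theorem onAlg_sum_left (h : LeftInvariantMetric G) (e : Module.Basis (Fin 3) ℝ (Alg G))
    (x : Fin 3 → ℝ) (Y : Alg G) :
    h.onAlg (∑ i, x i • e i) Y = ∑ i, x i * h.onAlg (e i) Y := by
  simp [LeftInvariantMetric.onAlg]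

theorem onAlg_comm (h : LeftInvariantMetric G) (X Y : Alg G) : h.onAlg X Y = h.onAlg Y X :=
  h.symm 1 X Y

theorem onAlg_smul_smul (h : LeftInvariantMetric G) (a b : ℝ) (X Y : Alg G) :
    h.onAlg (a • X) (b • Y) = a * (b * h.onAlg X Y) := by
  simp [LeftInvariantMetric.onAlg, mul_left_comm]

theorem onAlg_eq_of_orthonormal {h : LeftInvariantMetric G} {e : Module.Basis (Fin 3) ℝ (Alg G)}
    (he : ∀ i j, h.onAlg (e i) (e j) = if i = j then 1 else 0) (X Y : Alg G) :
    h.onAlg X Y = ∑ i, e.repr X i * e.repr Y i := by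
  have h1 : ∀ i, h.onAlg (e i) Y = e.repr Y i := fun i => by
    rw [onAlg_comm, ← e.sum_repr Y, onAlg_sum_left]
    simp [he]
  conv_lhs => rw [← e.sum_repr X, onAlg_sum_left]
  simp only [h1]

theorem structureConst_antisymm [LieGroup (𝓡 3) ∞ G] (e : Module.Basis (Fin 3) ℝ (Alg G))
    (i j k : Fin 3) : structureConst e i j k = -structureConst e j i k := by
  rw [structureConst, structureConst, ← lie_skew, map_neg, Finsupp.neg_apply]

theorem structureConst_self [LieGroup (𝓡 3) ∞ G] (e : Module.Basis (Fin 3) ℝ (Alg G))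
    (i k : Fin 3) : structureConst e i i k = 0 := by
  rw [structureConst, lie_self, map_zero, Finsupp.zero_apply]

/-- In an orthonormal frame with constant components, antisymmetry of the bracket reduces the Koszul
formula for Γ^i_{ij} to γ^i_{ij}. -/
theorem divergence_eq [LieGroup (𝓡 3) ∞ G] {h : LeftInvariantMetric G}
    {K : LeftInvariantEndomorphism G} {e : Module.Basis (Fin 3) ℝ (Alg G)} {p : Fin 3 → ℝ}
    (he : ∀ i j, h.onAlg (e i) (e j) = if i = j then 1 else 0)
    (hK : ∀ i, K.onAlg (e i) = p i • e i) (j : Fin 3) :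
    divergence h K e j = ∑ i, (p j - p i) * structureConst e i j i := by
  have hg : (Matrix.of fun i j => h.onAlg (e i) (e j)) = 1 := by
    ext i j
    rw [Matrix.of_apply, he, Matrix.one_apply]
  have hk : ∀ i j, e.repr (K.onAlg (e j)) i = if i = j then p j else 0 := fun i j => by
    rw [hK]
    simp [Finsupp.single_apply, eq_comm]
  have hΓ : ∀ i, christoffel (fun _ _ _ => 0) (structureConst e)
      (fun _ => (1 : Matrix (Fin 3) (Fin 3) ℝ)) i j i 0 = structureConst e i j i := fun i => by
    simp only [christoffel, koszul, inv_one, Matrix.one_apply, mul_ite, mul_one, mul_zero,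
      Finset.sum_ite_eq', Finset.mem_univ, if_true, Finset.sum_sub_distrib]
    rw [structureConst_self, structureConst_antisymm e j i i]
    ring
  simp only [divergence, hg, hk, ite_mul, mul_ite, mul_zero, zero_mul]
  refine Finset.sum_congr rfl fun i _ => ?_
  rw [Finset.sum_sub_distrib]
  simp only [Finset.sum_ite_eq, Finset.sum_ite_eq', Finset.mem_univ, if_true, hΓ]
  ring

theorem trace_ad_eq [LieGroup (𝓡 3) ∞ G] (e : Module.Basis (Fin 3) ℝ (Alg G)) (j : Fin 3) :
    LinearMap.trace ℝ (Alg G) (LieAlgebra.ad ℝ (Alg G) (e j)) = ∑ i, structureConst e j i i := by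
  rw [LinearMap.trace_eq_matrix_trace ℝ e, Matrix.trace]
  simp [LinearMap.toMatrix_apply, structureConst]

theorem IsQuiescentData.exists_orthonormal_eigenframe [LieGroup (𝓡 3) ∞ G]
    {h : LeftInvariantMetric G} {K : LeftInvariantEndomorphism G} {Ω₀ : ℝ}
    (hd : IsQuiescentData h K Ω₀) : ∃ (e : Module.Basis (Fin 3) ℝ (Alg G)) (p : Fin 3 → ℝ),
      IsEigenframe K e p ∧ ∀ i j, h.onAlg (e i) (e j) = if i = j then 1 else 0 := by
  obtain ⟨q, hq, hq'⟩ := hd.distinct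
  -- The eigenvalues are given without order; sorting an injective family makes it strictly
  -- increasing.
  set p : Fin 3 → ℝ := q ∘ Tuple.sort q with hp
  have hpm : StrictMono p := (Tuple.monotone_sort q).strictMono_of_injective
    (hq.comp (Tuple.sort q).injective)
  choose v hv using fun i => (hq' (Tuple.sort q i)).exists_hasEigenvector
  have hKv : ∀ i, K.onAlg (v i) = p i • v i := fun i => (hv i).apply_eq_smul
  have hpos : ∀ i, 0 < h.onAlg (v i) (v i) := fun i => h.pos 1 (v i) (hv i).2
  set w : Fin 3 → Alg G := fun i => (Real.sqrt (h.onAlg (v i) (v i)))⁻¹ • v i with hw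
  have hs : ∀ i, (Real.sqrt (h.onAlg (v i) (v i)))⁻¹ ≠ 0 := fun i =>
    inv_ne_zero (Real.sqrt_pos.2 (hpos i)).ne'
  have hKw : ∀ i, K.onAlg (w i) = p i • w i := fun i => by
    simp only [hw, map_smul, hKv]
    rw [smul_comm]
  have hli : LinearIndependent ℝ w := Module.End.eigenvectors_linearIndependent' K.onAlg p
    hpm.injective w fun i => ⟨Module.End.mem_eigenspace_iff.2 (hKw i), smul_ne_zero (hs i) (hv i).2⟩
  have hfin : Fintype.card (Fin 3) = Module.finrank ℝ (Alg G) := by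
    rw [Fintype.card_fin]
    exact (finrank_euclideanSpace_fin (𝕜 := ℝ) (n := 3)).symm
  refine ⟨basisOfLinearIndependentOfCardEqFinrank hli hfin, p, ⟨hpm, fun i => ?_⟩, fun i j => ?_⟩
  · simpa using hKw i
  · simp only [coe_basisOfLinearIndependentOfCardEqFinrank]
    by_cases hij : i = j
    · subst hij
      simp only [hw, onAlg_smul_smul, if_true]
      rw [← mul_assoc, ← mul_inv, Real.mul_self_sqrt (hpos i).le, inv_mul_cancel₀ (hpos i).ne']
    · have h1 := hd.symm (w i) (w j)
      have h2 := onAlg_smul_smul h (p i) 1 (w i) (w j)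
      have h3 := onAlg_smul_smul h 1 (p j) (w i) (w j)
      rw [one_smul] at h2 h3
      rw [hKw, hKw, h2, h3] at h1
      have h4 : (p i - p j) * h.onAlg (w i) (w j) = 0 := by linear_combination h1
      simpa [hij, sub_eq_zero, hpm.injective.ne hij] using h4

/-- For distinct i, j, k the divergence condition reads (p_j - p_i) γ^i_{ij} + (p_j - p_k) γ^k_{kj}
= 0, and unimodularity γ^i_{ij} + γ^k_{kj} = 0. Eliminating γ^k_{kj} leaves (p_k - p_i) γ^i_{ij} =
0. -/
theorem IsQuiescentData.exists_frame [LieGroup (𝓡 3) ∞ G]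
    {h : LeftInvariantMetric G} {K : LeftInvariantEndomorphism G} {Ω₀ : ℝ}
    (hd : IsQuiescentData h K Ω₀) :
    ∃ (e : Module.Basis (Fin 3) ℝ (Alg G)) (p n : Fin 3 → ℝ), IsEigenframe K e p ∧
      (∀ X Y, h.onAlg X Y = ∑ i, e.repr X i * e.repr Y i) ∧ IsClassAFrame e n ∧
      (∀ i, n i ≠ 0 → 0 < p i) ∧ ∑ i, p i = 1 ∧ ∑ i, p i ^ 2 + 2 * Ω₀ / 3 = 1 := by
  obtain ⟨e, p, he, hon⟩ := hd.exists_orthonormal_eigenframe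
  have hunit : ∀ i, h.onAlg (e i) (e i) = 1 := fun i => by simp [hon]
  have hq := hd.quiescent e p he hunit
  have hdiv : ∀ j, ∑ i, (p j - p i) * structureConst e i j i = 0 := fun j => by
    rw [← divergence_eq hon he.eigen, hd.div_eq]
  have htr : ∀ j, ∑ i, structureConst e j i i = 0 := fun j => by
    rw [← trace_ad_eq]
    exact hd.unimodular (e j)
  have hne : ∀ {i k : Fin 3}, i ≠ k → p k - p i ≠ 0 := fun hik =>
    sub_ne_zero.2 (he.strictMono.injective.ne hik.symm)
  have hanti := structureConst_antisymm e
  have hself := structureConst_self e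
  have hzero : ∀ i j k : Fin 3, i ≠ j → j ≠ k → i ≠ k → structureConst e i j i = 0 := by
    intro i j k hij hjk hik
    have hsum : ∀ F : Fin 3 → ℝ, ∑ l, F l = F i + F j + F k := fun F => by
      rw [Fin.sum_univ_three]
      fin_cases i <;> fin_cases j <;> fin_cases k <;> simp at hij hjk hik <;> simp <;> ring
    have h1 := hdiv j
    have h2 := htr j
    rw [hsum] at h1 h2
    rw [hanti j i i, hanti j k k, hself] at h2
    rw [hself] at h1
    have : (p k - p i) * structureConst e i j i = 0 := by
      linear_combination h1 + (p j - p k) * h2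
    exact (mul_eq_zero.1 this).resolve_left (hne hik)
  have hlie : ∀ i j, ⁅e i, e j⁆ = ∑ k, structureConst e i j k • e k := fun i j =>
    (e.sum_repr _).symm
  refine ⟨e, p, fun k => structureConst e (k + 1) (k + 2) k, he, onAlg_eq_of_orthonormal hon,
    ⟨?_, ?_, ?_⟩, fun k hk => ?_, ?_, ?_⟩
  · rw [hlie, Fin.sum_univ_three, hzero 1 2 0 (by decide) (by decide) (by decide), hanti 1 2 2,
      hzero 2 1 0 (by decide) (by decide) (by decide)]
    simp
  · rw [hlie, Fin.sum_univ_three, hzero 2 0 1 (by decide) (by decide) (by decide), hanti 2 0 0,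
      hzero 0 2 1 (by decide) (by decide) (by decide)]
    simp
  · rw [hlie, Fin.sum_univ_three, hzero 0 1 2 (by decide) (by decide) (by decide), hanti 0 1 1,
      hzero 1 0 2 (by decide) (by decide) (by decide)]
    simp
  · by_contra hcon
    have := hq (k + 1) (k + 2) k (by simp) (by simp) (by simp) (not_lt.1 hcon)
    exact hk (pow_eq_zero_iff two_ne_zero |>.1 this)
  · rw [← Spacetime.trace_eq_sum he.eigen, hd.trace_eq]
  · have h2 : ∀ i, (K.onAlg * K.onAlg) (e i) = p i ^ 2 • e i := fun i => by
      rw [Module.End.mul_apply, he.eigen, map_smul, he.eigen, smul_smul, sq]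
    rw [← Spacetime.trace_eq_sum h2, hd.trace_sq]

end LieGroup

/-! ### Change of frame -/

/-- Every permutation of ℤ/3 is a translation or a reflection, so it preserves or swaps the two
other indices in cyclic order. -/
theorem perm_fin_three_cyclic : ∀ σ : Equiv.Perm (Fin 3),
    (∀ i, σ (i + 1) = σ i + 1 ∧ σ (i + 2) = σ i + 2) ∨
      ∀ i, σ (i + 1) = σ i + 2 ∧ σ (i + 2) = σ i + 1 := by
  decide

theorem toda_comp_perm (σ : Equiv.Perm (Fin 3)) {ε : ℝ} (hε : ε ^ 2 = 1) (m : Fin 3 → ℝ)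
    (i : Fin 3) : toda (fun i => ε * m (σ i)) i = toda m (σ i) := by
  rw [toda_mul ε (fun i => m (σ i)), hε, one_mul]
  simp only [toda]
  rcases perm_fin_three_cyclic σ with h | h
  · rw [(h i).1, (h i).2]
  · rw [(h i).1, (h i).2]
    ring

theorem exists_levi_perm (σ : Equiv.Perm (Fin 3)) :
    ∃ s : ℝ, s ^ 2 = 1 ∧ ∀ i, levi (σ (i + 1)) (σ (i + 2)) (σ i) = s := by
  rcases perm_fin_three_cyclic σ with h | h
  · refine ⟨1, by norm_num, fun i => ?_⟩
    rw [(h i).1, (h i).2]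
    generalize σ i = j
    fin_cases j <;> simp [levi]
  · refine ⟨-1, by norm_num, fun i => ?_⟩
    rw [(h i).1, (h i).2]
    generalize σ i = j
    fin_cases j <;> simp [levi]

section Geometry

variable {G : Type*} [TopologicalSpace G] [ChartedSpace (EuclideanSpace ℝ (Fin 3)) G] [Group G]

theorem isClassAFrame_iff {e : Module.Basis (Fin 3) ℝ (Alg G)} {n : Fin 3 → ℝ} :
    IsClassAFrame e n ↔ ∀ i, ⁅e (i + 1), e (i + 2)⁆ = n i • e i := by
  constructor
  · rintro ⟨h0, h1, h2⟩ i
    fin_cases i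
    exacts [h0, h1, h2]
  · exact fun h => ⟨h 0, h 1, h 2⟩

theorem IsClassAFrame.exists_sign [LieGroup (𝓡 3) ∞ G] {e e' : Module.Basis (Fin 3) ℝ (Alg G)}
    {n n' c : Fin 3 → ℝ} {σ : Equiv.Perm (Fin 3)} (h : IsClassAFrame e n)
    (h' : IsClassAFrame e' n') (he : ∀ i, e i = c i • e' (σ i)) :
    ∃ s : ℝ, s ^ 2 = 1 ∧ ∀ i, n i * c i = c (i + 1) * c (i + 2) * (s * n' (σ i)) := by
  obtain ⟨s, hs, hσ⟩ := exists_levi_perm σ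
  refine ⟨s, hs, fun i => ?_⟩
  have h1 := isClassAFrame_iff.1 h i
  rw [he i, he (i + 1), he (i + 2), smul_lie, lie_smul] at h1
  have h2 := congrArg (fun X => e'.repr X (σ i)) h1
  simp only [map_smul, Finsupp.smul_apply, smul_eq_mul, Module.Basis.repr_self,
    Finsupp.single_eq_same] at h2
  have h3 : e'.repr ⁅e' (σ (i + 1)), e' (σ (i + 2))⁆ (σ i) = s * n' (σ i) := by
    rw [← hσ i]
    exact h'.structureConst_eq _ _ _
  rw [h3] at h2
  linear_combination -h2

theorem repr_eq_mul_of_scaling {e e' : Module.Basis (Fin 3) ℝ (Alg G)} {c : Fin 3 → ℝ}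
    {σ : Equiv.Perm (Fin 3)} (he : ∀ i, e i = c i • e' (σ i)) (X : Alg G) (i : Fin 3) :
    e'.repr X (σ i) = c i * e.repr X i := by
  have h : X = ∑ i, (e.repr X i * c i) • e' (σ i) := by
    conv_lhs => rw [← e.sum_repr X]
    exact Finset.sum_congr rfl fun j _ => by rw [he, smul_smul]
  conv_lhs => rw [h, map_sum, Finset.sum_apply']
  simp [Finsupp.single_apply, mul_comm]

theorem continuous_repr (e : Module.Basis (Fin 3) ℝ (Alg G)) (i : Fin 3) :
    Continuous fun X : Alg G => e.repr X i := by
  have : T2Space (Alg G) := inferInstanceAs (T2Space (EuclideanSpace ℝ (Fin 3)))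
  have : FiniteDimensional ℝ (Alg G) := Module.Finite.of_basis e
  exact LinearMap.continuous_of_finiteDimensional (e.coord i)

namespace Spacetime

variable {M : Spacetime G} {e e' : Module.Basis (Fin 3) ℝ (Alg G)} {n n' c : Fin 3 → ℝ}
  {f : ℝ → Phase}

/-- The logarithmic scale factors and Hubble rates in the frame `c i • e (σ i)`. -/
noncomputable def reframe (σ : Equiv.Perm (Fin 3)) (c : Fin 3 → ℝ) (z : Phase) : Phase :=
  (fun i => z.1 (σ i) + Real.log |c i|, fun i => z.2 (σ i))

/-- Orientation is lost by using |c_i|, but it only shows up in the common sign ε = s · sgn(c₀c₁c₂),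
which is invisible to the quadratic `toda`. -/
theorem exists_twist_reframe {σ : Equiv.Perm (Fin 3)} (hc : ∀ i, c i ≠ 0) {s : ℝ}
    (hs : s ^ 2 = 1) (hn : ∀ i, n i * c i = c (i + 1) * c (i + 2) * (s * n' (σ i))) :
    ∃ ε : ℝ, ε ^ 2 = 1 ∧ ∀ z : Phase,
      twist n (reframe σ c z).1 = fun i => ε * twist n' z.1 (σ i) := by
  have habs : ∀ i, 0 < |c i| := fun i => abs_pos.2 (hc i)
  refine ⟨s * ((c 0 * c 1 * c 2) / |c 0 * c 1 * c 2|), ?_, fun z => funext fun i => ?_⟩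
  · have : |c 0 * c 1 * c 2| ≠ 0 := by simp [hc]
    rw [mul_pow, div_pow, sq_abs, div_self (by simpa using this), hs, one_mul]
  · have hsum : ∑ j, (z.1 (σ j) + Real.log |c j|) =
        ∑ j, z.1 j + (Real.log |c 0| + Real.log |c 1| + Real.log |c 2|) := by
      rw [Finset.sum_add_distrib, Equiv.sum_comp σ z.1, Fin.sum_univ_three (fun j => Real.log |c j|)]
    have hlog : Real.exp (Real.log |c i| + Real.log |c i| -
        (Real.log |c 0| + Real.log |c 1| + Real.log |c 2|)) = c i * c i / |c 0 * c 1 * c 2| := by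
      rw [Real.exp_sub, Real.exp_add, Real.exp_add, Real.exp_add, Real.exp_log (habs _),
        Real.exp_log (habs _), Real.exp_log (habs _), Real.exp_log (habs _), abs_mul_abs_self,
        abs_mul, abs_mul]
    simp only [twist, reframe, hsum]
    rw [show 2 * (z.1 (σ i) + Real.log |c i|) - (∑ j, z.1 j + (Real.log |c 0| + Real.log |c 1| +
      Real.log |c 2|)) = (2 * z.1 (σ i) - ∑ j, z.1 j) + (Real.log |c i| + Real.log |c i| -
      (Real.log |c 0| + Real.log |c 1| + Real.log |c 2|)) by ring, Real.exp_add, hlog]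
    have hprod : c (i + 1) * c (i + 2) * c i = c 0 * c 1 * c 2 := by
      fin_cases i <;> simp <;> ring
    linear_combination Real.exp (2 * z.1 (σ i) - ∑ j, z.1 j) / |c 0 * c 1 * c 2| *
      (c i * hn i + s * n' (σ i) * hprod)

theorem IsDiagonalSolution.reframe [LieGroup (𝓡 3) ∞ G] {σ : Equiv.Perm (Fin 3)}
    (h : M.IsDiagonalSolution e' n' f) (hn : IsClassAFrame e n) (hn' : IsClassAFrame e' n')
    (hc : ∀ i, c i ≠ 0) (he : ∀ i, e i = c i • e' (σ i)) :
    M.IsDiagonalSolution e n fun t => reframe σ c (f t) := by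
  obtain ⟨s, hs, hns⟩ := hn.exists_sign hn' he
  obtain ⟨ε, hε, htw⟩ := exists_twist_reframe (n := n) (n' := n') hc hs hns
  have htoda : ∀ z i, toda (twist n (Spacetime.reframe σ c z).1) i = toda (twist n' z.1) (σ i) :=
    fun z i => by rw [htw, toda_comp_perm σ hε]
  refine ⟨fun t ht => ?_, fun t ht X Y => ?_, fun t ht => ?_⟩
  · have h1 := hasDerivAt_classA_iff.1 (h.sol t ht)
    rw [hasDerivAt_classA_iff]
    refine ⟨fun i => (h1.1 (σ i)).add_const _, fun i => ?_⟩
    rw [htoda]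
    refine (h1.2 (σ i)).congr_deriv ?_
    simp only [Spacetime.reframe, Equiv.sum_comp σ (f t).2]
  · have hrepr := repr_eq_mul_of_scaling he
    rw [h.metric t ht, ← Equiv.sum_comp σ]
    refine Finset.sum_congr rfl fun i _ => ?_
    rw [hrepr, hrepr, Spacetime.reframe, mul_add, Real.exp_add, two_mul (Real.log |c i|),
      Real.exp_add, Real.exp_log (abs_pos.2 (hc i)), abs_mul_abs_self]
    ring
  · rw [h.density t ht]
    simp only [constraintDensity, htoda]
    simp only [Spacetime.reframe, Equiv.sum_comp σ (f t).2,
      Equiv.sum_comp σ (fun i => (f t).2 i ^ 2), Equiv.sum_comp σ (toda (twist n' (f t).1))]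

/-- The frame of a solution whose normalised Weingarten map has a limit consists of eigenvectors of
the limit. -/
theorem IsDiagonalSolution.exists_eigenvalues (h : M.IsDiagonalSolution e n f)
    {K : Module.End ℝ (Alg G)} {l : Filter ℝ} [l.NeBot] (hl : ∀ᶠ t in l, t ∈ M.interval)
    (hK : ∀ X, Tendsto (fun t => M.normalisedWeingarten t X) l (𝓝 (K X))) :
    ∃ p : Fin 3 → ℝ, ∀ i, K (e i) = p i • e i := by
  have : T2Space (Alg G) := inferInstanceAs (T2Space (EuclideanSpace ℝ (Fin 3)))
  refine ⟨fun i => e.repr (K (e i)) i, fun i => e.repr.injective (Finsupp.ext fun j => ?_)⟩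
  by_cases hij : i = j
  · subst hij
    simp
  · have h1 := ((continuous_repr e j).tendsto _).comp (hK (e i))
    have h2 : Tendsto (fun _ : ℝ => (0 : ℝ)) l (𝓝 (e.repr (K (e i)) j)) := by
      refine h1.congr' ?_
      filter_upwards [hl] with t ht
      simp [normalisedWeingarten, h.weingarten_basis ht, hij]
    have h3 := tendsto_nhds_unique tendsto_const_nhds h2
    simp [← h3, hij]

/-- The frame that comes with a solution is a priori unrelated to the data. Convergence of the
normalised Weingarten map makes it an eigenbasis of `K`, so the solution can be rewritten in the
fixed frame `e`. -/
theorem IsStiffFluidSolution.exists_isDiagonalSolution [LieGroup (𝓡 3) ∞ G]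
    (hM : M.IsStiffFluidSolution) {K : LeftInvariantEndomorphism G} {p : Fin 3 → ℝ}
    (he : IsEigenframe K e p) (hn : IsClassAFrame e n) {l : Filter ℝ} [l.NeBot]
    (hl : ∀ᶠ t in l, t ∈ M.interval)
    (hK : ∀ X, Tendsto (fun t => M.normalisedWeingarten t X) l (𝓝 (K.onAlg X))) :
    ∃ f, M.IsDiagonalSolution e n f := by
  obtain ⟨e', n', f', hn', hsol, -⟩ := M.isStiffFluidSolution_iff.1 hM
  obtain ⟨p', hp'⟩ := hsol.exists_eigenvalues hl hK
  obtain ⟨σ, c, hc, he', -⟩ := exists_perm_of_eigenbases he.strictMono.injective he.eigen hp'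
  exact ⟨_, hsol.reframe hn hn' hc he'⟩

/-! ### The left end of the existence interval -/

theorem atLeftEnd_of_coe {r : ℝ} (h : M.tMinus = r) : M.atLeftEnd = 𝓝[>] r := by
  rw [atLeftEnd, h, nhdsWithin, comap_inf, comap_principal,
    ← EReal.isEmbedding_coe.nhds_eq_comap, nhdsWithin]
  congr 2
  ext t
  simp

theorem atLeftEnd_of_bot (h : M.tMinus = ⊥) : M.atLeftEnd = atBot := by
  rw [atLeftEnd, h]
  ext s
  rw [mem_comap, mem_atBot_sets]
  constructor
  · rintro ⟨u, hu, hus⟩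
    obtain ⟨v, hv, hvu⟩ := mem_nhdsWithin_iff_exists_mem_nhds_inter.1 hu
    obtain ⟨y, hy⟩ := EReal.mem_nhds_bot_iff.1 hv
    refine ⟨y - 1, fun t ht => hus (hvu ⟨hy ?_, EReal.bot_lt_coe t⟩)⟩
    exact EReal.coe_lt_coe_iff.2 (by linarith)
  · rintro ⟨y, hy⟩
    refine ⟨Iio (y : EReal), mem_nhdsWithin_of_mem_nhds
      (EReal.mem_nhds_bot_iff.2 ⟨y, Subset.rfl⟩), fun t ht => hy t ?_⟩
    exact (EReal.coe_lt_coe_iff.1 ht).le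

theorem tMinus_eq_bot_or_coe (M : Spacetime G) : M.tMinus = ⊥ ∨ ∃ r : ℝ, M.tMinus = r := by
  have h := M.lt
  induction hM : M.tMinus using EReal.rec with
  | bot => exact .inl rfl
  | coe r => exact .inr ⟨r, rfl⟩
  | top => simp [hM] at h

instance atLeftEnd_neBot (M : Spacetime G) : M.atLeftEnd.NeBot := by
  rcases M.tMinus_eq_bot_or_coe with h | ⟨r, h⟩
  · rw [atLeftEnd_of_bot h]
    infer_instance
  · rw [atLeftEnd_of_coe h]
    infer_instance

theorem eventually_mem_interval (M : Spacetime G) : ∀ᶠ t in M.atLeftEnd, t ∈ M.interval := by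
  refine mem_of_superset (preimage_mem_comap (Ioo_mem_nhdsGT M.lt)) ?_
  exact fun t ht => ht

theorem eventually_le_of_mem (M : Spacetime G) {t₀ : ℝ} (ht₀ : t₀ ∈ M.interval) :
    ∀ᶠ t in M.atLeftEnd, t ≤ t₀ := by
  refine mem_of_superset (preimage_mem_comap (Ioo_mem_nhdsGT ht₀.1)) ?_
  exact fun t ht => (EReal.coe_lt_coe_iff.1 ht.2).le

end Spacetime

end Geometry

/-! ### Asymptotics of solutions inducing given data -/

section Geometry

variable {G : Type*} [TopologicalSpace G] [ChartedSpace (EuclideanSpace ℝ (Fin 3)) G] [Group G]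

namespace Spacetime

variable {M : Spacetime G} {e : Module.Basis (Fin 3) ℝ (Alg G)} {n p : Fin 3 → ℝ}
  {f : ℝ → Phase} {h : LeftInvariantMetric G} {K : LeftInvariantEndomorphism G} {Ω₀ : ℝ}

theorem IsDiagonalSolution.tendsto_rate_div (hf : M.IsDiagonalSolution e n f)
    (hM : M.InducesData h K Ω₀) (he : IsEigenframe K e p) (i : Fin 3) :
    Tendsto (fun t => (f t).2 i / M.θ t) M.atLeftEnd (𝓝 (p i)) := by
  have h1 := ((continuous_repr e i).tendsto _).comp (hM.weingarten_tendsto (e i))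
  have h2 : e.repr (K.onAlg (e i)) i = p i := by simp [he.eigen]
  rw [h2] at h1
  refine h1.congr' ?_
  filter_upwards [M.eventually_mem_interval] with t ht
  simp [normalisedWeingarten, hf.weingarten_basis ht, div_eq_inv_mul]

/-- Evaluating the metric form on `e i` gives e^{2α_i} = b_i² θ^{-2p_i}, and b_i² → 1 because `e` is
orthonormal for `h`. -/
theorem IsDiagonalSolution.tendsto_scale_add_log (hf : M.IsDiagonalSolution e n f)
    (hM : M.InducesData h K Ω₀) (he : IsEigenframe K e p)
    (hh : ∀ X Y, h.onAlg X Y = ∑ i, e.repr X i * e.repr Y i) (i : Fin 3) :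
    Tendsto (fun t => (f t).1 i + p i * Real.log (M.θ t)) M.atLeftEnd (𝓝 0) := by
  obtain ⟨t₀, ht₀, b, hb, hlim⟩ := hM.metric_form e p he
  have h1 := hlim (e i) (e i)
  have h2 : h.onAlg (e i) (e i) = 1 := by simp [hh, Finsupp.single_apply]
  rw [h2] at h1
  have h3 : Tendsto (fun t => Real.exp (2 * ((f t).1 i + p i * Real.log (M.θ t))))
      M.atLeftEnd (𝓝 1) := by
    refine h1.congr' ?_
    filter_upwards [M.eventually_mem_interval, M.eventually_le_of_mem ht₀] with t ht htt
    obtain ⟨hθ, -, hm⟩ := hb t ht htt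
    have h4 := hm (e i) (e i)
    rw [hf.metric t ht] at h4
    simp only [Module.Basis.repr_self, Finsupp.single_apply, mul_ite, mul_one, mul_zero,
      Finset.sum_ite_eq, Finset.mem_univ, if_true] at h4 ⊢
    rw [mul_add, Real.exp_add, h4, Real.rpow_def_of_pos hθ, mul_assoc, ← Real.exp_add]
    ring_nf
    simp
  have h4 := (h3.log one_ne_zero).const_mul (1 / 2)
  simpa using h4

theorem IsDiagonalSolution.tendsto_exp_sum_mul (hf : M.IsDiagonalSolution e n f)
    (hM : M.InducesData h K Ω₀) (he : IsEigenframe K e p)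
    (hh : ∀ X Y, h.onAlg X Y = ∑ i, e.repr X i * e.repr Y i) (hp : ∑ i, p i = 1) :
    Tendsto (fun t => Real.exp (∑ i, (f t).1 i) * M.θ t) M.atLeftEnd (𝓝 1) := by
  have h1 := (Real.continuous_exp.tendsto _).comp
    (tendsto_finsetSum Finset.univ fun i _ => hf.tendsto_scale_add_log hM he hh i)
  simp only [Finset.sum_const_zero, Real.exp_zero] at h1
  refine h1.congr' ?_
  filter_upwards [hM.crushing.eventually_gt_atTop 0] with t ht
  rw [Function.comp_apply, Finset.sum_add_distrib, ← Finset.sum_mul, hp, one_mul, Real.exp_add,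
    Real.exp_log ht]

theorem IsDiagonalSolution.tendsto_exp_sum (hf : M.IsDiagonalSolution e n f)
    (hM : M.InducesData h K Ω₀) (he : IsEigenframe K e p)
    (hh : ∀ X Y, h.onAlg X Y = ∑ i, e.repr X i * e.repr Y i) (hp : ∑ i, p i = 1) :
    Tendsto (fun t => Real.exp (∑ i, (f t).1 i)) M.atLeftEnd (𝓝 0) := by
  refine ((hf.tendsto_exp_sum_mul hM he hh hp).div_atTop hM.crushing).congr' ?_
  filter_upwards [hM.crushing.eventually_gt_atTop 0] with t ht
  rw [mul_div_cancel_right₀ _ ht.ne']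

theorem IsDiagonalSolution.hasDerivAt_exp_sum (hf : M.IsDiagonalSolution e n f) {t : ℝ}
    (ht : t ∈ M.interval) : HasDerivAt (fun s => Real.exp (∑ i, (f s).1 i))
      (Real.exp (∑ i, (f t).1 i) * M.θ t) t := by
  rw [hf.θ_eq ht]
  exact classA_exp_sum (hf.sol t ht)

/-- The singularity is reached in finite time. -/
theorem IsDiagonalSolution.exists_tMinus_eq (hf : M.IsDiagonalSolution e n f)
    (hM : M.InducesData h K Ω₀) (he : IsEigenframe K e p)
    (hh : ∀ X Y, h.onAlg X Y = ∑ i, e.repr X i * e.repr Y i) (hp : ∑ i, p i = 1) :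
    ∃ r : ℝ, M.tMinus = r := by
  refine M.tMinus_eq_bot_or_coe.resolve_left fun hbot => ?_
  have h1 := hf.tendsto_exp_sum_mul hM he hh hp
  have h2 := M.eventually_mem_interval
  rw [atLeftEnd_of_bot hbot] at h1 h2
  obtain ⟨c, hc⟩ := eventually_atBot.1 (h2.and (h1.eventually_const_le (u := 1 / 2) (by norm_num)))
  set V : ℝ → ℝ := fun t => Real.exp (∑ i, (f t).1 i) with hV
  have hd : ∀ t ≤ c, HasDerivAt V (V t * M.θ t) t := fun t ht =>
    hf.hasDerivAt_exp_sum (hc t ht).1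
  have hVc : 0 < V c := Real.exp_pos _
  have hint : ∀ t ∈ interior (Iic c), t ≤ c := fun t ht => mem_Iic.1 (interior_subset ht)
  -- As V' = Vθ ≥ 1/2 on all of (-∞, c], going back by 2 V(c) would make the positive function V
  -- nonpositive.
  have key := (convex_Iic c).mul_sub_le_image_sub_of_le_deriv (f := V) (C := 1 / 2)
    (fun t ht => (hd t ht).continuousAt.continuousWithinAt)
    (fun t ht => (hd t (hint t ht)).differentiableAt.differentiableWithinAt)
    (fun t ht => by
      rw [(hd t (hint t ht)).deriv]
      exact (hc t (hint t ht)).2)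
    (c - 2 * V c) (by simp [hVc.le]) c self_mem_Iic (by linarith)
  have := Real.exp_pos (∑ i, (f (c - 2 * V c)).1 i)
  simp only [hV] at key this
  linarith

/-- A solution inducing data with eigenvalues `p` is asymptotic to a Kasner solution. -/
theorem IsDiagonalSolution.isKasnerLike (hf : M.IsDiagonalSolution e n f)
    (hM : M.InducesData h K Ω₀) (he : IsEigenframe K e p)
    (hh : ∀ X Y, h.onAlg X Y = ∑ i, e.repr X i * e.repr Y i) (hp : ∑ i, p i = 1) {r : ℝ}
    (hr : M.tMinus = r) : IsKasnerLike p fun t => f (t + r) := by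
  have hl := atLeftEnd_of_coe hr
  have h1 := hf.tendsto_exp_sum_mul hM he hh hp
  -- L'Hôpital: V and t - r both tend to 0, and the quotient of their derivatives is Vθ → 1.
  -- Dividing Vθ by this ratio yields (t - r) θ → 1.
  have hV : Tendsto (fun t => Real.exp (∑ i, (f t).1 i) / (t - r)) (𝓝[>] r) (𝓝 1) := by
    refine HasDerivAt.lhopital_zero_nhdsGT (g' := fun _ => 1)
      (f' := fun t => Real.exp (∑ i, (f t).1 i) * M.θ t) ?_ ?_ ?_ ?_ ?_ ?_
    · filter_upwards [hl ▸ M.eventually_mem_interval] with t ht using hf.hasDerivAt_exp_sum ht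
    · exact Eventually.of_forall fun t => (hasDerivAt_id' t).sub_const r
    · simp
    · exact hl ▸ hf.tendsto_exp_sum hM he hh hp
    · have : Tendsto (fun t : ℝ => t - r) (𝓝 r) (𝓝 (r - r)) := by
        exact (continuous_id.sub continuous_const).tendsto r
      rw [sub_self] at this
      exact this.mono_left nhdsWithin_le_nhds
    · simpa using hl ▸ h1
  have hθ : Tendsto (fun t => (t - r) * M.θ t) (𝓝[>] r) (𝓝 1) := by
    have := (hl ▸ h1).div hV one_ne_zero
    rw [div_one] at this
    refine this.congr' ?_
    filter_upwards [self_mem_nhdsWithin] with t ht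
    have : t - r ≠ 0 := (sub_pos.2 ht).ne'
    have := (Real.exp_pos (∑ i, (f t).1 i)).ne'
    simp only [Pi.div_apply]
    field_simp
  have hθpos : ∀ᶠ t in 𝓝[>] r, 0 < M.θ t := hl ▸ hM.crushing.eventually_gt_atTop 0
  have hshift : Tendsto (fun t : ℝ => t + r) (𝓝[>] 0) (𝓝[>] r) := by
    refine tendsto_nhdsWithin_iff.2 ⟨?_, ?_⟩
    · have : Tendsto (fun t : ℝ => t + r) (𝓝 0) (𝓝 (0 + r)) :=
        (continuous_id.add continuous_const).tendsto 0
      rw [zero_add] at this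
      exact this.mono_left nhdsWithin_le_nhds
    · filter_upwards [self_mem_nhdsWithin] with t ht
      have : (0 : ℝ) < t := ht
      simpa using this
  refine ⟨fun i => ?_, fun i => ?_⟩
  · have h2 := hθ.mul (hl ▸ hf.tendsto_rate_div hM he i)
    rw [one_mul] at h2
    have h3 : Tendsto (fun t => (t - r) * (f t).2 i) (𝓝[>] r) (𝓝 (p i)) := by
      refine h2.congr' ?_
      filter_upwards [hθpos] with t ht
      field_simp
    simpa [Function.comp_def] using h3.comp hshift
  · have h2 := (hl ▸ hf.tendsto_scale_add_log hM he hh i).sub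
      ((hθ.log one_ne_zero).const_mul (p i))
    rw [Real.log_one, mul_zero, sub_zero] at h2
    have h3 : Tendsto (fun t => (f t).1 i - p i * Real.log (t - r)) (𝓝[>] r) (𝓝 0) := by
      refine h2.congr' ?_
      filter_upwards [hθpos, self_mem_nhdsWithin] with t ht htr
      rw [Real.log_mul (sub_pos.2 htr).ne' ht.ne']
      ring
    simpa [Function.comp_def] using h3.comp hshift

end Spacetime

end Geometry

section Geometry

variable {G : Type*} [TopologicalSpace G] [ChartedSpace (EuclideanSpace ℝ (Fin 3)) G] [Group G]

namespace Spacetime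

/-! ### Time translations -/

theorem ereal_add_lt_coe_iff {a : EReal} {τ t : ℝ} :
    a + (τ : EReal) < t ↔ a < ((t - τ : ℝ) : EReal) := by
  rw [EReal.coe_sub, EReal.lt_sub_iff_add_lt (by simp) (by simp)]

theorem ereal_coe_lt_add_iff {a : EReal} {τ t : ℝ} :
    (t : EReal) < a + (τ : EReal) ↔ ((t - τ : ℝ) : EReal) < a := by
  rw [EReal.coe_sub, EReal.sub_lt_iff (by simp) (by simp)]

/-- The spacetime translated in time by `τ`. -/
noncomputable def translate (M : Spacetime G) (τ : ℝ) : Spacetime G where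
  tMinus := M.tMinus + (τ : EReal)
  tPlus := M.tPlus + (τ : EReal)
  lt := EReal.add_lt_add_right_coe M.lt τ
  metric t := M.metric (t - τ)
  ρ t := M.ρ (t - τ)

theorem mem_interval_translate {M : Spacetime G} {τ t : ℝ} :
    t ∈ (M.translate τ).interval ↔ t - τ ∈ M.interval :=
  and_congr ereal_add_lt_coe_iff ereal_coe_lt_add_iff

theorem IsDiagonalSolution.translate {M : Spacetime G} {e : Module.Basis (Fin 3) ℝ (Alg G)}
    {n : Fin 3 → ℝ} {f : ℝ → Phase} (h : M.IsDiagonalSolution e n f) (τ : ℝ) :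
    (M.translate τ).IsDiagonalSolution e n fun t => f (t - τ) where
  sol t ht := (h.sol (t - τ) (mem_interval_translate.1 ht)).comp_sub_const t τ
  metric t ht := h.metric (t - τ) (mem_interval_translate.1 ht)
  density t ht := h.density (t - τ) (mem_interval_translate.1 ht)

/-! ### Solutions with equal metrics -/

variable {M M' : Spacetime G} {e : Module.Basis (Fin 3) ℝ (Alg G)} {n n' p : Fin 3 → ℝ}
  {f f' : ℝ → Phase} {h : LeftInvariantMetric G} {K : LeftInvariantEndomorphism G} {Ω₀ : ℝ}

theorem weingarten_congr {t : ℝ} (h : M'.metric =ᶠ[𝓝 t] M.metric) :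
    M'.weingarten t = M.weingarten t := by
  have h1 : ∀ X Y : Alg G, deriv (fun s => (M'.metric s).onAlg X Y) t =
      deriv (fun s => (M.metric s).onAlg X Y) t := fun X Y =>
    (h.fun_comp fun m => m.onAlg X Y).deriv_eq
  simp only [weingarten, h1, h.self_of_nhds]

theorem IsExtension.interval_subset (h : M'.IsExtension M) : M.interval ⊆ M'.interval :=
  fun _ ht => ⟨h.1.trans_lt ht.1, ht.2.trans_le h.2.1⟩

theorem IsExtension.weingarten_eq (h : M'.IsExtension M) {t : ℝ} (ht : t ∈ M.interval) :
    M'.weingarten t = M.weingarten t := by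
  refine weingarten_congr ?_
  filter_upwards [M.isOpen_interval.mem_nhds ht] with s hs using (h.2.2 s hs).1

theorem IsExtension.θ_eq (h : M'.IsExtension M) {t : ℝ} (ht : t ∈ M.interval) :
    M'.θ t = M.θ t := by
  rw [θ, θ, h.weingarten_eq ht]

/-- The metric coefficients determine α and the Weingarten map determines H, so the phase in a given
frame depends on the metric alone. -/
theorem IsExtension.phase_eq (h : M'.IsExtension M) (hf : M.IsDiagonalSolution e n f)
    (hf' : M'.IsDiagonalSolution e n' f') {t : ℝ} (ht : t ∈ M.interval) : f' t = f t := by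
  have ht' := h.interval_subset ht
  refine Prod.ext (funext fun i => ?_) (funext fun i => ?_)
  · have h1 := hf'.metric t ht' (e i) (e i)
    rw [(h.2.2 t ht).1, hf.metric t ht] at h1
    simp only [Module.Basis.repr_self, Finsupp.single_apply, mul_ite, mul_one, mul_zero,
      Finset.sum_ite_eq, Finset.mem_univ, if_true] at h1
    have := Real.exp_injective h1
    linarith
  · have h1 := hf'.weingarten_apply ht' (e i) i
    rw [h.weingarten_eq ht, hf.weingarten_apply ht] at h1
    simpa using h1.symm

theorem interval_eq_initialInterval (h : M.tMinus = (0 : ℝ)) :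
    M.interval = initialInterval M.tPlus := by
  ext t
  simp [interval, initialInterval, h]

theorem tPlus_pos (h : M.tMinus = (0 : ℝ)) : 0 < M.tPlus := by
  simpa [h] using M.lt

/-! ### Kasner-like solutions induce data on the singularity -/

theorem IsDiagonalSolution.tendsto_mul_θ (hf : M.IsDiagonalSolution e n f)
    (hM : M.tMinus = (0 : ℝ)) (hk : IsKasnerLike p f) (hp : ∑ i, p i = 1) :
    Tendsto (fun t => t * M.θ t) (𝓝[>] 0) (𝓝 1) := by
  have h1 := tendsto_finsetSum Finset.univ fun i _ => hk.rate i
  rw [hp] at h1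
  refine h1.congr' ?_
  filter_upwards [atLeftEnd_of_coe hM ▸ M.eventually_mem_interval] with t ht
  rw [hf.θ_eq ht, Finset.mul_sum]

theorem IsDiagonalSolution.crushing_of_isKasnerLike (hf : M.IsDiagonalSolution e n f)
    (hM : M.tMinus = (0 : ℝ)) (hk : IsKasnerLike p f) (hp : ∑ i, p i = 1) :
    Tendsto M.θ (𝓝[>] 0) atTop := by
  refine ((hf.tendsto_mul_θ hM hk hp).pos_mul_atTop one_pos tendsto_inv_nhdsGT_zero).congr' ?_
  filter_upwards [self_mem_nhdsWithin] with t ht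
  have : t ≠ 0 := ne_of_gt ht
  field_simp

theorem IsDiagonalSolution.weingarten_tendsto_of_isKasnerLike (hf : M.IsDiagonalSolution e n f)
    (hM : M.tMinus = (0 : ℝ)) (hk : IsKasnerLike p f) (hp : ∑ i, p i = 1)
    (he : IsEigenframe K e p) (X : Alg G) :
    Tendsto (fun t => M.normalisedWeingarten t X) (𝓝[>] 0) (𝓝 (K.onAlg X)) := by
  have hmem := atLeftEnd_of_coe hM ▸ M.eventually_mem_interval
  have h1 : ∀ i, Tendsto (fun t => (M.θ t)⁻¹ * (f t).2 i) (𝓝[>] 0) (𝓝 (p i)) := fun i => by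
    have h2 := (hk.rate i).div (hf.tendsto_mul_θ hM hk hp) one_ne_zero
    rw [div_one] at h2
    refine h2.congr' ?_
    filter_upwards [self_mem_nhdsWithin] with t ht
    have : t ≠ 0 := ne_of_gt ht
    rw [Pi.div_apply, mul_div_mul_left _ _ this, div_eq_inv_mul]
  have h2 : Tendsto (fun t => ∑ i, ((M.θ t)⁻¹ * (f t).2 i * e.repr X i) • e i) (𝓝[>] 0)
      (𝓝 (∑ i, (p i * e.repr X i) • e i)) :=
    tendsto_finsetSum _ fun i _ => ((h1 i).mul_const _).smul_const _
  have h3 : K.onAlg X = ∑ i, (p i * e.repr X i) • e i := by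
    conv_lhs => rw [← e.sum_repr X, map_sum]
    exact Finset.sum_congr rfl fun i _ => by rw [map_smul, he.eigen, smul_smul, mul_comm]
  rw [h3]
  refine h2.congr' ?_
  filter_upwards [hmem] with t ht
  conv_rhs => rw [normalisedWeingarten, LinearMap.smul_apply, ← e.sum_repr (M.weingarten t X),
    Finset.smul_sum]
  exact Finset.sum_congr rfl fun i _ => by rw [hf.weingarten_apply ht, smul_smul, mul_assoc]

theorem IsDiagonalSolution.density_eq_of_isKasnerLike (hf : M.IsDiagonalSolution e n f)
    (hM : M.tMinus = (0 : ℝ)) (hk : IsKasnerLike p f) (hp : ∑ i, p i = 1)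
    (hnp : ∀ i, n i ≠ 0 → 0 < p i) {t : ℝ} (ht : t ∈ M.interval) :
    Real.exp (∑ i, (f t).1 i) ^ 2 * M.ρ t = (1 - ∑ i, p i ^ 2) / 2 := by
  have hI := interval_eq_initialInterval hM
  rw [hf.density t ht]
  exact hk.constraintDensity_eq hp hnp (fun s hs => hf.sol s (hI ▸ hs)) (hI ▸ ht)

/-- Since V²ρ = Ω₀/3, one has Ω = 3ρ/θ² = Ω₀/(Vθ)², and Vθ → 1. -/
theorem IsDiagonalSolution.Ω_tendsto_of_isKasnerLike (hf : M.IsDiagonalSolution e n f)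
    (hM : M.tMinus = (0 : ℝ)) (hk : IsKasnerLike p f) (hp : ∑ i, p i = 1)
    (hnp : ∀ i, n i ≠ 0 → 0 < p i) (hΩ : ∑ i, p i ^ 2 + 2 * Ω₀ / 3 = 1) :
    Tendsto M.Ω (𝓝[>] 0) (𝓝 Ω₀) := by
  have h1 := (hk.exp_sum hp).mul (hf.tendsto_mul_θ hM hk hp)
  have h2 : Tendsto (fun t => Ω₀ /
      (Real.exp (∑ i, (f t).1 i) / t * (t * M.θ t)) ^ 2) (𝓝[>] 0) (𝓝 (Ω₀ / (1 * 1) ^ 2)) :=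
    tendsto_const_nhds.div (h1.pow 2) (by norm_num)
  rw [one_mul, one_pow, div_one] at h2
  refine h2.congr' ?_
  filter_upwards [self_mem_nhdsWithin, atLeftEnd_of_coe hM ▸ M.eventually_mem_interval,
    (hf.crushing_of_isKasnerLike hM hk hp).eventually_gt_atTop 0] with t ht htI hθ
  have h3 := hf.density_eq_of_isKasnerLike hM hk hp hnp htI
  have h4 : Ω₀ = 3 * (Real.exp (∑ i, (f t).1 i) ^ 2 * M.ρ t) := by rw [h3]; linarith
  have h5 : t ≠ 0 := ne_of_gt ht
  have h6 := (Real.exp_pos (∑ i, (f t).1 i)).ne'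
  rw [Ω, h4]
  field_simp

theorem IsDiagonalSolution.tendsto_scale_of_isKasnerLike (hf : M.IsDiagonalSolution e n f)
    (hM : M.tMinus = (0 : ℝ)) (hk : IsKasnerLike p f) (hp : ∑ i, p i = 1) (i : Fin 3) :
    Tendsto (fun t => Real.exp ((f t).1 i) * M.θ t ^ p i) (𝓝[>] 0) (𝓝 1) := by
  have h1 := (hk.scale i).add (((hf.tendsto_mul_θ hM hk hp).log one_ne_zero).const_mul (p i))
  rw [Real.log_one, mul_zero, add_zero] at h1
  have h2 := (Real.continuous_exp.tendsto _).comp h1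
  rw [Real.exp_zero] at h2
  refine h2.congr' ?_
  filter_upwards [self_mem_nhdsWithin,
    (hf.crushing_of_isKasnerLike hM hk hp).eventually_gt_atTop 0] with t ht hθ
  rw [Function.comp_apply, Real.rpow_def_of_pos hθ, ← Real.exp_add,
    Real.log_mul (ne_of_gt ht) hθ.ne']
  ring_nf

theorem IsDiagonalSolution.metric_form_of_isKasnerLike (hf : M.IsDiagonalSolution e n f)
    (hM : M.tMinus = (0 : ℝ)) (hk : IsKasnerLike p f) (hp : ∑ i, p i = 1)
    (he : IsEigenframe K e p) (hh : ∀ X Y, h.onAlg X Y = ∑ i, e.repr X i * e.repr Y i)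
    {e' : Module.Basis (Fin 3) ℝ (Alg G)} {p' : Fin 3 → ℝ} (he' : IsEigenframe K e' p') :
    ∃ t₀ ∈ M.interval, ∃ b : Fin 3 → ℝ → ℝ,
      (∀ t ∈ M.interval, t ≤ t₀ → 0 < M.θ t ∧ (∀ i, 0 < b i t) ∧
        ∀ X Y : Alg G, (M.metric t).onAlg X Y =
          ∑ i, b i t ^ 2 * M.θ t ^ (-2 * p' i) * (e'.repr X i * e'.repr Y i)) ∧
      ∀ X Y : Alg G, Tendsto (fun t => ∑ i, b i t ^ 2 * (e'.repr X i * e'.repr Y i))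
        (𝓝[>] 0) (𝓝 (h.onAlg X Y)) := by
  obtain ⟨rfl, c, hc, hec⟩ := he.exists_scaling he'
  have hrepr := fun X i => repr_eq_mul_of_scaling (σ := 1) hec X i
  simp only [Equiv.Perm.one_apply] at hrepr
  have hev := (hf.crushing_of_isKasnerLike hM hk hp).eventually_gt_atTop 0
  obtain ⟨u, hu, hsub⟩ := (mem_nhdsGT_iff_exists_Ioo_subset).1 hev
  have hu : 0 < u := hu
  obtain ⟨t₀, ht₀, ht₀u⟩ := ((atLeftEnd_of_coe hM ▸ M.eventually_mem_interval).and
    (Ioo_mem_nhdsGT hu)).exists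
  have hprod : ∀ (a : ℝ) i x y, (a / |c i|) ^ 2 * (c i * x * (c i * y)) = a ^ 2 * (x * y) :=
    fun a i x y => by
      have := hc i
      rw [div_pow, sq_abs]
      field_simp
  -- The functions are e^{α_i} θ^{p_i}, divided by |c_i| to pass from the orthonormal eigenframe to
  -- an arbitrary one; `t₀` lies below `u`, so θ > 0 up to it.
  refine ⟨t₀, ht₀, fun i t => Real.exp ((f t).1 i) * M.θ t ^ p i / |c i|, fun t ht htt => ?_,
    fun X Y => ?_⟩
  · have ht0 : 0 < t := by
      rw [interval_eq_initialInterval hM] at ht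
      exact ht.1
    have hθ : 0 < M.θ t := hsub ⟨ht0, htt.trans_lt ht₀u.2⟩
    refine ⟨hθ, fun i => ?_, fun X Y => ?_⟩
    · exact div_pos (mul_pos (Real.exp_pos _) (Real.rpow_pos_of_pos hθ _)) (abs_pos.2 (hc i))
    · rw [hf.metric t ht]
      refine Finset.sum_congr rfl fun i _ => ?_
      rw [mul_right_comm, hrepr, hrepr, hprod, mul_pow, two_mul, Real.exp_add]
      have h1 : (M.θ t ^ p i) ^ 2 * M.θ t ^ (-2 * p i) = 1 := by
        rw [← Real.rpow_natCast, ← Real.rpow_mul hθ.le, ← Real.rpow_add hθ]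
        simp [mul_comm]
      linear_combination (-Real.exp ((f t).1 i) ^ 2 * (e.repr X i * e.repr Y i)) * h1
  · rw [hh]
    refine tendsto_finsetSum _ fun i _ => ?_
    simp only [hrepr, hprod]
    simpa using ((hf.tendsto_scale_of_isKasnerLike hM hk hp i).pow 2).mul_const
      (e.repr X i * e.repr Y i)

theorem IsDiagonalSolution.inducesData (hf : M.IsDiagonalSolution e n f)
    (hM : M.tMinus = (0 : ℝ)) (hk : IsKasnerLike p f) (hp : ∑ i, p i = 1)
    (hnp : ∀ i, n i ≠ 0 → 0 < p i) (hΩ : ∑ i, p i ^ 2 + 2 * Ω₀ / 3 = 1)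
    (he : IsEigenframe K e p) (hh : ∀ X Y, h.onAlg X Y = ∑ i, e.repr X i * e.repr Y i) :
    M.InducesData h K Ω₀ := by
  have hl := atLeftEnd_of_coe hM
  constructor
  · rw [hl]
    exact hf.crushing_of_isKasnerLike hM hk hp
  · rw [hl]
    exact hf.weingarten_tendsto_of_isKasnerLike hM hk hp he
  · rw [hl]
    exact hf.Ω_tendsto_of_isKasnerLike hM hk hp hnp hΩ
  · rw [hl]
    exact fun e' p' he' => hf.metric_form_of_isKasnerLike hM hk hp he hh he'

/-! ### Maximality and uniqueness -/

/-- The solution is maximal among the solutions of the class A equations starting at the same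
singularity at `t = 0`. -/
def IsMaximalPhase (n : Fin 3 → ℝ) (T : EReal) (f : ℝ → Phase) : Prop :=
  ∀ (T' : EReal) (g : ℝ → Phase),
    (∀ t ∈ initialInterval T', HasDerivAt g (classAField n (g t)) t) → g =ᶠ[𝓝[>] 0] f →
      T' ≤ T ∧ ∀ t ∈ initialInterval T', g t = f t

/-- An extension past t = 0 would have continuous Σ H_i there, contradicting θ → ∞. To the right, an
extension is an orbit with the same germ at 0, which cannot outlive the maximal one. -/
theorem IsDiagonalSolution.extension_eq [LieGroup (𝓡 3) ∞ G] (hf : M.IsDiagonalSolution e n f)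
    (hn : IsClassAFrame e n) (hM : M.tMinus = (0 : ℝ)) (hmax : IsMaximalPhase n M.tPlus f)
    (hdata : M.InducesData h K Ω₀) (he : IsEigenframe K e p) (hM' : M'.IsStiffFluidSolution)
    (hext : M'.IsExtension M) : M'.tMinus = M.tMinus ∧ M'.tPlus = M.tPlus := by
  have hl := atLeftEnd_of_coe hM
  have hmem := M.eventually_mem_interval
  -- The extension shares the limit of the Weingarten map along the left end of `M`, so it too is
  -- diagonal in `e`.
  obtain ⟨f', hf'⟩ := hM'.exists_isDiagonalSolution he hn
    (hmem.mono fun t ht => hext.interval_subset ht) fun X => by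
      refine (hdata.weingarten_tendsto X).congr' ?_
      filter_upwards [hmem] with t ht
      rw [normalisedWeingarten, normalisedWeingarten, hext.weingarten_eq ht, hext.θ_eq ht]
  have hminus : M'.tMinus = M.tMinus := by
    refine le_antisymm hext.1 (not_lt.1 fun hlt => ?_)
    have h0 : (0 : ℝ) ∈ M'.interval :=
      ⟨hM ▸ hlt, lt_of_lt_of_le (by simpa using tPlus_pos hM) hext.2.1⟩
    have h1 : Tendsto (fun t => ∑ i, (f' t).2 i) (𝓝[>] 0) (𝓝 (∑ i, (f' 0).2 i)) :=
      tendsto_finsetSum _ fun i _ =>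
        ((hasDerivAt_classA_iff.1 (hf'.sol 0 h0)).2 i).continuousAt.mono_left nhdsWithin_le_nhds
    have h2 := hdata.crushing
    rw [hl] at h2 hmem
    refine not_tendsto_atTop_of_tendsto_nhds h1 (h2.congr' ?_)
    filter_upwards [hmem] with t ht
    rw [← hf'.θ_eq (hext.interval_subset ht), hext.θ_eq ht]
  refine ⟨hminus, le_antisymm ?_ hext.2.1⟩
  refine (hmax M'.tPlus f' (fun t ht => hf'.sol t ?_) ?_).1
  · rwa [interval_eq_initialInterval (hminus.trans hM)]
  · rw [hl] at hmem
    filter_upwards [hmem] with t ht using hext.phase_eq hf hf' ht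

/-- Shifted to start at 0, `M'` has the same Kasner asymptotics as `M`, hence the same germ, and
lies inside the maximal orbit. So a translate of `M` extends `M'`, and the maximality of `M'` makes
the endpoints agree. -/
theorem IsDevelopment.isTimeTranslate [LieGroup (𝓡 3) ∞ G] (hf : M.IsDiagonalSolution e n f)
    (hn : IsClassAFrame e n) (hM : M.tMinus = (0 : ℝ)) (hmax : IsMaximalPhase n M.tPlus f)
    (hk : IsKasnerLike p f) (hp : ∑ i, p i = 1) (hnp : ∀ i, n i ≠ 0 → 0 < p i)
    (hρ : ∀ t ∈ M.interval, 0 ≤ M.ρ t)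
    (he : IsEigenframe K e p) (hh : ∀ X Y, h.onAlg X Y = ∑ i, e.repr X i * e.repr Y i)
    (hM' : M'.IsDevelopment) (hdata : M'.InducesData h K Ω₀) :
    ∃ τ : ℝ, M'.IsTimeTranslate M τ := by
  obtain ⟨f', hf'⟩ := hM'.1.exists_isDiagonalSolution he hn M'.eventually_mem_interval
    hdata.weingarten_tendsto
  obtain ⟨r, hr⟩ := hf'.exists_tMinus_eq hdata he hh hp
  have hk' := hf'.isKasnerLike hdata he hh hp hr
  have hg := hf'.translate (-r)
  simp only [sub_neg_eq_add] at hg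
  have h0 : (M'.translate (-r)).tMinus = (0 : ℝ) := by
    simp only [translate, hr]
    rw [← EReal.coe_add, add_neg_cancel]
  have hgI := interval_eq_initialInterval h0
  have hsol : ∀ t ∈ initialInterval (M'.translate (-r)).tPlus,
      HasDerivAt (fun t => f' (t + r)) (classAField n (f' (t + r))) t := fun t ht =>
    hg.sol t (hgI ▸ ht)
  have heq := hk'.eventuallyEq hk hp hnp (tPlus_pos h0) (tPlus_pos hM) hsol
    fun t ht => hf.sol t (interval_eq_initialInterval hM ▸ ht)
  obtain ⟨hT, hgf⟩ := hmax _ _ hsol heq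
  have hphase : ∀ t ∈ M'.interval, f' t = f (t - r) := fun t ht => by
    have := hgf (t - r) (hgI ▸ mem_interval_translate.2 (by simpa using ht))
    simpa using this
  have hNminus : (M.translate r).tMinus = M'.tMinus := by
    simp [translate, hM, hr]
  have hNplus : M'.tPlus ≤ (M.translate r).tPlus := by
    have h1 : M'.tPlus - (r : EReal) ≤ M.tPlus := by
      simpa [translate, sub_eq_add_neg] using hT
    exact (EReal.sub_le_iff_le_add (by simp) (by simp)).1 h1
  have hsub : M'.interval ⊆ (M.translate r).interval := fun t ht =>
    ⟨hNminus ▸ ht.1, ht.2.trans_le hNplus⟩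
  have hNf := hf.translate r
  have hmetric : ∀ t ∈ M'.interval, (M.translate r).metric t = M'.metric t ∧
      (M.translate r).ρ t = M'.ρ t := fun t ht => by
    refine ⟨LeftInvariantMetric.ext_onAlg fun X Y => ?_, ?_⟩
    · rw [hNf.metric t (hsub ht), hf'.metric t ht, hphase t ht]
    · rw [hNf.density t (hsub ht), hf'.density t ht, hphase t ht]
  have hNsol : (M.translate r).IsStiffFluidSolution := (isStiffFluidSolution_iff _).2
    ⟨e, n, _, hn, hNf, fun t ht => hρ _ (mem_interval_translate.1 ht)⟩
  obtain ⟨-, hplus⟩ := hM'.2 _ hNsol ⟨hNminus.le, hNplus, hmetric⟩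
  refine ⟨r, hNminus.symm, hplus.symm, fun t ht => ?_⟩
  have ht' : t + r ∈ (M.translate r).interval := mem_interval_translate.2 (by simpa using ht)
  have ht'' : t + r ∈ M'.interval := ⟨hNminus ▸ ht'.1, hplus ▸ ht'.2⟩
  have h1 := hmetric _ ht''
  simp only [translate, add_sub_cancel_right] at h1
  exact ⟨h1.1.symm, h1.2.symm⟩

end Spacetime

open Spacetime in
/-- Existence and uniqueness of developments of quiescent initial data on the singularity. -/
theorem IsQuiescentData.exists_development [LieGroup (𝓡 3) ∞ G] {h : LeftInvariantMetric G}
    {K : LeftInvariantEndomorphism G} {Ω₀ : ℝ} (hdata : IsQuiescentData h K Ω₀) :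
    ∃ M : Spacetime G, M.IsDevelopment ∧ M.InducesData h K Ω₀ ∧
      (Ω₀ = 0 → ∀ t ∈ M.interval, M.ρ t = 0) ∧
      ∀ M' : Spacetime G, M'.IsDevelopment → M'.InducesData h K Ω₀ →
        ∃ τ : ℝ, M'.IsTimeTranslate M τ := by
  obtain ⟨e, p, n, he, hh, hn, hnp, hp, hΩ⟩ := hdata.exists_frame
  obtain ⟨T₀, f₀, hT₀, hsol₀, hk₀⟩ := exists_kasnerLike hp hnp
  have hX : ContDiff ℝ 1 (classAField n) := (contDiff_classAField n).of_le (by simp)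
  obtain ⟨T, f, hT, hff₀, hsol, hmax₀⟩ := exists_maximal_solution hX hT₀ hsol₀
  -- Kasner asymptotics depend only on the germ at 0, which the maximal continuation does not
  -- change.
  have hk : IsKasnerLike p f :=
    ⟨fun i => (hk₀.rate i).congr' (hff₀.symm.mono fun t ht => by simp only [ht]),
      fun i => (hk₀.scale i).congr' (hff₀.symm.mono fun t ht => by simp only [ht])⟩
  have hmax : IsMaximalPhase n T f := fun T' g hg hgf => hmax₀ T' g hg (hgf.trans hff₀)
  let M : Spacetime G := ⟨(0 : ℝ), T, by simpa using hT, fun t => diagonalMetric e (f t).1,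
    fun t => constraintDensity n (f t)⟩
  have hM : M.tMinus = (0 : ℝ) := rfl
  have hf : M.IsDiagonalSolution e n f :=
    ⟨fun t ht => hsol t (interval_eq_initialInterval hM ▸ ht),
      fun t _ => diagonalMetric_onAlg e (f t).1, fun t _ => rfl⟩
  -- The conserved value V²ρ = Ω₀/3 yields both ρ ≥ 0 and, for Ω₀ = 0, the vacuum case.
  have hρ : ∀ t ∈ M.interval, Real.exp (∑ i, (f t).1 i) ^ 2 * M.ρ t = Ω₀ / 3 := fun t ht => by
    rw [hf.density_eq_of_isKasnerLike hM hk hp hnp ht]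
    linarith
  have hρ0 : ∀ t ∈ M.interval, 0 ≤ M.ρ t := fun t ht => by
    refine nonneg_of_mul_nonneg_right ?_ (pow_pos (Real.exp_pos (∑ i, (f t).1 i)) 2)
    rw [hρ t ht]
    exact div_nonneg hdata.nonneg (by norm_num)
  have hind := hf.inducesData hM hk hp hnp hΩ he hh
  refine ⟨M, ⟨(isStiffFluidSolution_iff M).2 ⟨e, n, f, hn, hf, hρ0⟩, fun M' hM' hext =>
    hf.extension_eq hn hM hmax hind he hM' hext⟩, hind, fun h0 t ht => ?_,
    fun M' hM' hdata' => hM'.isTimeTranslate hf hn hM hmax hk hp hnp hρ0 he hh hdata'⟩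
  have := hρ t ht
  rw [h0, zero_div] at this
  exact (mul_eq_zero.1 this).resolve_left (pow_pos (Real.exp_pos _) 2).ne'

end Geometry

end Bianchi

theorem mainTheorem1 {G : Type*} [TopologicalSpace G]
    [ChartedSpace (EuclideanSpace ℝ (Fin 3)) G] [Group G] [LieGroup (𝓡 3) ∞ G]
    (h : Bianchi.LeftInvariantMetric G) (K : Bianchi.LeftInvariantEndomorphism G) (Ω₀ : ℝ)
    (hdata : Bianchi.IsQuiescentData h K Ω₀) :
    ∃ M : Bianchi.Spacetime G, M.IsDevelopment ∧ M.InducesData h K Ω₀ ∧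
      (Ω₀ = 0 → ∀ t ∈ M.interval, M.ρ t = 0) ∧
      ∀ M' : Bianchi.Spacetime G, M'.IsDevelopment → M'.InducesData h K Ω₀ →
        ∃ τ : ℝ, M'.IsTimeTranslate M τ :=
  hdata.exists_development
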